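/- Proposition 4. Let $(M_1,g_1),\dots,(M_N,g_N)$ be oriented Riemannian manifolds of dimensions $D_1,\dots,D_N$ with spin structures $P_i\to P_{SO}(M_i)$, and let $S_i=P_i\times_{\mathrm{Spin}(D_i)}\Delta_i$ be their spinor bundles, where $\Delta_i$ is an irreducible complex module of the Clifford algebra $C\ell(D_i)$ (unit vectors square to $-1$). Let $M=M_1\times\cdots\times M_N$ carry the product metric and the product orientation, put $D=D_1+\cdots+D_N$, and let $$P=(P_1\times\cdots\times P_N)\times_{\mathrm{Spin}(D_1)\times\cdots\times\mathrm{Spin}(D_N)}\mathrm{Spin}(D)$$ be the induced spin structure of $M$, so that $P_1\times\cdots\times P_N$ is a reduction of $P$; here $[p,b]$ is sent to the frame obtained by joining the frames of the $p_i$ and rotating by $b$. For $D_i$ even let $S_i=S_i^+\oplus S_i^-$ be the decomposition into the eigenbundles, for the eigenvalues $\pm1$, of the normalized volume element $i^{D_i/2}e_1\cdots e_{D_i}$; for $D_i$ odd put $S_i^+=S_i^-=S_i$. Let $W=\bigotimes_{i=1}^N(S_i^+\oplus S_i^-)$, a bundle over $M$. Let $N_o$ be the number of indices $i$ with $D_i$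 odd, choose a set $T$ of $N_o-[N_o/2]$ of these indices, and let $S\subset W$ be the subbundle in which the factor $S_i^+\oplus S_i^-=S_i\oplus S_i$ is replaced by its diagonal $\{(\xi,\xi)\}$ for every $i\in T$. Let $\hat S$ be its standard fibre, constructed in the same way from the $\Delta_i$. Then for every irreducible complex $C\ell(D)$-module $\Delta$ the spinor bundle $P\times_{\mathrm{Spin}(D)}\Delta$ of $M$ is isomorphic to $S$ as a smooth complex vector bundle, and the isomorphism $\varphi:S\to P\times_{\mathrm{Spin}(D)}\Delta$ can be chosen compatible with the reduction: there is a linear isomorphism $L:\hat S\to\Delta$ such that for all $p\in P_1\times\cdots\times P_N$ the map $\varphi$ becomes $L$ if $S$ is identified with $\hat S$, and the spinor bundle with $\Delta$, by means of $p$. If moreover $T$ contains at most the last index $N$, then $S$ is stable under the Clifford multiplication of $W$, $$X\,(\xi_1\otimes\cdots\otimes\xi_N)=\sum_{i=1}^N(-1)^{\epsilon_1+\cdots+\epsilon_{i-1}}\,\xi_1\otimes\cdots\otimes X_i\xi_i\otimes\cdots\otimes\xi_N,\qquad X_i(\xi^+,\xi^-)=(X_i\xi^-,X_i\xi^+),$$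 for $X=X_1+\cdots+X_N\in TM=\bigoplus_i TM_i$ and homogeneous $\xi_j\in S_j^{\epsilon_j}$, and the same $\varphi$ can be chosen such that $\varphi(X\Xi)=\varepsilon\,X\varphi(\Xi)$ for all $X$ and $\Xi$, with a constant sign $\varepsilon\in\{1,-1\}$ which is $1$ if $D$ is even. -/

import Mathlib

open scoped Manifold ContDiff TensorProduct
open Bundle CliffordAlgebra

universe u v v' w w' f m

noncomputable section

namespace SpinProduct

section Clifford

variable (κ : Type) [Fintype κ]

/-- The quadratic form `v ↦ -|v|²`, so that unit vectors square to `-1` in the Clifford algebra. -/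
def stdForm : QuadraticForm ℝ (κ → ℝ) :=
  QuadraticMap.weightedSumSquares ℝ (fun _ : κ => (-1 : ℝ))

/-- The real Clifford algebra of Euclidean space with basis indexed by `κ`. -/
abbrev Cl : Type := CliffordAlgebra (stdForm κ)

/-- The spin group of Euclidean space with basis indexed by `κ`. -/
abbrev Spin : Submonoid (Cl κ) := spinGroup (stdForm κ)

variable {κ}

lemma stdForm_apply (v : κ → ℝ) : stdForm κ v = -∑ k, v k * v k := by
  simp [stdForm, QuadraticMap.weightedSumSquares_apply]

lemma ι_injective : Function.Injective (ι (stdForm κ)) := by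
  intro v w h
  have := congrArg (equivExterior (stdForm κ)) h
  simp only [equivExterior, changeFormEquiv_apply, changeForm_ι] at this
  exact (ExteriorAlgebra.ι_inj ℝ v w).1 this

instance : FiniteDimensional ℝ (Cl κ) := by
  let := LinearOrder.lift' _ (Fintype.equivFin κ).injective
  have b := (Module.Basis.ExteriorAlgebra (Pi.basisFun ℝ κ))
  have : Module.Finite ℝ (ExteriorAlgebra ℝ (κ → ℝ)) := Module.Finite.of_basis b
  exact Module.Finite.equiv (equivExterior (stdForm κ)).symm

lemma conj_mem (a : Spin κ) (v : κ → ℝ) :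
    (a : Cl κ) * ι (stdForm κ) v * ((a⁻¹ : Spin κ) : Cl κ) ∈ LinearMap.range (ι (stdForm κ)) := by
  have := spinGroup.conjAct_smul_ι_mem_range_ι (Q := stdForm κ) (x := spinGroup.toUnits a) a.2 v
  simpa [ConjAct.units_smul_def, ← map_inv] using this

/-- The covering homomorphism `Spin → SO`: the rotation `v ↦ a v a⁻¹`. -/
def rot (a : Spin κ) : (κ → ℝ) →ₗ[ℝ] (κ → ℝ) :=
  (LinearEquiv.ofInjective (ι (stdForm κ)) ι_injective).symm.toLinearMap ∘ₗ
    ((LinearMap.mulLeft ℝ (a : Cl κ) ∘ₗ LinearMap.mulRight ℝ ((a⁻¹ : Spin κ) : Cl κ)) ∘ₗ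
      ι (stdForm κ)).codRestrict (LinearMap.range (ι (stdForm κ)))
        (fun v => by simpa [mul_assoc] using conj_mem a v)

lemma ι_rot (a : Spin κ) (v : κ → ℝ) :
    ι (stdForm κ) (rot a v) = a * ι (stdForm κ) v * ((a⁻¹ : Spin κ) : Cl κ) := by
  have h : ∀ y : LinearMap.range (ι (stdForm κ)),
      ι (stdForm κ) ((LinearEquiv.ofInjective (ι (stdForm κ)) ι_injective).symm y) = y := by
    intro y
    have := congrArg Subtype.val
      ((LinearEquiv.ofInjective (ι (stdForm κ)) ι_injective).apply_symm_apply y)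
    simpa using this
  simp [rot, h, mul_assoc]

lemma coe_mul_coe_inv (a : Spin κ) : (a : Cl κ) * ((a⁻¹ : Spin κ) : Cl κ) = 1 := by
  rw [← Submonoid.coe_mul, mul_inv_cancel, Submonoid.coe_one]

lemma coe_inv_mul_coe (a : Spin κ) : ((a⁻¹ : Spin κ) : Cl κ) * (a : Cl κ) = 1 := by
  rw [← Submonoid.coe_mul, inv_mul_cancel, Submonoid.coe_one]

lemma rot_mul (a b : Spin κ) (v : κ → ℝ) : rot (a * b) v = rot a (rot b v) := by
  apply ι_injective
  simp [ι_rot, mul_assoc]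

lemma rot_one (v : κ → ℝ) : rot (1 : Spin κ) v = v := by
  apply ι_injective
  simp [ι_rot]

/-- The rotation attached to an element of the spin group, as a linear automorphism. -/
def rotEquiv (a : Spin κ) : (κ → ℝ) ≃ₗ[ℝ] (κ → ℝ) :=
  LinearEquiv.ofLinearMap (rot a) (rot a⁻¹)
    (LinearMap.ext fun v => by simp [← rot_mul, rot_one])
    (LinearMap.ext fun v => by simp [← rot_mul, rot_one])

lemma stdForm_rot (a : Spin κ) (v : κ → ℝ) : stdForm κ (rot a v) = stdForm κ v := by
  have h1 := ι_sq_scalar (stdForm κ) (rot a v)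
  have h2 := ι_sq_scalar (stdForm κ) v
  have inv := coe_inv_mul_coe a
  have key : ι (stdForm κ) (rot a v) * ι (stdForm κ) (rot a v) =
      algebraMap ℝ (Cl κ) (stdForm κ v) := by
    rw [ι_rot]
    calc _ = (a : Cl κ) * ι (stdForm κ) v * (((a⁻¹ : Spin κ) : Cl κ) * a) * ι (stdForm κ) v *
          ((a⁻¹ : Spin κ) : Cl κ) := by simp only [mul_assoc]
      _ = (a : Cl κ) * (ι (stdForm κ) v * ι (stdForm κ) v) * ((a⁻¹ : Spin κ) : Cl κ) := by
          rw [inv]; simp only [mul_assoc, mul_one]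
      _ = _ := by
          rw [h2, ← Algebra.commutes, mul_assoc, coe_mul_coe_inv, mul_one]
  rw [h1] at key
  exact (algebraMap ℝ (Cl κ)).injective key

lemma dot_rot (a : Spin κ) (v w : κ → ℝ) : rot a v ⬝ᵥ rot a w = v ⬝ᵥ w := by
  have h := stdForm_rot a (v + w)
  have hv := stdForm_rot a v
  have hw := stdForm_rot a w
  rw [map_add] at h
  simp only [stdForm_apply, Pi.add_apply, mul_add, add_mul, Finset.sum_add_distrib] at h hv hw
  simp only [dotProduct]
  have c1 : ∑ k, rot a w k * rot a v k = ∑ k, rot a v k * rot a w k :=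
    Finset.sum_congr rfl fun _ _ => mul_comm _ _
  have c2 : ∑ k, w k * v k = ∑ k, v k * w k := Finset.sum_congr rfl fun _ _ => mul_comm _ _
  rw [c1, c2] at h
  linarith

lemma exists_twisted (x : (Cl κ)ˣ) (hx : x ∈ lipschitzGroup (stdForm κ)) :
    ∃ (ε : ℝ) (A : (κ → ℝ) →ₗ[ℝ] (κ → ℝ)), (ε = 1 ∨ ε = -1) ∧ LinearMap.det A = ε ∧
      involute (x : Cl κ) = ε • (x : Cl κ) ∧
      ∀ w, ι (stdForm κ) (A w) * x = involute (x : Cl κ) * ι (stdForm κ) w := by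
  induction hx using Subgroup.closure_induction with
  | mem x hx =>
    obtain ⟨v, hv⟩ := hx
    have hQ : stdForm κ v ≠ 0 := by
      intro h0
      have := ι_sq_scalar (stdForm κ) v
      rw [h0, map_zero, hv] at this
      exact (x * x).ne_zero (by simp at this)
    set q := stdForm κ v with hq
    let f : Module.Dual ℝ (κ → ℝ) := (-q⁻¹) • (QuadraticMap.polarBilin (stdForm κ) v)
    refine ⟨-1, LinearMap.transvection f v, Or.inr rfl, ?_, ?_, ?_⟩
    · rw [LinearMap.transvection.det]
      simp only [f, LinearMap.smul_apply, QuadraticMap.polarBilin_apply_apply,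
        QuadraticMap.polar_self, smul_eq_mul, ← hq]
      field_simp; ring
    · rw [← hv]; simp
    · intro w
      rw [← hv, involute_ι, LinearMap.transvection.apply, map_add, map_smul, add_mul, smul_mul_assoc,
        ι_sq_scalar, ← hq, Algebra.smul_def, ← (algebraMap ℝ (Cl κ)).map_mul, neg_mul,
        ι_mul_ι_comm]
      simp only [f, LinearMap.smul_apply, QuadraticMap.polarBilin_apply_apply, smul_eq_mul]
      have : -q⁻¹ * QuadraticMap.polar (stdForm κ) v w * q = -QuadraticMap.polar (stdForm κ) v w := by
        field_simp
      rw [this, map_neg, QuadraticMap.polar_comm _ w v]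
      abel
  | one => exact ⟨1, LinearMap.id, Or.inl rfl, by simp, by simp, by simp⟩
  | mul x y _ _ hx hy =>
    obtain ⟨ε, A, hε, hA, hi, h⟩ := hx
    obtain ⟨ε', A', hε', hA', hi', h'⟩ := hy
    refine ⟨ε * ε', A ∘ₗ A', ?_, ?_, ?_, ?_⟩
    · rcases hε with rfl | rfl <;> rcases hε' with rfl | rfl <;> simp
    · rw [LinearMap.det_comp, hA, hA']
    · simp [hi, hi', smul_smul, mul_comm]
    · intro w
      simp only [LinearMap.comp_apply, Units.val_mul, map_mul, mul_assoc]
      rw [← mul_assoc, h, mul_assoc, h']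
  | inv x _ hx =>
    obtain ⟨ε, A, hε, hA, hi, h⟩ := hx
    have hε0 : ε ≠ 0 := by rcases hε with rfl | rfl <;> norm_num
    have hεε : ε⁻¹ = ε := by rcases hε with rfl | rfl <;> norm_num
    have hu : IsUnit (LinearMap.det A) := by rw [hA]; exact hε0.isUnit
    let e := LinearMap.equivOfDetNeZero A (by rw [hA]; exact hε0)
    have hei : involute ((x⁻¹ : (Cl κ)ˣ) : Cl κ) = ε • ((x⁻¹ : (Cl κ)ˣ) : Cl κ) := by
      have h1 : involute ((x⁻¹ : (Cl κ)ˣ) : Cl κ) * involute (x : Cl κ) = 1 := by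
        rw [← map_mul, Units.inv_mul, map_one]
      rw [hi, mul_smul_comm] at h1
      have h2 := congrArg (· * ((x⁻¹ : (Cl κ)ˣ) : Cl κ)) h1
      simp only [smul_mul_assoc, Units.mul_inv_cancel_right, one_mul] at h2
      rw [← h2, smul_smul, show ε * ε = 1 by rcases hε with rfl | rfl <;> norm_num, one_smul, h2]
    refine ⟨ε, e.symm, hε, ?_, hei, ?_⟩
    · have : LinearMap.det A * LinearMap.det (e.symm : (κ → ℝ) →ₗ[ℝ] (κ → ℝ)) = 1 := by
        rw [← LinearMap.det_comp]
        have : A ∘ₗ (e.symm : (κ → ℝ) →ₗ[ℝ] (κ → ℝ)) = LinearMap.id := by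
          exact LinearMap.ext fun v => e.apply_symm_apply v
        rw [this, LinearMap.det_id]
      rw [hA] at this
      rw [← hεε]; exact eq_inv_of_mul_eq_one_right this
    · intro w
      have h1 := h (e.symm w)
      have : A (e.symm w) = w := e.apply_symm_apply w
      rw [LinearEquiv.coe_coe, hei]
      rw [this, hi] at h1
      have h2 := congrArg (fun z => ε • (((x⁻¹ : (Cl κ)ˣ) : Cl κ) * z *
        ((x⁻¹ : (Cl κ)ˣ) : Cl κ))) h1
      simp only [smul_mul_assoc, mul_smul_comm, smul_smul, mul_assoc,
        Units.inv_mul_cancel_left, Units.mul_inv, mul_one] at h2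
      rw [smul_mul_assoc, h2]
      have : ε * ε = 1 := by rcases hε with rfl | rfl <;> norm_num
      rw [this, one_smul]

lemma det_rot_pos (a : Spin κ) : 0 < LinearMap.det (rot a) := by
  obtain ⟨ε, A, hε, hA, hi, h⟩ := exists_twisted (spinGroup.toUnits a)
    (spinGroup.units_mem_lipschitzGroup a.2)
  have hinv : involute (a : Cl κ) = a := spinGroup.involute_eq a.2
  have e1 : ((spinGroup.toUnits a : (Cl κ)ˣ) : Cl κ) = a := rfl
  rw [e1, hinv] at hi h
  have hone : ε = 1 := by
    rcases hε with h | rfl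
    · exact h
    · exfalso
      have h2 : (a : Cl κ) = 0 := by
        have h3 : (2 : ℝ) • (a : Cl κ) = 0 := by
          rw [two_smul]; nth_rewrite 1 [hi]; simp
        exact (smul_eq_zero.1 h3).resolve_left two_ne_zero
      have := coe_mul_coe_inv a
      rw [h2, zero_mul] at this
      exact zero_ne_one this
  have : rot a = A := by
    refine LinearMap.ext fun v => ι_injective ?_
    simp only [ι_rot, ← h, mul_assoc, coe_mul_coe_inv, mul_one]
  rw [this, hA, hone]; exact one_pos

end Clifford

section Sum

variable {J : Type} [Fintype J] [DecidableEq J] {κ : J → Type} [∀ j, Fintype (κ j)]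

/-- The inclusion of the `j`-th summand into the orthogonal direct sum. -/
def incl (j : J) : stdForm (κ j) →qᵢ stdForm (Σ j, κ j) where
  toFun v s := (Pi.single j v : ∀ j, κ j → ℝ) s.1 s.2
  map_add' v w := by ext s; simp [Pi.single_add]
  map_smul' r v := by ext s; simp [Pi.single_smul]
  map_app' v := by
    change stdForm (Σ j, κ j) (fun s => (Pi.single j v : ∀ j, κ j → ℝ) s.1 s.2) = _
    rw [stdForm_apply, stdForm_apply, Fintype.sum_sigma, Finset.sum_eq_single j]
    · simp
    · intro b _ hb; simp [Pi.single_eq_of_ne hb]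
    · simp

lemma incl_apply (j : J) (v : κ j → ℝ) (s : Σ j, κ j) :
    incl j v s = (Pi.single j v : ∀ j, κ j → ℝ) s.1 s.2 := rfl

lemma incl_ortho {j k : J} (h : j ≠ k) (v : κ j → ℝ) (w : κ k → ℝ) :
    (stdForm (Σ j, κ j)).IsOrtho (incl j v) (incl k w) := by
  rw [QuadraticMap.isOrtho_def]
  simp only [stdForm_apply, Pi.add_apply, mul_add, add_mul, Finset.sum_add_distrib]
  have z : ∀ s : Σ j, κ j, incl j v s * incl k w s = 0 := by
    intro s
    rw [incl_apply, incl_apply]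
    by_cases hs : s.1 = j
    · have : s.1 ≠ k := fun h' => h (hs.symm.trans h')
      simp [Pi.single_eq_of_ne this]
    · simp [Pi.single_eq_of_ne hs]
  have z' : ∀ s : Σ j, κ j, incl k w s * incl j v s = 0 := fun s => by rw [mul_comm, z]
  simp only [z, z', Finset.sum_const_zero]
  ring

lemma map_star_cl {V W : Type} [AddCommGroup V] [Module ℝ V] [AddCommGroup W] [Module ℝ W]
    {Q : QuadraticForm ℝ V} {Q' : QuadraticForm ℝ W} (f : Q →qᵢ Q') (x : CliffordAlgebra Q) :
    CliffordAlgebra.map f (star x) = star (CliffordAlgebra.map f x) := by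
  induction x using CliffordAlgebra.induction with
  | algebraMap r => simp [CliffordAlgebra.star_algebraMap]
  | ι v => simp [CliffordAlgebra.star_ι]
  | mul a b ha hb => simp [ha, hb]
  | add a b ha hb => simp [ha, hb]

lemma map_mem_evenOdd {V W : Type} [AddCommGroup V] [Module ℝ V] [AddCommGroup W] [Module ℝ W]
    {Q : QuadraticForm ℝ V} {Q' : QuadraticForm ℝ W} (f : Q →qᵢ Q') {x : CliffordAlgebra Q}
    (hx : x ∈ CliffordAlgebra.even Q) : CliffordAlgebra.map f x ∈ CliffordAlgebra.even Q' := by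
  have hx' : x ∈ evenOdd Q 0 := hx
  clear hx
  change _ ∈ evenOdd Q' 0
  induction x, hx' using CliffordAlgebra.even_induction with
  | algebraMap r => rw [AlgHom.commutes]; exact SetLike.algebraMap_mem_graded _ _
  | add x y hx hy ihx ihy => rw [_root_.map_add]; exact Submodule.add_mem _ ihx ihy
  | ι_mul_ι_mul v w x hx ih =>
    rw [map_mul, map_mul, map_apply_ι, map_apply_ι]
    have := SetLike.mul_mem_graded (A := evenOdd Q')
      (ι_mul_ι_mem_evenOdd_zero Q' (f v) (f w)) ih
    simpa using this

lemma map_mem_spinGroup {V W : Type} [AddCommGroup V] [Module ℝ V] [AddCommGroup W] [Module ℝ W]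
    {Q : QuadraticForm ℝ V} {Q' : QuadraticForm ℝ W} (f : Q →qᵢ Q') {x : CliffordAlgebra Q}
    (hx : x ∈ spinGroup Q) : CliffordAlgebra.map f x ∈ spinGroup Q' := by
  refine ⟨⟨?_, ?_⟩, map_mem_evenOdd f (spinGroup.mem_even hx)⟩
  · obtain ⟨u, hu, rfl⟩ := pinGroup.mem_lipschitzGroup (spinGroup.mem_pin hx)
    refine ⟨Units.map (CliffordAlgebra.map f : CliffordAlgebra Q →* CliffordAlgebra Q') u, ?_, rfl⟩
    have h : lipschitzGroup Q ≤ (lipschitzGroup Q').comap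
        (Units.map (CliffordAlgebra.map f : CliffordAlgebra Q →* CliffordAlgebra Q')) := by
      refine (Subgroup.closure_le _).2 ?_
      rintro y ⟨v, hv⟩
      refine Subgroup.subset_closure ⟨f v, ?_⟩
      simp [← hv]
    exact h hu
  · have h1 := spinGroup.star_mul_self_of_mem hx
    have h2 := spinGroup.mul_star_self_of_mem hx
    constructor
    · rw [← map_star_cl, ← map_mul, h1, map_one]
    · rw [← map_star_cl, ← map_mul, h2, map_one]

/-- The homomorphism `Spin(κ j) → Spin(⨁ κ)` induced by the inclusion of the `j`-th summand. -/
def spinIncl (j : J) : Spin (κ j) →* Spin (Σ j, κ j) where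
  toFun a := ⟨CliffordAlgebra.map (incl j) a, map_mem_spinGroup _ a.2⟩
  map_one' := Subtype.ext (map_one _)
  map_mul' a b := Subtype.ext (map_mul _ _ _)

lemma spinIncl_commute : Pairwise fun j k : J => ∀ (a : Spin (κ j)) (b : Spin (κ k)),
    Commute (spinIncl j a) (spinIncl k b) := by
  intro j k hjk a b
  refine Subtype.ext ?_
  exact commute_map_mul_map_of_isOrtho_of_mem_evenOdd_zero_left (incl j) (incl k)
    (incl_ortho hjk) _ _ (spinGroup.mem_even a.2) (i₂ := 0) (spinGroup.mem_even b.2)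

/-- The homomorphism `∏ Spin(κ j) → Spin(⨁ κ)`, `(aⱼ) ↦ ∏ aⱼ`. -/
def spinProd : (∀ j, Spin (κ j)) →* Spin (Σ j, κ j) :=
  MonoidHom.noncommPiCoprod spinIncl spinIncl_commute

/-- Rotations act blockwise: `spinProd a` rotates the `j`-th summand by `a j`. -/
lemma rot_spinIncl_self (j : J) (a : Spin (κ j)) (v : κ j → ℝ) :
    rot (spinIncl j a) (incl j v) = incl j (rot a v) := by
  apply ι_injective
  rw [ι_rot, ← map_inv, ← map_apply_ι, ← map_apply_ι, ι_rot]
  simp [spinIncl]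

lemma rot_spinIncl_of_ne {j k : J} (h : j ≠ k) (a : Spin (κ j)) (v : κ k → ℝ) :
    rot (spinIncl j a) (incl k v) = incl k v := by
  apply ι_injective
  rw [ι_rot, ← map_apply_ι]
  have : Commute ((spinIncl j a : Spin (Σ j, κ j)) : Cl (Σ j, κ j))
      (CliffordAlgebra.map (incl k) (ι _ v)) :=
    commute_map_mul_map_of_isOrtho_of_mem_evenOdd_zero_left (incl j) (incl k)
      (incl_ortho h) _ _ (spinGroup.mem_even a.2) (i₂ := 1) (ι_mem_evenOdd_one _ v)
  rw [this.eq, mul_assoc, coe_mul_coe_inv, mul_one]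

lemma eq_sum_incl (v : (Σ j, κ j) → ℝ) : v = ∑ j, incl j (fun a => v ⟨j, a⟩) := by
  ext s
  rw [Finset.sum_apply, Finset.sum_eq_single s.1]
  · simp [incl_apply]
  · intro j _ hj; simp [incl_apply, Pi.single_eq_of_ne hj.symm]
  · simp

lemma spinProd_eq_mul (a : ∀ j, Spin (κ j)) (j : J) :
    spinProd a = spinIncl j (a j) * spinProd (Function.update a j 1) := by
  have e : spinIncl j (a j) = spinProd (Pi.mulSingle j (a j)) :=
    (MonoidHom.noncommPiCoprod_mulSingle (hcomm := spinIncl_commute) spinIncl j (a j)).symm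
  rw [e]
  rw [← map_mul]
  congr 1
  ext1 k
  by_cases h : k = j
  · subst h; simp
  · simp [h]

lemma rot_noncommProd (s : Finset J) (f : J → Spin (Σ j, κ j)) (hf) (w : (Σ j, κ j) → ℝ)
    (h : ∀ j ∈ s, rot (f j) w = w) : rot (s.noncommProd f hf) w = w := by
  induction s using Finset.induction_on with
  | empty => simp [rot_one]
  | insert j s hj ih =>
    rw [Finset.noncommProd_insert_of_notMem _ _ _ _ hj, rot_mul,
      ih _ (fun k hk => h k (Finset.mem_insert_of_mem hk)), h j (Finset.mem_insert_self _ _)]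

lemma rot_spinProd_incl (a : ∀ j, Spin (κ j)) (j : J) (v : κ j → ℝ) :
    rot (spinProd a) (incl j v) = incl j (rot (a j) v) := by
  rw [spinProd_eq_mul a j, rot_mul]
  have : rot (spinProd (Function.update a j 1)) (incl j v) = incl j v := by
    rw [spinProd, MonoidHom.noncommPiCoprod_apply]
    refine rot_noncommProd _ _ _ _ fun k _ => ?_
    by_cases h : k = j
    · subst h; simp [rot_one]
    · exact rot_spinIncl_of_ne h _ _
  rw [this, rot_spinIncl_self]

lemma rot_spinProd (a : ∀ j, Spin (κ j)) (v : (Σ j, κ j) → ℝ) (s : Σ j, κ j) :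
    rot (spinProd a) v s = rot (a s.1) (fun b => v ⟨s.1, b⟩) s.2 := by
  conv_lhs => rw [eq_sum_incl v]
  rw [map_sum, Finset.sum_apply, Finset.sum_eq_single s.1]
  · simp [rot_spinProd_incl, incl_apply]
  · intro j _ hj; simp [rot_spinProd_incl, incl_apply, Pi.single_eq_of_ne hj.symm]
  · simp

end Sum

section Forms

variable {A B : Type} [NormedAddCommGroup A] [NormedSpace ℝ A]
    [NormedAddCommGroup B] [NormedSpace ℝ B]

/-- The pullback of bilinear forms along a linear map. -/
def pullForm (p : B →L[ℝ] A) : (A →L[ℝ] A →L[ℝ] ℝ) →L[ℝ] (B →L[ℝ] B →L[ℝ] ℝ) :=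
  ((ContinuousLinearMap.compL ℝ B A (B →L[ℝ] ℝ)).flip p).comp
    (ContinuousLinearMap.compL ℝ A (A →L[ℝ] ℝ) (B →L[ℝ] ℝ)
      ((ContinuousLinearMap.compL ℝ B A ℝ).flip p))

lemma pullForm_apply (p : B →L[ℝ] A) (b : A →L[ℝ] A →L[ℝ] ℝ) (u v : B) :
    pullForm p b u v = b (p u) (p v) := rfl

lemma contMDiffAt_clm {EE HH : Type*} [NormedAddCommGroup EE] [NormedSpace ℝ EE]
    [TopologicalSpace HH] {II : ModelWithCorners ℝ EE HH} {MM : Type*} [TopologicalSpace MM]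
    [ChartedSpace HH MM] (L : A →L[ℝ] B) {F : MM → A} {x : MM}
    (hF : ContMDiffAt II 𝓘(ℝ, A) ∞ F x) : ContMDiffAt II 𝓘(ℝ, B) ∞ (fun y => L (F y)) x :=
  (L.contMDiff (n := ∞)).contMDiffAt.comp x hF

set_option synthInstance.maxHeartbeats 400000 in
lemma contMDiffAt_pullForm {EE HH : Type*} [NormedAddCommGroup EE] [NormedSpace ℝ EE]
    [TopologicalSpace HH] {II : ModelWithCorners ℝ EE HH} {MM : Type*} [TopologicalSpace MM]
    [ChartedSpace HH MM] (p : B →L[ℝ] A) {F : MM → A →L[ℝ] A →L[ℝ] ℝ} {x : MM}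
    (hF : ContMDiffAt II 𝓘(ℝ, A →L[ℝ] A →L[ℝ] ℝ) ∞ F x) :
    ContMDiffAt II 𝓘(ℝ, B →L[ℝ] B →L[ℝ] ℝ) ∞ (fun y => pullForm p (F y)) x :=
  contMDiffAt_clm (A := A →L[ℝ] A →L[ℝ] ℝ) (B := B →L[ℝ] B →L[ℝ] ℝ) (pullForm p) hF

end Forms

section PiManifold

variable {J : Type} [Fintype J] {E : J → Type} [∀ j, NormedAddCommGroup (E j)]
  [∀ j, NormedSpace ℝ (E j)] {H : J → Type} [∀ j, TopologicalSpace (H j)]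
  (I : ∀ j, ModelWithCorners ℝ (E j) (H j))
  {M : J → Type*} [∀ j, TopologicalSpace (M j)] [∀ j, ChartedSpace (H j) (M j)]

lemma range_pi : Set.range (ModelWithCorners.pi I) = Set.univ.pi fun j => Set.range (I j) := by
  change Set.range (fun (f : ∀ j, H j) j => I j (f j)) = _
  exact Set.range_piMap _

instance isManifold_pi [∀ j, IsManifold (I j) ∞ (M j)] :
    IsManifold (ModelWithCorners.pi I) ∞ (∀ j, M j) := by
  apply isManifold_of_contDiffOn
  rintro _ _ ⟨e, he, rfl⟩ ⟨e', he', rfl⟩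
  rw [contDiffOn_pi]
  intro j
  have h := (contDiffGroupoid ∞ (I j)).compatible (he j trivial) (he' j trivial)
  rw [contDiffGroupoid, mem_groupoid_of_pregroupoid] at h
  have h1 := h.1
  simp only [contDiffPregroupoid] at h1
  refine ContDiffOn.comp (t := (I j).symm ⁻¹' ((e j).symm.trans (e' j)).source ∩ Set.range (I j))
    (f := fun y : (∀ j, E j) => y j) h1 (ContinuousLinearMap.proj (R := ℝ) (φ := E) j).contDiff.contDiffOn ?_
  rintro y ⟨hy, hy'⟩
  rw [range_pi] at hy'
  refine ⟨?_, hy' j trivial⟩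
  have h2 := hy.1
  have h3 := hy.2
  refine ⟨h2 j trivial, h3 j trivial⟩

lemma extChartAt_pi (x y : ∀ j, M j) (j : J) :
    extChartAt (ModelWithCorners.pi I) x y j = extChartAt (I j) (x j) (y j) := rfl

lemma extChartAt_pi_symm (x : ∀ j, M j) (y : ∀ j, E j) (j : J) :
    (extChartAt (ModelWithCorners.pi I) x).symm y j = (extChartAt (I j) (x j)).symm (y j) := rfl

lemma mem_chart_source_pi {x y : ∀ j, M j} :
    y ∈ (chartAt (ModelPi H) x).source ↔ ∀ j, y j ∈ (chartAt (H j) (x j)).source := by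
  change y ∈ Set.univ.pi _ ↔ _
  simp

lemma contMDiff_eval (j : J) :
    ContMDiff (ModelWithCorners.pi I) (I j) ∞ (fun x : ∀ j, M j => x j) := by
  intro x
  rw [contMDiffAt_iff]
  refine ⟨(continuous_apply j).continuousAt, ?_⟩
  refine ((ContinuousLinearMap.proj (R := ℝ) (φ := E) j).contDiff.contDiffWithinAt (s := Set.range (ModelWithCorners.pi I))
    (x := extChartAt (ModelWithCorners.pi I) x x)).congr_of_eventuallyEq ?_ ?_
  · filter_upwards [extChartAt_target_mem_nhdsWithin (I := ModelWithCorners.pi I) x] with y hy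
    simp only [Function.comp_apply, extChartAt_pi_symm]
    apply (extChartAt (I j) (x j)).right_inv
    have h1 : y j ∈ Set.range (I j) := by
      have := extChartAt_target_subset_range (I := ModelWithCorners.pi I) x hy
      rw [range_pi] at this; exact this j trivial
    rw [extChartAt_target] at hy ⊢
    exact ⟨hy.1 j trivial, h1⟩
  · simp only [Function.comp_apply, extChartAt_pi_symm, extChartAt_pi]
    rw [(extChartAt (I j) (x j)).left_inv (mem_extChartAt_source (x j))]
    rfl

/-- The tangent space of the product is the product of the tangent spaces: under this
identification the differentials of the projections are the coordinate maps. -/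
lemma mfderiv_eval (x : ∀ j, M j) (j : J) (v : TangentSpace (ModelWithCorners.pi I) x) :
    mfderiv (ModelWithCorners.pi I) (I j) (fun x : ∀ j, M j => x j) x v = v j := by
  have hd : HasMFDerivAt (ModelWithCorners.pi I) (I j) (fun x : ∀ j, M j => x j) x
      (ContinuousLinearMap.proj (R := ℝ) (φ := E) j) := by
    refine ⟨(continuous_apply j).continuousAt, ?_⟩
    refine (ContinuousLinearMap.proj (R := ℝ) (φ := E) j).hasFDerivWithinAt.congr_of_eventuallyEq
      ?_ ?_
    · filter_upwards [extChartAt_target_mem_nhdsWithin (I := ModelWithCorners.pi I) x] with y hy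
      simp only [writtenInExtChartAt, Function.comp_apply, extChartAt_pi_symm]
      apply (extChartAt (I j) (x j)).right_inv
      have h1 : y j ∈ Set.range (I j) := by
        have := extChartAt_target_subset_range (I := ModelWithCorners.pi I) x hy
        rw [range_pi] at this; exact this j trivial
      rw [extChartAt_target] at hy ⊢
      exact ⟨hy.1 j trivial, h1⟩
    · simp only [writtenInExtChartAt, Function.comp_apply, extChartAt_pi_symm, extChartAt_pi]
      rw [(extChartAt (I j) (x j)).left_inv (mem_extChartAt_source (x j))]
      rfl
  rw [hd.mfderiv]
  rfl

variable [∀ j, IsManifold (I j) ∞ (M j)]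

lemma tangentCoordChange_pi {x y z : ∀ j, M j} (hx : z ∈ (chartAt (ModelPi H) x).source)
    (hy : z ∈ (chartAt (ModelPi H) y).source) (v : ∀ j, E j) (j : J) :
    tangentCoordChange (ModelWithCorners.pi I) x y z v j =
      tangentCoordChange (I j) (x j) (y j) (z j) (v j) := by
  have hx' := mem_chart_source_pi.1 hx
  have hy' := mem_chart_source_pi.1 hy
  have hd : HasFDerivWithinAt
      ((extChartAt (ModelWithCorners.pi I) y) ∘ (extChartAt (ModelWithCorners.pi I) x).symm)
      (ContinuousLinearMap.pi fun j => (tangentCoordChange (I j) (x j) (y j) (z j)).comp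
        (ContinuousLinearMap.proj (R := ℝ) (φ := E) j))
      (Set.range (ModelWithCorners.pi I)) (extChartAt (ModelWithCorners.pi I) x z) := by
    rw [hasFDerivWithinAt_pi']
    intro k
    have h1 := hasFDerivWithinAt_tangentCoordChange (I := I k) (x := x k) (y := y k) (z := z k)
      ⟨by rw [extChartAt_source]; exact hx' k, by rw [extChartAt_source]; exact hy' k⟩
    have h2 := h1.comp (extChartAt (ModelWithCorners.pi I) x z)
      (f := fun z : (∀ j, E j) => z k) (s := Set.range (ModelWithCorners.pi I))
      ((ContinuousLinearMap.proj (R := ℝ) (φ := E) k).hasFDerivWithinAt)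
      (by intro z hz; rw [range_pi] at hz; exact hz k trivial)
    exact h2
  have hd' := hasFDerivWithinAt_tangentCoordChange (I := ModelWithCorners.pi I) (x := x) (y := y)
    (z := z) ⟨by rw [extChartAt_source]; exact hx, by rw [extChartAt_source]; exact hy⟩
  have hu : UniqueDiffWithinAt ℝ (Set.range (ModelWithCorners.pi I))
      (extChartAt (ModelWithCorners.pi I) x z) :=
    (ModelWithCorners.pi I).uniqueDiffOn _ ⟨_, rfl⟩
  rw [hu.eq hd' hd]
  rfl

lemma trivializationAt_snd {EE HH : Type} [NormedAddCommGroup EE] [NormedSpace ℝ EE]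
    [TopologicalSpace HH] (II : ModelWithCorners ℝ EE HH) {MM : Type*} [TopologicalSpace MM]
    [ChartedSpace HH MM] [IsManifold II ∞ MM] (x y : MM) (v : TangentSpace II y) :
    (trivializationAt EE (TangentSpace II) x ⟨y, v⟩).2 = tangentCoordChange II y x y v := rfl

lemma form_inCoordinates {EE HH : Type} [NormedAddCommGroup EE] [NormedSpace ℝ EE]
    [TopologicalSpace HH] (II : ModelWithCorners ℝ EE HH) {MM : Type*} [TopologicalSpace MM]
    [ChartedSpace HH MM] [IsManifold II ∞ MM] {x₀ x : MM} (hx : x ∈ (chartAt HH x₀).source)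
    (φ : TangentSpace II x →L[ℝ] TangentSpace II x →L[ℝ] ℝ) (u v : EE) :
    ContinuousLinearMap.inCoordinates EE (fun x : MM => TangentSpace II x) (EE →L[ℝ] ℝ)
      (fun x : MM => TangentSpace II x →L[ℝ] ℝ) x₀ x x₀ x φ u v =
    φ (tangentCoordChange II x₀ x x u) (tangentCoordChange II x₀ x x v) := by
  have e1 := inCoordinates_apply_eq₂ (F₃ := ℝ) (E₃ := Trivial MM ℝ)
    (E₁ := fun x : MM => TangentSpace II x)
    (E₂ := fun x : MM => TangentSpace II x) (x₀ := x₀) (x := x)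
    (ϕ := φ) (v := u) (w := v) hx hx (Set.mem_univ _)
  refine Eq.trans e1 ?_
  simp only [Trivial.fiberBundle_trivializationAt', Trivial.linearMapAt_trivialization,
    LinearMap.id_coe, id_eq]
  have h : ∀ u, (trivializationAt EE (fun x : MM => TangentSpace II x) x₀).symm x u =
      tangentCoordChange II x₀ x x u := fun u =>
    ((trivializationAt EE (TangentSpace II) x₀).symmL_apply (R := ℝ) hx u).symm.trans
    (congrArg (fun L : EE →L[ℝ] EE => L u)
      (TangentBundle.symmL_trivializationAt_eq_core (I := II) hx))
  rw [h, h]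

/-- The orthogonal sum of bilinear forms on the factors. -/
def sumForm (b : ∀ j, E j →L[ℝ] E j →L[ℝ] ℝ) : (∀ j, E j) →L[ℝ] (∀ j, E j) →L[ℝ] ℝ :=
  ∑ j, pullForm (ContinuousLinearMap.proj (R := ℝ) (φ := E) j) (b j)

lemma sumForm_apply (b : ∀ j, E j →L[ℝ] E j →L[ℝ] ℝ) (u v : ∀ j, E j) :
    sumForm b u v = ∑ j, b j (u j) (v j) := by
  simp [sumForm, sum_apply, pullForm_apply]

/-- The product metric `g = ∑ⱼ pⱼ^* gⱼ`. -/
def productMetric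
    (g : ∀ j, ContMDiffRiemannianMetric (I j) ∞ (E j) (fun x : M j => TangentSpace (I j) x)) :
    ContMDiffRiemannianMetric (ModelWithCorners.pi I) ∞ (∀ j, E j)
      (fun x : ∀ j, M j => TangentSpace (ModelWithCorners.pi I) x) where
  inner x := sumForm (E := E) fun j => (g j).inner (x j)
  symm x v w := by
    refine (sumForm_apply _ _ _).trans (Eq.trans ?_ (sumForm_apply _ _ _).symm)
    exact Finset.sum_congr rfl fun j _ => (g j).symm (x j) _ _
  pos x v hv := by
    obtain ⟨j, hj⟩ : ∃ j, v j ≠ 0 := by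
      by_contra! h
      exact hv (funext h)
    refine lt_of_lt_of_eq ?_ (sumForm_apply _ _ _).symm
    refine Finset.sum_pos' (fun k _ => ?_) ⟨j, Finset.mem_univ _, (g j).pos (x j) _ hj⟩
    by_cases hk : v k = 0
    · refine le_of_eq (Eq.symm ?_)
      rw [hk]; exact ((g k).inner (x k) 0).map_zero
    · exact ((g k).pos (x k) _ hk).le
  isVonNBounded x := by
    refine (Bornology.isVonNBounded_pi_iff (𝕜 := ℝ) (E := E)).2 fun j => ?_
    refine ((g j).isVonNBounded (x j)).subset ?_
    rintro _ ⟨v, hv, rfl⟩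
    refine lt_of_le_of_lt ?_ (show sumForm (E := E) (fun j => (g j).inner (x j)) v v < 1 from hv)
    refine le_of_le_of_eq ?_ (sumForm_apply _ _ _).symm
    refine Finset.single_le_sum (f := fun k => (g k).inner (x k) (v k) (v k)) (fun k _ => ?_)
      (Finset.mem_univ j)
    by_cases hk : v k = 0
    · refine le_of_eq (Eq.symm ?_)
      rw [hk]; exact ((g k).inner (x k) 0).map_zero
    · exact ((g k).pos (x k) _ hk).le
  contMDiff := by
    intro x₀
    rw [contMDiffAt_hom_bundle]
    refine ⟨contMDiffAt_id, ?_⟩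
    have h1 : ∀ j, ContMDiffAt (ModelWithCorners.pi I) 𝓘(ℝ, E j →L[ℝ] E j →L[ℝ] ℝ) ∞
        (fun x : ∀ j, M j => ContinuousLinearMap.inCoordinates (E j)
          (fun y : M j => TangentSpace (I j) y) (E j →L[ℝ] ℝ)
          (fun y : M j => TangentSpace (I j) y →L[ℝ] ℝ) (x₀ j) (x j) (x₀ j) (x j)
            ((g j).inner (x j))) x₀ := by
      intro j
      have h := (g j).contMDiff (x₀ j)
      rw [contMDiffAt_hom_bundle] at h
      exact h.2.comp x₀ (contMDiff_eval I j x₀)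
    have h2 := ContMDiffAt.sum (t := Finset.univ) fun j _ => 
      contMDiffAt_pullForm (ContinuousLinearMap.proj (R := ℝ) (φ := E) j) (h1 j)
    refine h2.congr_of_eventuallyEq ?_
    filter_upwards [chart_source_mem_nhds (ModelPi H) x₀] with x hx
    have hx' := mem_chart_source_pi.1 hx
    ext u v
    refine Eq.trans (form_inCoordinates (ModelWithCorners.pi I) hx _ u v) ?_
    rw [sum_apply, sum_apply]
    refine Eq.trans (sumForm_apply _ _ _) ?_
    refine Finset.sum_congr rfl fun j _ => ?_
    refine Eq.trans ?_ (form_inCoordinates (I j) (hx' j) _ (u j) (v j)).symm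
    rw [tangentCoordChange_pi I hx (mem_chart_source _ x),
      tangentCoordChange_pi I hx (mem_chart_source _ x)]
    rfl

variable [DecidableEq J]

lemma contMDiffOn_single (j : J) (e : ∀ y : M j, TangentSpace (I j) y) (U : Set (M j))
    (he : ContMDiffOn (I j) (I j).tangent ∞ (fun y => (⟨y, e y⟩ : TangentBundle (I j) (M j))) U)
    (s : ∀ x : ∀ j, M j, TangentSpace (ModelWithCorners.pi I) x)
    (hs : ∀ x k, s x k = (Pi.single j (e (x j)) : ∀ j, E j) k) :
    ContMDiffOn (ModelWithCorners.pi I) (ModelWithCorners.pi I).tangent ∞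
      (fun x => (⟨x, s x⟩ : TangentBundle (ModelWithCorners.pi I) (∀ j, M j))) {x | x j ∈ U} := by
  intro x₀ hx₀
  have h1 := he (x₀ j) hx₀
  rw [Bundle.contMDiffWithinAt_section] at h1 ⊢
  have h2 := h1.comp x₀ (contMDiff_eval I j).contMDiffAt.contMDiffWithinAt
    (s := {x | x j ∈ U}) (fun x hx => hx)
  have h3 := (ContinuousLinearMap.single ℝ E j).contMDiff (n := ∞) |>.contMDiffAt
    |>.comp_contMDiffWithinAt _ h2
  have key : ∀ x ∈ (chartAt (ModelPi H) x₀).source,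
      (trivializationAt (∀ j, E j) (TangentSpace (ModelWithCorners.pi I)) x₀
        ⟨x, s x⟩).2 = ContinuousLinearMap.single ℝ E j
        ((trivializationAt (E j) (TangentSpace (I j)) (x₀ j) ⟨x j, e (x j)⟩).2) := by
    intro x hx
    rw [trivializationAt_snd, trivializationAt_snd]
    funext k
    refine (tangentCoordChange_pi I (mem_chart_source _ x) hx (s x) k).trans ?_
    rw [hs]
    by_cases hk : k = j
    · subst hk
      rw [ContinuousLinearMap.single_apply, Pi.single_eq_same]
      exact congrArg _ (Pi.single_eq_same (M := E) k (e (x k)))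
    · rw [ContinuousLinearMap.single_apply, Pi.single_eq_of_ne hk]
      exact (congrArg _ (Pi.single_eq_of_ne (M := E) hk (e (x j)))).trans (map_zero _)
  refine h3.congr_of_eventuallyEq ?_ (key x₀ (mem_chart_source _ _))
  filter_upwards [mem_nhdsWithin_of_mem_nhds (chart_source_mem_nhds (ModelPi H) x₀)] with x hx
  exact key x hx

end PiManifold

section Manifold

variable {E H : Type} [NormedAddCommGroup E] [NormedSpace ℝ E] [TopologicalSpace H]
  (I : ModelWithCorners ℝ E H) {M : Type u} [TopologicalSpace M] [ChartedSpace H M]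

/-- Smoothness on `U` of a map into a finite dimensional real vector space `A`: every linear
coordinate of the map is smooth. -/
def SmoothOn {A : Type*} [AddCommGroup A] [Module ℝ A] (f : M → A) (U : Set M) : Prop :=
  ∀ ℓ : A →ₗ[ℝ] ℝ, ContMDiffOn I 𝓘(ℝ, ℝ) ∞ (fun x => ℓ (f x)) U

variable (M) [IsManifold I ∞ M] (κ : Type) [Fintype κ] [DecidableEq κ]

/-- The data making `M` an oriented Riemannian manifold: a smooth Riemannian metric and an
orientation of every tangent space which is given, locally, by a smooth frame. The index type `κ`
labels the members of a frame. -/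
structure OrientedRiemannian where
  metric : ContMDiffRiemannianMetric I ∞ E (fun x : M => TangentSpace I x)
  orientation : ∀ x : M, Orientation ℝ (TangentSpace I x) κ
  locally_framed : ∀ x₀ : M, ∃ U : Set M, IsOpen U ∧ x₀ ∈ U ∧
    ∃ b : ∀ x : M, Module.Basis κ ℝ (TangentSpace I x),
      (∀ k, ContMDiffOn I I.tangent ∞ (fun x => (⟨x, b x k⟩ : TangentBundle I M)) U) ∧
      ∀ x ∈ U, (b x).orientation = orientation x

variable {I M κ}

/-- The fibre over `x` of the bundle `P_SO` of oriented orthonormal frames; a frame is regarded as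
an oriented linear isometry from Euclidean space to the tangent space. -/
structure Frame (g : OrientedRiemannian I M κ) (x : M) where
  toEquiv : (κ → ℝ) ≃ₗ[ℝ] TangentSpace I x
  inner_eq : ∀ v w, g.metric.inner x (toEquiv v) (toEquiv w) = v ⬝ᵥ w
  oriented : ((Pi.basisFun ℝ κ).map toEquiv).orientation = g.orientation x

/-- The right action of `Spin` on frames through the covering `Spin → SO`. -/
def Frame.rotate {g : OrientedRiemannian I M κ} {x : M} (f : Frame g x) (a : Spin κ) :
    Frame g x where
  toEquiv := (rotEquiv a).trans f.toEquiv
  inner_eq v w := (f.inner_eq _ _).trans (dot_rot a v w)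
  oriented := by
    have h : ((Pi.basisFun ℝ κ).map (rotEquiv a)).orientation = (Pi.basisFun ℝ κ).orientation :=
      ((Pi.basisFun ℝ κ).orientation_comp_linearEquiv_eq_iff_det_pos (rotEquiv a)).2
        (det_rot_pos a)
    have e : (Pi.basisFun ℝ κ).map ((rotEquiv a).trans f.toEquiv) =
        ((Pi.basisFun ℝ κ).map (rotEquiv a)).map f.toEquiv := by
      ext k; rfl
    rw [e, Module.Basis.orientation_map, h, ← Module.Basis.orientation_map, f.oriented]

variable (I M κ)

/-- A smooth principal `Spin`-bundle over `M`, given by its fibres with their simply transitive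
right `Spin`-action (`div p q` is the unique element with `p · div p q = q`) and by a bundle atlas of
local sections `sec a` over the open sets `dom a`, whose transition functions are smooth maps into
the spin group, regarded as a subset of the Clifford algebra. The values of `sec a` outside
`dom a` play no role. -/
structure SpinPrincipalBundle where
  fiber : M → Type w
  act : ∀ {x : M}, fiber x → Spin κ → fiber x
  act_one : ∀ {x : M} (p : fiber x), act p 1 = p
  act_mul : ∀ {x : M} (p : fiber x) (a b : Spin κ), act p (a * b) = act (act p a) b
  div : ∀ {x : M}, fiber x → fiber x → Spin κ
  act_div : ∀ {x : M} (p q : fiber x), act p (div p q) = q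
  div_act : ∀ {x : M} (p : fiber x) (a : Spin κ), div p (act p a) = a
  Index : Type w'
  dom : Index → Set M
  isOpen_dom : ∀ a, IsOpen (dom a)
  cover : ∀ x : M, ∃ a, x ∈ dom a
  sec : Index → ∀ x : M, fiber x
  smooth_transition : ∀ a b,
    SmoothOn I (fun x => (div (sec a x) (sec b x) : Cl κ)) (dom a ∩ dom b)

variable {I M κ}

/-- A spin structure on an oriented Riemannian manifold: a principal `Spin`-bundle with a smooth
map to the bundle of oriented orthonormal frames which is equivariant with respect to the covering
`Spin → SO`. -/
structure SpinStructure (g : OrientedRiemannian I M κ) extends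
    SpinPrincipalBundle.{u, w, w'} I M κ where
  frame : ∀ {x : M}, fiber x → Frame g x
  frame_act : ∀ {x : M} (p : fiber x) (a : Spin κ), frame (act p a) = (frame p).rotate a
  smooth_frame : ∀ (a : Index) (k : κ), ContMDiffOn I I.tangent ∞
    (fun x => (⟨x, (frame (sec a x)).toEquiv (Pi.single k 1)⟩ : TangentBundle I M)) (dom a)

end Manifold

section Product

variable {J : Type} [Fintype J] [DecidableEq J] {E : J → Type} [∀ j, NormedAddCommGroup (E j)]
  [∀ j, NormedSpace ℝ (E j)] {H : J → Type} [∀ j, TopologicalSpace (H j)]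
  {I : ∀ j, ModelWithCorners ℝ (E j) (H j)}
  {M : J → Type u} [∀ j, TopologicalSpace (M j)] [∀ j, ChartedSpace (H j) (M j)]
  [∀ j, IsManifold (I j) ∞ (M j)] {κ : J → Type} [∀ j, Fintype (κ j)] [∀ j, DecidableEq (κ j)]

/-- The identification `⨁ T M_j = T M`, see `mfderiv_eval`. -/
def tangentSum (x : ∀ j, M j) :
    (∀ j, TangentSpace (I j) (x j)) ≃ₗ[ℝ] TangentSpace (ModelWithCorners.pi I) x :=
  LinearEquiv.refl ℝ (∀ j, E j)

lemma pi_orientation_congr {V : J → Type} [∀ j, AddCommGroup (V j)] [∀ j, Module ℝ (V j)]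
    (b b' : ∀ j, Module.Basis (κ j) ℝ (V j)) (h : ∀ j, (b j).orientation = (b' j).orientation) :
    (Pi.basis b).orientation = (Pi.basis b').orientation := by
  rw [Module.Basis.orientation_eq_iff_det_pos, Module.Basis.det_apply]
  let e := Fintype.equivFin J
  have entry : ∀ s t, (Pi.basis b).toMatrix (Pi.basis b') s t =
      (b s.1).repr ((Pi.single t.1 (b' t.1 t.2) : ∀ j, V j) s.1) s.2 := by
    intro s t
    rw [Module.Basis.toMatrix_apply, Pi.basis_repr, Pi.basis_apply]
  have tri : Matrix.BlockTriangular ((Pi.basis b).toMatrix (Pi.basis b'))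
      (fun s : Σ j, κ j => e s.1) := by
    intro s t hst
    have hne : s.1 ≠ t.1 := by
      intro h
      change e t.1 < e s.1 at hst
      rw [h] at hst
      exact lt_irrefl _ hst
    rw [entry, Pi.single_eq_of_ne hne]
    simp
  rw [tri.det_fintype]
  refine Finset.prod_pos fun k _ => ?_
  obtain ⟨j, rfl⟩ := e.surjective k
  let q : κ j ≃ {s : Σ j, κ j // e s.1 = e j} :=
    { toFun := fun a => ⟨⟨j, a⟩, rfl⟩
      invFun := fun s => (e.injective s.2) ▸ s.1.2
      left_inv := fun a => rfl
      right_inv := by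
        rintro ⟨⟨i, a⟩, h⟩
        obtain rfl := e.injective h
        rfl }
  rw [← Matrix.det_submatrix_equiv_self q]
  have : (Matrix.toSquareBlock ((Pi.basis b).toMatrix (Pi.basis b'))
      (fun s : Σ j, κ j => e s.1) (e j)).submatrix q q = (b j).toMatrix (b' j) := by
    ext a c
    rw [Matrix.submatrix_apply, Matrix.toSquareBlock_def, Matrix.of_apply, entry]
    simp [q, Module.Basis.toMatrix_apply]
  rw [this, ← Module.Basis.det_apply]
  exact (Module.Basis.orientation_eq_iff_det_pos _ _).1 (h j)

/-- A positively oriented basis of the tangent space. -/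
def posBasis {E H : Type} [NormedAddCommGroup E] [NormedSpace ℝ E] [TopologicalSpace H]
    {I : ModelWithCorners ℝ E H} {M : Type u} [TopologicalSpace M] [ChartedSpace H M]
    [IsManifold I ∞ M] {κ : Type} [Fintype κ] [DecidableEq κ] (g : OrientedRiemannian I M κ)
    (x : M) : Module.Basis κ ℝ (TangentSpace I x) :=
  (g.locally_framed x).choose_spec.2.2.choose x

lemma posBasis_orientation {E H : Type} [NormedAddCommGroup E] [NormedSpace ℝ E]
    [TopologicalSpace H] {I : ModelWithCorners ℝ E H} {M : Type u} [TopologicalSpace M]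
    [ChartedSpace H M] [IsManifold I ∞ M] {κ : Type} [Fintype κ] [DecidableEq κ]
    (g : OrientedRiemannian I M κ) (x : M) : (posBasis g x).orientation = g.orientation x :=
  (g.locally_framed x).choose_spec.2.2.choose_spec.2 x (g.locally_framed x).choose_spec.2.1

/-- The Riemannian product, with the product orientation: concatenating positively oriented bases
of the `T M_j` gives a positively oriented basis of `T M`. -/
def product (g : ∀ j, OrientedRiemannian (I j) (M j) (κ j)) :
    OrientedRiemannian (ModelWithCorners.pi I) (∀ j, M j) (Σ j, κ j) where
  metric := productMetric I fun j => (g j).metric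
  orientation x := ((Pi.basis fun j => posBasis (g j) (x j)).map (tangentSum x)).orientation
  locally_framed x₀ := by
    choose U hU hx b hb hbo using fun j => (g j).locally_framed (x₀ j)
    refine ⟨Set.univ.pi U, isOpen_set_pi Set.finite_univ fun j _ => hU j, fun j _ => hx j,
      fun x => (Pi.basis fun j => b j (x j)).map (tangentSum x), ?_, ?_⟩
    · rintro ⟨j, k⟩
      refine (contMDiffOn_single I j (fun y => b j y k) (U j) (hb j k) _ ?_).mono
        (fun x hx => hx j trivial)
      intro x i
      rw [Module.Basis.map_apply, Pi.basis_apply]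
      rfl
    · intro x hx
      rw [Module.Basis.orientation_map, Module.Basis.orientation_map]
      congr 1
      exact pi_orientation_congr _ _ fun j =>
        (hbo j (x j) (hx j trivial)).trans (posBasis_orientation (g j) (x j)).symm

lemma product_inner (g : ∀ j, OrientedRiemannian (I j) (M j) (κ j)) (x : ∀ j, M j)
    (v w : TangentSpace (ModelWithCorners.pi I) x) :
    (product g).metric.inner x v w = ∑ j, (g j).metric.inner (x j) (v j) (w j) :=
  sumForm_apply _ _ _

/-- The orthonormal frame of the product obtained by joining orthonormal frames of the factors. -/
def productFrame {g : ∀ j, OrientedRiemannian (I j) (M j) (κ j)} {x : ∀ j, M j}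
    (f : ∀ j, Frame (g j) (x j)) : Frame (product g) x where
  toEquiv := ((LinearEquiv.piCurry ℝ fun (j : J) (_ : κ j) => ℝ).trans
    (LinearEquiv.piCongrRight fun j => (f j).toEquiv)).trans (tangentSum x)
  inner_eq v w := by
    rw [product_inner]
    have : ∀ j, (g j).metric.inner (x j) ((f j).toEquiv fun a => v ⟨j, a⟩)
        ((f j).toEquiv fun a => w ⟨j, a⟩) = ∑ a, v ⟨j, a⟩ * w ⟨j, a⟩ :=
      fun j => (f j).inner_eq _ _
    rw [dotProduct, Fintype.sum_sigma]
    exact Finset.sum_congr rfl fun j _ => this j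
  oriented := by
    have e : (Pi.basisFun ℝ (Σ j, κ j)).map
        (((LinearEquiv.piCurry ℝ fun (j : J) (_ : κ j) => ℝ).trans
          (LinearEquiv.piCongrRight fun j => (f j).toEquiv)).trans (tangentSum x)) =
        (Pi.basis fun j => (Pi.basisFun ℝ (κ j)).map (f j).toEquiv).map (tangentSum x) := by
      apply Module.Basis.eq_of_apply_eq
      rintro ⟨j, a⟩
      rw [Module.Basis.map_apply, Module.Basis.map_apply, Pi.basis_apply]
      simp only [LinearEquiv.trans_apply]
      congr 1
      funext k
      rw [LinearEquiv.piCongrRight_apply]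
      by_cases h : k = j
      · subst h
        simp only [Pi.basisFun_apply, Pi.single_eq_same, Module.Basis.map_apply]
        congr 1
        funext c
        simp [Sigma.curry, Pi.single_apply]
      · rw [Pi.single_eq_of_ne h]
        convert map_zero (f k).toEquiv
        funext c
        simp [Sigma.curry, h]
    rw [e]
    change _ = ((Pi.basis fun j => posBasis (g j) (x j)).map (tangentSum x)).orientation
    rw [Module.Basis.orientation_map, Module.Basis.orientation_map]
    congr 1
    exact pi_orientation_congr _ _ fun j =>
      (f j).oriented.trans (posBasis_orientation (g j) (x j)).symm

end Product

section Smooth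

variable {E H : Type} [NormedAddCommGroup E] [NormedSpace ℝ E] [TopologicalSpace H]
  {I : ModelWithCorners ℝ E H} {M : Type u} [TopologicalSpace M] [ChartedSpace H M]

lemma SmoothOn.linear {A B : Type*} [AddCommGroup A] [Module ℝ A] [AddCommGroup B] [Module ℝ B]
    {f : M → A} {U : Set M} (hf : SmoothOn I f U) (L : A →ₗ[ℝ] B) :
    SmoothOn I (fun x => L (f x)) U := fun ℓ => hf (ℓ ∘ₗ L)

lemma SmoothOn.mono {A : Type*} [AddCommGroup A] [Module ℝ A] {f : M → A} {U V : Set M}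
    (hf : SmoothOn I f U) (h : V ⊆ U) : SmoothOn I f V := fun ℓ => (hf ℓ).mono h

lemma SmoothOn.congr {A : Type*} [AddCommGroup A] [Module ℝ A] {f f' : M → A} {U : Set M}
    (hf : SmoothOn I f U) (h : ∀ x ∈ U, f' x = f x) : SmoothOn I f' U :=
  fun ℓ => (hf ℓ).congr fun x hx => by rw [h x hx]

lemma SmoothOn.mul {A : Type*} [Ring A] [Algebra ℝ A] [FiniteDimensional ℝ A]
    {f f' : M → A} {U : Set M} (hf : SmoothOn I f U) (hf' : SmoothOn I f' U) :
    SmoothOn I (fun x => f x * f' x) U := by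
  intro ℓ
  let b := Module.finBasis ℝ A
  have h : ∀ x, ℓ (f x * f' x) = ∑ k, b.coord k (f x) * (ℓ ∘ₗ LinearMap.mulLeft ℝ (b k)) (f' x) := by
    intro x
    conv_lhs => rw [← b.sum_repr (f x), Finset.sum_mul, map_sum]
    exact Finset.sum_congr rfl fun k _ => by simp
  simp only [h]
  exact contMDiffOn_finsetSum fun k _ => (hf (b.coord k)).mul (hf' _)

lemma SmoothOn.multilinear {J : Type} [Fintype J] {A : J → Type*} {B : Type*}
    [∀ j, AddCommGroup (A j)] [∀ j, Module ℝ (A j)] [∀ j, FiniteDimensional ℝ (A j)]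
    [AddCommGroup B] [Module ℝ B] (m : MultilinearMap ℝ A B) {f : ∀ j, M → A j} {U : Set M}
    (hf : ∀ j, SmoothOn I (f j) U) : SmoothOn I (fun x => m fun j => f j x) U := by
  classical
  intro ℓ
  let b := fun j => Module.finBasis ℝ (A j)
  have h : ∀ x, ℓ (m fun j => f j x) =
      ∑ r : ∀ j, Fin (Module.finrank ℝ (A j)),
        (∏ j, (b j).coord (r j) (f j x)) * ℓ (m fun j => b j (r j)) := by
    intro x
    have e : (fun j => f j x) = fun j => ∑ k, (b j).coord k (f j x) • b j k := by
      funext j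
      exact ((b j).sum_repr (f j x)).symm
    rw [e, MultilinearMap.map_sum, map_sum]
    exact Finset.sum_congr rfl fun r _ => by
      rw [MultilinearMap.map_smul_univ, map_smul, smul_eq_mul]
  simp only [h]
  exact contMDiffOn_finsetSum fun r _ =>
    (contMDiffOn_finsetProd fun j _ => hf j ((b j).coord (r j))).mul contMDiffOn_const

lemma smoothOn_noncommProd {J κ : Type} [DecidableEq J] [Fintype κ] (s : Finset J) (f : J → M → Spin κ)
    (hc : ∀ x, (s : Set J).Pairwise (Function.onFun Commute fun j => f j x)) {U : Set M}
    (hf : ∀ j, SmoothOn I (fun x => (f j x : Cl κ)) U) :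
    SmoothOn I (fun x => ((s.noncommProd (fun j => f j x) (hc x) : Spin κ) : Cl κ)) U := by
  induction s using Finset.induction_on with
  | empty =>
    simp only [Finset.noncommProd_empty]
    exact fun ℓ => contMDiffOn_const
  | insert j s hj ih =>
    have := (hf j).mul (ih fun x => (hc x).mono (by simp))
    refine this.congr fun x _ => ?_
    rw [Finset.noncommProd_insert_of_notMem _ _ _ _ hj, Submonoid.coe_mul]

end Smooth

section Induced

variable {J : Type} [Fintype J] {E : J → Type} [∀ j, NormedAddCommGroup (E j)]
  [∀ j, NormedSpace ℝ (E j)] {H : J → Type} [∀ j, TopologicalSpace (H j)]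
  {I : ∀ j, ModelWithCorners ℝ (E j) (H j)}
  {M : J → Type u} [∀ j, TopologicalSpace (M j)] [∀ j, ChartedSpace (H j) (M j)]

lemma SmoothOn.comp_eval {A : Type*} [AddCommGroup A] [Module ℝ A] (j : J) {f : M j → A}
    {U : Set (M j)} (hf : SmoothOn (I j) f U) {V : Set (∀ j, M j)} (hV : ∀ x ∈ V, x j ∈ U) :
    SmoothOn (ModelWithCorners.pi I) (fun x : ∀ j, M j => f (x j)) V :=
  fun ℓ => (hf ℓ).comp (contMDiff_eval I j).contMDiffOn hV

variable [DecidableEq J] [∀ j, IsManifold (I j) ∞ (M j)] {κ : J → Type} [∀ j, Fintype (κ j)]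
  [∀ j, DecidableEq (κ j)] {g : ∀ j, OrientedRiemannian (I j) (M j) (κ j)}

lemma Frame.ext' {E H : Type} [NormedAddCommGroup E] [NormedSpace ℝ E]
    [TopologicalSpace H] {I : ModelWithCorners ℝ E H} {M : Type u} [TopologicalSpace M]
    [ChartedSpace H M] [IsManifold I ∞ M] {κ : Type} [Fintype κ] [DecidableEq κ]
    {g : OrientedRiemannian I M κ} {x : M} {f f' : Frame g x}
    (h : ∀ v, f.toEquiv v = f'.toEquiv v) : f = f' := by
  obtain ⟨e, _, _⟩ := f
  obtain ⟨e', _, _⟩ := f'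
  have : e = e' := LinearEquiv.ext h
  subst this
  rfl

lemma Frame.rotate_mul {E H : Type} [NormedAddCommGroup E] [NormedSpace ℝ E]
    [TopologicalSpace H] {I : ModelWithCorners ℝ E H} {M : Type u} [TopologicalSpace M]
    [ChartedSpace H M] [IsManifold I ∞ M] {κ : Type} [Fintype κ] [DecidableEq κ]
    {g : OrientedRiemannian I M κ} {x : M} (f : Frame g x) (a b : Spin κ) :
    f.rotate (a * b) = (f.rotate a).rotate b :=
  Frame.ext' fun v => congrArg f.toEquiv (rot_mul a b v)

lemma Frame.rotate_one {E H : Type} [NormedAddCommGroup E] [NormedSpace ℝ E]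
    [TopologicalSpace H] {I : ModelWithCorners ℝ E H} {M : Type u} [TopologicalSpace M]
    [ChartedSpace H M] [IsManifold I ∞ M] {κ : Type} [Fintype κ] [DecidableEq κ]
    {g : OrientedRiemannian I M κ} {x : M} (f : Frame g x) : f.rotate 1 = f :=
  Frame.ext' fun v => congrArg f.toEquiv (rot_one v)

lemma productFrame_rotate {x : ∀ j, M j} (f : ∀ j, Frame (g j) (x j)) (a : ∀ j, Spin (κ j)) :
    productFrame (fun j => (f j).rotate (a j)) = (productFrame f).rotate (spinProd a) := by
  refine Frame.ext' fun v => funext fun j => ?_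
  change (f j).toEquiv (rot (a j) fun b => v ⟨j, b⟩) =
    (f j).toEquiv fun b => rot (spinProd a) v ⟨j, b⟩
  congr 1
  funext b
  rw [rot_spinProd]

variable (P : ∀ j, SpinStructure.{u, w, w'} (g j))

/-- The fibre over `x` of `(∏ P_j) ×_{∏ Spin(κ j)} Spin(⨁ κ)`. The class of a pair `(p, b)` is
recorded as the equivariant map `F : ∏ P_j → Spin(⨁ κ)` with `F p = b`. -/
@[ext] structure InducedFiber (x : ∀ j, M j) where
  toFun : (∀ j, (P j).fiber (x j)) → Spin (Σ j, κ j)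
  equivariant : ∀ (p : ∀ j, (P j).fiber (x j)) (a : ∀ j, Spin (κ j)),
    toFun (fun j => (P j).act (p j) (a j)) = (spinProd a)⁻¹ * toFun p

variable {P}

lemma SpinPrincipalBundle.div_act_right {E H : Type} [NormedAddCommGroup E] [NormedSpace ℝ E]
    [TopologicalSpace H] {I : ModelWithCorners ℝ E H} {M : Type u} [TopologicalSpace M]
    [ChartedSpace H M] {κ : Type} [Fintype κ]
    (P : SpinPrincipalBundle.{u, w, w'} I M κ) {x : M} (p q : P.fiber x) (a : Spin κ) :
    P.div p (P.act q a) = P.div p q * a := by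
  rw [← P.div_act p (P.div p q * a), P.act_mul, P.act_div]

lemma SpinPrincipalBundle.div_self {E H : Type} [NormedAddCommGroup E] [NormedSpace ℝ E]
    [TopologicalSpace H] {I : ModelWithCorners ℝ E H} {M : Type u} [TopologicalSpace M]
    [ChartedSpace H M] {κ : Type} [Fintype κ]
    (P : SpinPrincipalBundle.{u, w, w'} I M κ) {x : M} (p : P.fiber x) : P.div p p = 1 := by
  conv_lhs => rw [← P.act_one p]
  rw [P.act_one, ← P.div_act p 1, P.act_one]

lemma InducedFiber.apply_eq {x : ∀ j, M j} (F : InducedFiber P x)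
    (p q : ∀ j, (P j).fiber (x j)) :
    F.toFun q = (spinProd fun j => (P j).div (p j) (q j))⁻¹ * F.toFun p := by
  rw [← F.equivariant]
  exact congrArg F.toFun (funext fun j => ((P j).act_div _ _).symm)

variable (P)

/-- The map `∏ P_j → P`, `p ↦ [p, 1]`, exhibiting `∏ P_j` as a reduction of the induced bundle. -/
def reduction {x : ∀ j, M j} (p : ∀ j, (P j).fiber (x j)) : InducedFiber P x :=
  ⟨fun q => (spinProd fun j => (P j).div (p j) (q j))⁻¹, fun q a => by
    rw [← mul_inv_rev, ← map_mul]
    exact congrArg (fun c => (spinProd c)⁻¹) (funext fun j => (P j).div_act_right _ _ _)⟩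

/-- A point of `∏ P_j` over `x`. -/
def basePoint (x : ∀ j, M j) (j : J) : (P j).fiber (x j) :=
  (P j).sec ((P j).cover (x j)).choose (x j)

lemma frame_indep {x : ∀ j, M j} (F : InducedFiber P x) (p q : ∀ j, (P j).fiber (x j)) :
    (productFrame fun j => (P j).frame (q j)).rotate (F.toFun q) =
      (productFrame fun j => (P j).frame (p j)).rotate (F.toFun p) := by
  have h : (fun j => (P j).frame (q j)) =
      fun j => ((P j).frame (p j)).rotate ((P j).div (p j) (q j)) := by
    funext j
    rw [← (P j).frame_act, (P j).act_div]
  rw [h, productFrame_rotate, F.apply_eq p q, ← Frame.rotate_mul, mul_inv_cancel_left]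

/-- The induced spin structure on the Riemannian product: the principal bundle
`(∏ P_j) ×_{∏ Spin(κ j)} Spin(⨁ κ)`, where `[p, b]` is mapped to the frame obtained by joining the
frames of the `p j` and rotating by `b`. Its local sections are the `[(s_j), 1]`. -/
def inducedSpinStructure : SpinStructure.{u, w, w'} (product g) where
  fiber := InducedFiber P
  act F b := ⟨fun p => F.toFun p * b, fun p a => by rw [F.equivariant, mul_assoc]⟩
  act_one F := InducedFiber.ext (funext fun p => mul_one _)
  act_mul F a b := InducedFiber.ext (funext fun p => (mul_assoc _ _ _).symm)
  div {x} F F' := (F.toFun (basePoint P x))⁻¹ * F'.toFun (basePoint P x)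
  act_div {x} F F' := by
    refine InducedFiber.ext (funext fun p => ?_)
    change F.toFun p * ((F.toFun (basePoint P x))⁻¹ * F'.toFun (basePoint P x)) = F'.toFun p
    rw [F.apply_eq (basePoint P x) p, F'.apply_eq (basePoint P x) p, mul_assoc,
      mul_inv_cancel_left]
  div_act F a := inv_mul_cancel_left _ _
  Index := ∀ j, (P j).Index
  dom a := Set.univ.pi fun j => (P j).dom (a j)
  isOpen_dom a := isOpen_set_pi Set.finite_univ fun j _ => (P j).isOpen_dom (a j)
  cover x := ⟨fun j => ((P j).cover (x j)).choose, fun j _ => ((P j).cover (x j)).choose_spec⟩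
  sec a x := reduction P fun j => (P j).sec (a j) (x j)
  smooth_transition a b := by
    have key : ∀ x : ∀ j, M j,
        ((reduction P fun j => (P j).sec (a j) (x j)).toFun (basePoint P x))⁻¹ *
          (reduction P fun j => (P j).sec (b j) (x j)).toFun (basePoint P x) =
        spinProd fun j => (P j).div ((P j).sec (a j) (x j)) ((P j).sec (b j) (x j)) := by
      intro x
      change (spinProd _)⁻¹⁻¹ * (spinProd _)⁻¹ = _
      rw [inv_inv, ← map_inv, ← map_mul]
      refine congrArg spinProd (funext fun j => ?_)
      rw [Pi.mul_apply, Pi.inv_apply, mul_inv_eq_iff_eq_mul, ← (P j).div_act_right, (P j).act_div]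
    refine SmoothOn.congr ?_ (fun x _ => congrArg Subtype.val (key x))
    simp only [spinProd, MonoidHom.noncommPiCoprod_apply]
    refine smoothOn_noncommProd _ _ _ fun j => ?_
    refine SmoothOn.comp_eval (f := fun y => CliffordAlgebra.map (incl j)
      ((P j).div ((P j).sec (a j) y) ((P j).sec (b j) y) : Cl (κ j))) j
      (((P j).smooth_transition (a j) (b j)).linear (CliffordAlgebra.map (incl j)).toLinearMap) ?_
    exact fun x hx => ⟨hx.1 j trivial, hx.2 j trivial⟩
  frame {x} F := (productFrame fun j => (P j).frame (basePoint P x j)).rotate (F.toFun (basePoint P x))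
  frame_act F a := Frame.rotate_mul _ _ _
  smooth_frame a k := by
    obtain ⟨j, k⟩ := k
    have key : ∀ x : ∀ j, M j,
        (productFrame fun j => (P j).frame (basePoint P x j)).rotate
          ((reduction P fun j => (P j).sec (a j) (x j)).toFun (basePoint P x)) =
        productFrame fun j => (P j).frame ((P j).sec (a j) (x j)) := by
      intro x
      rw [frame_indep P _ fun j => (P j).sec (a j) (x j)]
      have : (reduction P fun j => (P j).sec (a j) (x j)).toFun
          (fun j => (P j).sec (a j) (x j)) = 1 := by
        change (spinProd _)⁻¹ = 1
        rw [inv_eq_one, ← map_one spinProd]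
        exact congrArg spinProd (funext fun j => (P j).div_self _)
      rw [this, Frame.rotate_one]
    simp only [key]
    refine (contMDiffOn_single I j (fun y => ((P j).frame ((P j).sec (a j) y)).toEquiv
      (Pi.single k 1)) _ ((P j).smooth_frame (a j) k) _ ?_).mono (fun x hx => hx j trivial)
    intro x i
    change ((P i).frame ((P i).sec (a i) (x i))).toEquiv
      (fun c => (Pi.single ⟨j, k⟩ 1 : (Σ j, κ j) → ℝ) ⟨i, c⟩) = _
    by_cases h : i = j
    · subst h
      refine Eq.trans ?_ (Pi.single_eq_same (M := E) i _).symm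
      congr 1
      funext c
      simp [Pi.single_apply]
    · refine Eq.trans ?_ (Pi.single_eq_of_ne (M := E) h _).symm
      refine Eq.trans (congrArg _ ?_) (map_zero ((P i).frame ((P i).sec (a i) (x i))).toEquiv)
      funext c
      simp [h]

end Induced

section Bundles

variable {E H : Type} [NormedAddCommGroup E] [NormedSpace ℝ E] [TopologicalSpace H]
  (I : ModelWithCorners ℝ E H) (M : Type u) [TopologicalSpace M] [ChartedSpace H M]

/-- A smooth complex vector bundle over `M`, given by its fibres and a bundle atlas: a cover of `M`
by open sets `dom a` with linear trivializations `triv a` whose transition functions are smooth.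
The values of `triv a` outside `dom a` play no role. -/
structure ComplexBundle where
  fiber : M → Type f
  [addCommGroup : ∀ x, AddCommGroup (fiber x)]
  [module : ∀ x, Module ℂ (fiber x)]
  model : Type m
  [addCommGroupModel : AddCommGroup model]
  [moduleModel : Module ℂ model]
  [finiteModel : FiniteDimensional ℂ model]
  Index : Type w'
  dom : Index → Set M
  isOpen_dom : ∀ a, IsOpen (dom a)
  cover : ∀ x : M, ∃ a, x ∈ dom a
  triv : Index → ∀ x : M, fiber x ≃ₗ[ℂ] model
  smooth_transition : ∀ (a b : Index) (v : model),
    SmoothOn I (fun x => triv b x ((triv a x).symm v)) (dom a ∩ dom b)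

attribute [instance] ComplexBundle.addCommGroup ComplexBundle.module
  ComplexBundle.addCommGroupModel ComplexBundle.moduleModel ComplexBundle.finiteModel

variable {I M}

/-- An isomorphism of smooth complex vector bundles over the identity of `M`. -/
structure ComplexBundle.Iso (B : ComplexBundle.{u, w', f, m} I M)
    (C : ComplexBundle.{u, w, v, v'} I M) where
  equiv : ∀ x : M, B.fiber x ≃ₗ[ℂ] C.fiber x
  smooth : ∀ (a : B.Index) (b : C.Index) (v : B.model),
    SmoothOn I (fun x => C.triv b x (equiv x ((B.triv a x).symm v))) (B.dom a ∩ C.dom b)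
  smooth_symm : ∀ (a : B.Index) (b : C.Index) (v : C.model),
    SmoothOn I (fun x => B.triv a x ((equiv x).symm ((C.triv b x).symm v))) (B.dom a ∩ C.dom b)

end Bundles

section Spinors

/-- A complex spinor module: an irreducible complex representation of the Clifford algebra. -/
structure SpinorModule (κ : Type) [Fintype κ] where
  carrier : Type v
  [addCommGroup : AddCommGroup carrier]
  [module : Module ℂ carrier]
  [finite : FiniteDimensional ℂ carrier]
  c : Cl κ →ₐ[ℝ] Module.End ℂ carrier
  nontrivial : Nontrivial carrier
  irreducible : ∀ V : Submodule ℂ carrier, (∀ (z : Cl κ), ∀ s ∈ V, c z s ∈ V) → V = ⊥ ∨ V = ⊤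

attribute [instance] SpinorModule.addCommGroup SpinorModule.module SpinorModule.finite

variable {E H : Type} [NormedAddCommGroup E] [NormedSpace ℝ E] [TopologicalSpace H]
  {I : ModelWithCorners ℝ E H} {M : Type u} [TopologicalSpace M] [ChartedSpace H M]
  [IsManifold I ∞ M] {κ : Type} [Fintype κ] [DecidableEq κ] {g : OrientedRiemannian I M κ}
  (P : SpinStructure.{u, w, w'} g) (Δ : SpinorModule.{v} κ)

/-- The fibre over `x` of the associated bundle `P ×_Spin Δ`. The class of a pair `(p, s)` is
recorded as the equivariant map `f : P_x → Δ` with `f p = s`. -/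
def spinorSubmodule (x : M) : Submodule ℂ (P.fiber x → Δ.carrier) where
  carrier := {f | ∀ (p : P.fiber x) (a : Spin κ),
    f (P.act p a) = Δ.c ((a⁻¹ : Spin κ) : Cl κ) (f p)}
  zero_mem' p a := (map_zero _).symm
  add_mem' {f f'} hf hf' p a := by
    rw [Pi.add_apply, Pi.add_apply, hf, hf', map_add]
  smul_mem' r f hf p a := by
    rw [Pi.smul_apply, Pi.smul_apply, hf, map_smul]

/-- The fibre of `P ×_Spin Δ` as a type. -/
def spinorFiber (x : M) : Type (max w v) := spinorSubmodule P Δ x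

instance (x : M) : AddCommGroup (spinorFiber P Δ x) :=
  inferInstanceAs (AddCommGroup (spinorSubmodule P Δ x))

instance (x : M) : Module ℂ (spinorFiber P Δ x) :=
  inferInstanceAs (Module ℂ (spinorSubmodule P Δ x))

lemma div_inv {x : M} (p q : P.fiber x) : (P.div p q)⁻¹ = P.div q p := by
  rw [inv_eq_iff_mul_eq_one, ← P.div_act_right, P.act_div, P.div_self]

variable {P Δ}

lemma spinorFiber_apply {x : M} (s : spinorFiber P Δ x) (p q : P.fiber x) :
    s.1 q = Δ.c (P.div q p : Spin κ) (s.1 p) := by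
  have := s.2 p (P.div p q)
  rwa [P.act_div, div_inv] at this

/-- The isomorphism of the fibre with `Δ` given by a point `p` of the spin structure. -/
def evalAt {x : M} (p : P.fiber x) : spinorFiber P Δ x ≃ₗ[ℂ] Δ.carrier where
  toFun s := s.1 p
  map_add' _ _ := rfl
  map_smul' _ _ := rfl
  invFun v := ⟨fun q => Δ.c (P.div q p : Spin κ) v, fun q a => by
    change Δ.c (P.div (P.act q a) p : Spin κ) v = Δ.c ((a⁻¹ : Spin κ) : Cl κ) (Δ.c _ v)
    rw [← Module.End.mul_apply, ← map_mul, ← Submonoid.coe_mul, ← div_inv P p, P.div_act_right,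
      mul_inv_rev, div_inv]⟩
  left_inv s := Subtype.ext (funext fun q => (spinorFiber_apply s p q).symm)
  right_inv v := by
    change Δ.c (P.div p p : Spin κ) v = v
    rw [P.div_self, Submonoid.coe_one, map_one, Module.End.one_apply]

lemma evalAt_symm_apply {x : M} (p q : P.fiber x) (v : Δ.carrier) :
    evalAt q ((evalAt p).symm v) = Δ.c (P.div q p : Spin κ) v := rfl

lemma smoothOn_transition (a b : P.Index) (v : Δ.carrier) :
    SmoothOn I (fun x => evalAt (P.sec b x) ((evalAt (P.sec a x)).symm v))
      (P.dom a ∩ P.dom b) :=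
  ((P.smooth_transition b a).mono fun _ hx => ⟨hx.2, hx.1⟩).linear
    { toFun := fun z => Δ.c z v
      map_add' := fun z z' => by rw [map_add, LinearMap.add_apply]
      map_smul' := fun r z => by rw [map_smul, LinearMap.smul_apply, RingHom.id_apply] }

variable (P Δ)

/-- The spinor bundle `P ×_Spin Δ` of a spin structure. -/
def spinorBundle : ComplexBundle.{u, w', max w v, v} I M where
  fiber x := spinorFiber P Δ x
  model := Δ.carrier
  Index := P.Index
  dom := P.dom
  isOpen_dom := P.isOpen_dom
  cover := P.cover
  triv a x := evalAt (P.sec a x)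
  smooth_transition := smoothOn_transition

lemma frame_symm_act {x : M} (p : P.fiber x) (a : Spin κ) (X : TangentSpace I x) :
    (P.frame (P.act p a)).toEquiv.symm X = rot a⁻¹ ((P.frame p).toEquiv.symm X) := by
  rw [LinearEquiv.symm_apply_eq, P.frame_act]
  change X = (P.frame p).toEquiv (rot a (rot a⁻¹ _))
  rw [← rot_mul, mul_inv_cancel, rot_one, LinearEquiv.apply_symm_apply]

/-- Clifford multiplication by the tangent vector `X`: `X · [p, s] = [p, v · s]`, where `v` is the
coordinate vector of `X` in the frame of `p`. -/
def cliffordMul {x : M} (X : TangentSpace I x) : spinorFiber P Δ x →ₗ[ℂ] spinorFiber P Δ x where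
  toFun s := ⟨fun p => Δ.c (ι (stdForm κ) ((P.frame p).toEquiv.symm X)) (s.1 p), fun p a => by
    change Δ.c (ι (stdForm κ) ((P.frame (P.act p a)).toEquiv.symm X)) (s.1 (P.act p a)) =
      Δ.c ((a⁻¹ : Spin κ) : Cl κ) (Δ.c (ι (stdForm κ) ((P.frame p).toEquiv.symm X)) (s.1 p))
    rw [s.2, frame_symm_act, ι_rot, inv_inv, ← Module.End.mul_apply, ← Module.End.mul_apply,
      ← map_mul, ← map_mul, mul_assoc, coe_mul_coe_inv, mul_one]⟩
  map_add' s s' := Subtype.ext (funext fun p => map_add _ _ _)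
  map_smul' r s := Subtype.ext (funext fun p => map_smul _ _ _)

end Spinors

section Grading

/-- The volume element `e₁ ⋯ e_D` of the Clifford algebra. -/
def vol (D : ℕ) : Cl (Fin D) :=
  ((List.finRange D).map fun k => ι (stdForm (Fin D)) (Pi.single k 1)).prod

lemma single_anticomm {κ : Type} [Fintype κ] [DecidableEq κ] {k l : κ} (h : k ≠ l) :
    ι (stdForm κ) (Pi.single k 1) * ι (stdForm κ) (Pi.single l 1) =
      -(ι (stdForm κ) (Pi.single l 1) * ι (stdForm κ) (Pi.single k 1)) := by
  rw [eq_neg_iff_add_eq_zero]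
  refine ι_mul_ι_add_swap_of_isOrtho ?_
  rw [QuadraticMap.isOrtho_def]
  simp only [stdForm_apply, Pi.add_apply, mul_add, add_mul, Finset.sum_add_distrib]
  simp [Pi.single_apply, h, h.symm]

lemma single_mul_vol {D : ℕ} (k : Fin D) :
    ι (stdForm (Fin D)) (Pi.single k 1) * vol D =
      ((-1 : ℝ) ^ (D - 1)) • (vol D * ι (stdForm (Fin D)) (Pi.single k 1)) := by
  have h : ∀ l : List (Fin D), ι (stdForm (Fin D)) (Pi.single k 1) *
      (l.map fun k => ι (stdForm (Fin D)) (Pi.single k 1)).prod =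
      ((-1 : ℝ) ^ (l.countP fun j => j ≠ k)) •
        ((l.map fun k => ι (stdForm (Fin D)) (Pi.single k 1)).prod *
          ι (stdForm (Fin D)) (Pi.single k 1)) := by
    intro l
    induction l with
    | nil => simp
    | cons j l ih =>
      rw [List.map_cons, List.prod_cons, List.countP_cons]
      by_cases hj : j = k
      · subst hj
        rw [mul_assoc, ih]
        simp
      · rw [← mul_assoc, single_anticomm (Ne.symm hj), neg_mul, mul_assoc, ih]
        simp [hj, pow_succ, mul_assoc]
  have e : (List.finRange D).countP (fun j => j ≠ k) = D - 1 := by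
    have h1 := List.length_eq_countP_add_countP (fun j => decide (j = k)) (l := List.finRange D)
    have h2 : (List.finRange D).countP (fun j => decide (j = k)) = 1 := by
      have := List.count_eq_one_of_mem (List.nodup_finRange D) (List.mem_finRange k)
      rw [List.count] at this
      convert this using 2
      funext j
      exact Bool.eq_iff_iff.2 (by simp)
    simp only [List.length_finRange] at h1
    rw [h2] at h1
    simp at h1 ⊢
    omega
  rw [vol, h, e]

lemma ι_mul_vol {D : ℕ} (v : Fin D → ℝ) : ι (stdForm (Fin D)) v * vol D =
    ((-1 : ℝ) ^ (D - 1)) • (vol D * ι (stdForm (Fin D)) v) := by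
  have : v = ∑ k, v k • (Pi.single k 1 : Fin D → ℝ) := by
    ext j; simp [Finset.sum_apply, Pi.single_apply]
  rw [this]
  simp only [map_sum, map_smul, Finset.sum_mul, Finset.mul_sum, Finset.smul_sum]
  refine Finset.sum_congr rfl fun k _ => ?_
  rw [smul_mul_assoc, single_mul_vol, mul_smul_comm, smul_comm]

lemma commute_vol {D : ℕ} (a : Spin (Fin D)) : (a : Cl (Fin D)) * vol D = vol D * a := by
  have h : (a : Cl (Fin D)) ∈ evenOdd (stdForm (Fin D)) 0 := spinGroup.mem_even a.2
  generalize (a : Cl (Fin D)) = z at h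
  induction z, h using CliffordAlgebra.even_induction with
  | algebraMap r => exact Algebra.commutes r _
  | add x y hx hy ihx ihy => rw [add_mul, mul_add, ihx, ihy]
  | ι_mul_ι_mul v w x hx ih =>
    rw [mul_assoc, ih, ← mul_assoc, mul_assoc (ι _ v), ι_mul_vol, mul_smul_comm, ← mul_assoc,
      ι_mul_vol, smul_mul_assoc, smul_mul_assoc, smul_mul_assoc, smul_smul, ← pow_add]
    rw [Even.neg_one_pow ⟨D - 1, rfl⟩, one_smul]
    simp only [mul_assoc]

variable {D : ℕ}

/-- The half `Δ^ε` of a spinor module, `ε = ±1`. In even dimension it is the eigenspace of the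
normalized volume element `i^(D/2) e₁ ⋯ e_D` (an involution), in odd dimension it is all of `Δ`. -/
def half (Δ : SpinorModule.{v} (Fin D)) (ε : ℂ) : Submodule ℂ Δ.carrier :=
  if Even D then Module.End.eigenspace (Complex.I ^ (D / 2) • Δ.c (vol D)) ε else ⊤

lemma c_mem_half {Δ : SpinorModule.{v} (Fin D)} {ε : ℂ} (a : Spin (Fin D)) {s : Δ.carrier}
    (hs : s ∈ half Δ ε) : Δ.c (a : Cl (Fin D)) s ∈ half Δ ε := by
  unfold half at hs ⊢
  split_ifs at hs ⊢ with h
  · rw [Module.End.mem_eigenspace_iff] at hs ⊢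
    rw [LinearMap.smul_apply, ← Module.End.mul_apply, ← map_mul, ← commute_vol, map_mul,
      Module.End.mul_apply, ← map_smul, ← LinearMap.smul_apply, hs, map_smul]
  · trivial

variable {E H : Type} [NormedAddCommGroup E] [NormedSpace ℝ E] [TopologicalSpace H]
  {I : ModelWithCorners ℝ E H} {M : Type u} [TopologicalSpace M] [ChartedSpace H M]
  [IsManifold I ∞ M] {g : OrientedRiemannian I M (Fin D)}
  (P : SpinStructure.{u, w, w'} g) (Δ : SpinorModule.{v} (Fin D))

/-- The fibre of the half spinor bundle `P ×_Spin Δ^ε`. -/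
def halfFiber (ε : ℂ) (x : M) : Submodule ℂ (spinorFiber P Δ x) :=
  ⨅ p : P.fiber x, (half Δ ε).comap (evalAt p).toLinearMap

lemma halfFiber_map (ε : ℂ) {x : M} (p : P.fiber x) :
    (halfFiber P Δ ε x).map (evalAt p).toLinearMap = half Δ ε := by
  apply le_antisymm
  · rintro _ ⟨s, hs, rfl⟩
    exact (Submodule.mem_iInf _).1 hs p
  · intro v hv
    refine ⟨(evalAt p).symm v, ?_, (evalAt p).apply_symm_apply v⟩
    exact (Submodule.mem_iInf _).2 fun q => c_mem_half _ hv

end Grading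

section Tensor

variable {N : ℕ}

/-- Given spaces `F_i` with subspaces `F_i^+` and `F_i^-`, this is the subspace of
`⨂_i (F_i ⊕ F_i)` that is the tensor product of the diagonals `Δ(F_i ⊕ F_i)` for `i ∈ T` and of
the `F_i^+ ⊕ F_i^-` for `i ∉ T`. -/
def tensorSub {F : Fin N → Type v} [∀ i, AddCommGroup (F i)] [∀ i, Module ℂ (F i)]
    (T : Finset (Fin N)) (Fp Fm : ∀ i, Submodule ℂ (F i)) :
    Submodule ℂ (⨂[ℂ] i, F i × F i) :=
  Submodule.span ℂ {t | ∃ ξ : ∀ i, F i × F i, PiTensorProduct.tprod ℂ ξ = t ∧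
    ∀ i, if i ∈ T then (ξ i).1 = (ξ i).2 else (ξ i).1 ∈ Fp i ∧ (ξ i).2 ∈ Fm i}

lemma tensorSub_map {F : Fin N → Type v} [∀ i, AddCommGroup (F i)] [∀ i, Module ℂ (F i)]
    {G : Fin N → Type v'} [∀ i, AddCommGroup (G i)] [∀ i, Module ℂ (G i)]
    (T : Finset (Fin N)) {Fp Fm : ∀ i, Submodule ℂ (F i)} {Gp Gm : ∀ i, Submodule ℂ (G i)}
    (e : ∀ i, F i ≃ₗ[ℂ] G i) (hp : ∀ i, (Fp i).map (e i).toLinearMap = Gp i)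
    (hm : ∀ i, (Fm i).map (e i).toLinearMap = Gm i) :
    (tensorSub T Fp Fm).map
      (PiTensorProduct.congr fun i => (e i).prodCongr (e i)).toLinearMap = tensorSub T Gp Gm := by
  rw [tensorSub, Submodule.map_span, tensorSub]
  congr 1
  ext t
  constructor
  · rintro ⟨_, ⟨ξ, rfl, hξ⟩, rfl⟩
    refine ⟨fun i => (e i).prodCongr (e i) (ξ i), (PiTensorProduct.congr_tprod _ _).symm, ?_⟩
    intro i
    have h := hξ i
    split_ifs at h ⊢
    · exact congrArg (e i) h
    · rw [← hp, ← hm]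
      exact ⟨⟨_, h.1, rfl⟩, ⟨_, h.2, rfl⟩⟩
  · rintro ⟨ξ, rfl, hξ⟩
    refine ⟨PiTensorProduct.tprod ℂ fun i => ((e i).prodCongr (e i)).symm (ξ i), ⟨_, rfl, ?_⟩, ?_⟩
    · intro i
      have h := hξ i
      split_ifs at h ⊢
      · exact congrArg (e i).symm h
      · rw [← hp, ← hm] at h
        obtain ⟨⟨s, hs, h1⟩, ⟨s', hs', h2⟩⟩ := h
        have e1 : (e i).symm (ξ i).1 = s := by rw [LinearEquiv.symm_apply_eq]; exact h1.symm
        have e2 : (e i).symm (ξ i).2 = s' := by rw [LinearEquiv.symm_apply_eq]; exact h2.symm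
        exact ⟨(congrArg (· ∈ Fp i) e1).mpr hs, (congrArg (· ∈ Fm i) e2).mpr hs'⟩
    · refine (PiTensorProduct.congr_tprod _ _).trans ?_
      congr 1
      funext i
      exact LinearEquiv.apply_symm_apply _ _

/-- Operators `X_i` of the `F_i` act on `⨂_i (F_i ⊕ F_i)` through
`X Ξ = ∑_i (-1)^(ε_1 + ⋯ + ε_(i-1)) ξ_1 ⊗ ⋯ ⊗ X_i ξ_i ⊗ ⋯ ⊗ ξ_N` for homogeneous `ξ_j` of parity
`ε_j`, where the first summand of `F_j ⊕ F_j` is even, the second is odd, and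
`X_i (ξ⁺, ξ⁻) = (X_i ξ⁻, X_i ξ⁺)`. -/
def cliffordTensor {F : Fin N → Type v} [∀ i, AddCommGroup (F i)] [∀ i, Module ℂ (F i)]
    (X : ∀ i, F i →ₗ[ℂ] F i) : (⨂[ℂ] i, F i × F i) →ₗ[ℂ] (⨂[ℂ] i, F i × F i) :=
  ∑ i, PiTensorProduct.map fun j =>
    if j < i then LinearMap.prodMap LinearMap.id (-LinearMap.id)
    else if j = i then
      LinearMap.prod (X j ∘ₗ LinearMap.snd ℂ (F j) (F j)) (X j ∘ₗ LinearMap.fst ℂ (F j) (F j))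
    else LinearMap.id

end Tensor

section ProductSpinors

variable {N : ℕ} {E : Fin N → Type} [∀ j, NormedAddCommGroup (E j)]
  [∀ j, NormedSpace ℝ (E j)] {H : Fin N → Type} [∀ j, TopologicalSpace (H j)]
  {I : ∀ j, ModelWithCorners ℝ (E j) (H j)}
  {M : Fin N → Type u} [∀ j, TopologicalSpace (M j)] [∀ j, ChartedSpace (H j) (M j)]
  [∀ j, IsManifold (I j) ∞ (M j)] {D : Fin N → ℕ}
  {g : ∀ j, OrientedRiemannian (I j) (M j) (Fin (D j))}
  (P : ∀ j, SpinStructure.{u, w, w'} (g j)) (Δ : ∀ j, SpinorModule.{v} (Fin (D j)))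
  (T : Finset (Fin N))

/-- The fibre of the bundle `S` over the product: the tensor product of the diagonals of
`S_i ⊕ S_i` for `i ∈ T` and of the `S_i^+ ⊕ S_i^-` for `i ∉ T`. -/
def productFiber (x : ∀ j, M j) :
    Submodule ℂ (⨂[ℂ] i, spinorFiber (P i) (Δ i) (x i) × spinorFiber (P i) (Δ i) (x i)) :=
  tensorSub T (fun i => halfFiber (P i) (Δ i) 1 (x i)) (fun i => halfFiber (P i) (Δ i) (-1) (x i))

/-- The standard fibre of the bundle `S`. -/
def stdFiber : Submodule ℂ (⨂[ℂ] i, (Δ i).carrier × (Δ i).carrier) :=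
  tensorSub T (fun i => half (Δ i) 1) (fun i => half (Δ i) (-1))

variable {P}

/-- The isomorphism of the fibre of `S` with its standard fibre given by a point of `∏ P_i`. -/
def productEval {x : ∀ j, M j} (p : ∀ j, (P j).fiber (x j)) :
    productFiber P Δ T x ≃ₗ[ℂ] stdFiber Δ T :=
  LinearEquiv.ofSubmodules
    (PiTensorProduct.congr fun i => (evalAt (Δ := Δ i) (p i)).prodCongr (evalAt (p i))) _ _
    (tensorSub_map T _ (fun i => halfFiber_map (P i) (Δ i) 1 (p i))
      fun i => halfFiber_map (P i) (Δ i) (-1) (p i))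

lemma productEval_transition {x : ∀ j, M j} (p q : ∀ j, (P j).fiber (x j)) (v : stdFiber Δ T) :
    (productEval Δ T q ((productEval Δ T p).symm v) : ⨂[ℂ] i, (Δ i).carrier × (Δ i).carrier) =
      PiTensorProduct.map (fun i => LinearMap.prodMap
        ((evalAt (p i)).symm.trans (evalAt (Δ := Δ i) (q i))).toLinearMap
        ((evalAt (p i)).symm.trans (evalAt (Δ := Δ i) (q i))).toLinearMap) v.1 := by
  change PiTensorProduct.congr _ ((PiTensorProduct.congr _).symm v.1) = _
  generalize v.1 = v
  induction v using PiTensorProduct.induction_on with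
  | smul_tprod r ξ =>
    rw [map_smul, map_smul, map_smul, PiTensorProduct.congr_symm_tprod,
      PiTensorProduct.congr_tprod, PiTensorProduct.map_tprod]
    rfl
  | add v v' hv hv' => rw [map_add, map_add, map_add, hv, hv']

lemma SmoothOn.add {E H : Type} [NormedAddCommGroup E] [NormedSpace ℝ E] [TopologicalSpace H]
    {I : ModelWithCorners ℝ E H} {M : Type u} [TopologicalSpace M] [ChartedSpace H M]
    {A : Type*} [AddCommGroup A] [Module ℝ A] {f f' : M → A} {U : Set M}
    (hf : SmoothOn I f U) (hf' : SmoothOn I f' U) : SmoothOn I (fun x => f x + f' x) U := by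
  intro ℓ
  simp only [map_add]
  exact (hf ℓ).add (hf' ℓ)

lemma SmoothOn.prodMk {E H : Type} [NormedAddCommGroup E] [NormedSpace ℝ E] [TopologicalSpace H]
    {I : ModelWithCorners ℝ E H} {M : Type u} [TopologicalSpace M] [ChartedSpace H M]
    {A B : Type*} [AddCommGroup A] [Module ℝ A] [AddCommGroup B] [Module ℝ B] {f : M → A}
    {f' : M → B} {U : Set M} (hf : SmoothOn I f U) (hf' : SmoothOn I f' U) :
    SmoothOn I (fun x => (f x, f' x)) U :=
  ((hf.linear (LinearMap.inl ℝ A B)).add (hf'.linear (LinearMap.inr ℝ A B))).congr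
    fun x _ => by simp

lemma smoothOn_productEval (a b : ∀ j, (P j).Index) (v : stdFiber Δ T) :
    SmoothOn (ModelWithCorners.pi I) (fun x : ∀ j, M j =>
      productEval Δ T (fun j => (P j).sec (b j) (x j))
        ((productEval Δ T fun j => (P j).sec (a j) (x j)).symm v))
      ((Set.univ.pi fun j => (P j).dom (a j)) ∩ Set.univ.pi fun j => (P j).dom (b j)) := by
  suffices h : SmoothOn (ModelWithCorners.pi I) (fun x : ∀ j, M j =>
      (productEval Δ T (fun j => (P j).sec (b j) (x j))
        ((productEval Δ T fun j => (P j).sec (a j) (x j)).symm v) :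
          ⨂[ℂ] i, (Δ i).carrier × (Δ i).carrier))
      ((Set.univ.pi fun j => (P j).dom (a j)) ∩ Set.univ.pi fun j => (P j).dom (b j)) by
    intro ℓ
    obtain ⟨ℓ', hℓ⟩ := LinearMap.exists_extend (p := (stdFiber Δ T).restrictScalars ℝ) ℓ
    exact (h ℓ').congr fun x _ => (LinearMap.congr_fun hℓ _).symm
  simp only [productEval_transition]
  generalize v.1 = v
  induction v using PiTensorProduct.induction_on with
  | smul_tprod r ξ =>
    have h := SmoothOn.multilinear (I := ModelWithCorners.pi I) (M := ∀ j, M j)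
      ((PiTensorProduct.tprod ℂ (s := fun i => (Δ i).carrier × (Δ i).carrier)).restrictScalars ℝ)
      (f := fun j x => (evalAt ((P j).sec (b j) (x j)) ((evalAt ((P j).sec (a j) (x j))).symm (ξ j).1),
        evalAt ((P j).sec (b j) (x j)) ((evalAt ((P j).sec (a j) (x j))).symm (ξ j).2)))
      (U := (Set.univ.pi fun j => (P j).dom (a j)) ∩ Set.univ.pi fun j => (P j).dom (b j))
      (fun j => ((smoothOn_transition (a j) (b j) (ξ j).1).comp_eval j
          fun x hx => ⟨hx.1 j trivial, hx.2 j trivial⟩).prodMk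
        ((smoothOn_transition (a j) (b j) (ξ j).2).comp_eval j
          fun x hx => ⟨hx.1 j trivial, hx.2 j trivial⟩))
    refine (h.linear ((LinearMap.lsmul ℂ _ r).restrictScalars ℝ)).congr fun x _ => ?_
    rw [map_smul, PiTensorProduct.map_tprod]
    rfl
  | add v v' hv hv' =>
    simp only [map_add]
    exact hv.add hv'

variable (P)

/-- The bundle `S` over the product manifold, constructed from the spinor bundles of the factors. -/
def productSpinorBundle :
    ComplexBundle.{u, w', max w v, v} (ModelWithCorners.pi I) (∀ j, M j) where
  fiber x := productFiber P Δ T x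
  model := stdFiber Δ T
  Index := ∀ j, (P j).Index
  dom a := Set.univ.pi fun j => (P j).dom (a j)
  isOpen_dom a := isOpen_set_pi Set.finite_univ fun j _ => (P j).isOpen_dom (a j)
  cover x := ⟨fun j => ((P j).cover (x j)).choose, fun j _ => ((P j).cover (x j)).choose_spec⟩
  triv a x := productEval Δ T fun j => (P j).sec (a j) (x j)
  smooth_transition a b v := smoothOn_productEval (P := P) Δ T a b v

end ProductSpinors

end SpinProduct

end

/-! Both bundles are associated with `∏ P_i`: `S` through the factorwise action of `∏ Spin(D_i)` on
its standard fibre, the spinor bundle through `∏ Spin(D_i) → Spin(D)` and the module `Δ`. So a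
linear isomorphism `L` of the standard fibres that commutes with `∏ Spin(D_i)` is all that is
needed, and `bundleIso` turns it into `φ`. To find `L`, the standard fibre of `S` is made a
`Cl(D)`-module that restricts to the factorwise action of `∏ Spin(D_i)`, and this module is compared
with `Δ`.

Module structure. The Clifford multiplication of `W` puts the grading operator on all factors before
the `i`-th, which in general destroys the diagonals when `T` is arbitrary. Write `F ⊕ F = F ⊗ ℂ²`.
There `swapOp X`, `phaseOp` and `gradeOp` are `X ⊗ σ_x`, `1 ⊗ σ_y` and `1 ⊗ σ_z` with the Pauli
matrices, so operators of different kinds anticommute. By the size of `T` its indices can be paired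
injectively with odd-dimensional indices outside `T`, with at most one exception. Let `r i` be the
partner of `i ∈ T`, the number `N` (beyond all slots) for the exception, and `i` for `i ∉ T`.
Vectors of the `i`-th summand act by `swapOp` in slot `i`; in the other slots they act by the
grading before `r i` and the phase at `r i`, except that slots in `T` get the identity. Different
summands then anticommute (`twistedTerm_anticomm`), and the fibre is preserved (`twistedTerm_mem`).
All these auxiliary operators are involutions, so they cancel in products of two vectors of one
summand; even elements therefore act factorwise (`action_spinProd`). If `T` contains at most the
last index, rank `N` on `T` gives back the multiplication of `W`.

Comparison. Averaging a linear map over the monomials `e_m` yields an intertwiner. The trace of the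
averaging operator on `Hom(A, B)` is a sum of products of characters, and the character of a
monomial vanishes unless the monomial is `1` or, in odd dimension, the full one. Hence an
irreducible module has dimension `2^[n/2]` (`finrank_of_irreducible`), and any module of that
dimension is isomorphic to it up to a sign of the vectors (`exists_equiv_of_irreducible`). The
dimension count `finrank_stdFiber` makes this apply. The sign is invisible to `Spin`, whose elements
are even, so it affects the Clifford multiplication only. -/

noncomputable section

namespace SpinProduct

/-! ### Schur's lemma for complex Clifford modules -/

section Schur

variable {κ : Type} [Fintype κ] {A : Type v} [AddCommGroup A] [Module ℂ A] {B : Type v'}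
  [AddCommGroup B] [Module ℂ B] {α : Cl κ →ₐ[ℝ] Module.End ℂ A} {β : Cl κ →ₐ[ℝ] Module.End ℂ B}

lemma intertwiner_bijective [FiniteDimensional ℂ B] (hirr : ∀ V : Submodule ℂ A,
      (∀ (z : Cl κ), ∀ s ∈ V, α z s ∈ V) → V = ⊥ ∨ V = ⊤)
    (hd : Module.finrank ℂ A = Module.finrank ℂ B) (F : A →ₗ[ℂ] B) (hF : F ≠ 0)
    (h : ∀ z x, β z (F x) = F (α z x)) :
    ∃ L : A ≃ₗ[ℂ] B, ∀ z x, L (α z x) = β z (L x) := by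
  rcases hirr (LinearMap.ker F) (fun z s hs => by
    rw [LinearMap.mem_ker] at hs ⊢
    rw [← h, hs, map_zero]) with h0 | h0
  · refine ⟨LinearEquiv.ofInjectiveOfFinrankEq F (LinearMap.ker_eq_bot.1 h0) hd, fun z x => ?_⟩
    exact (h z x).symm
  · exact absurd (LinearMap.ker_eq_top.1 h0) hF

lemma exists_eq_smul_of_commute [FiniteDimensional ℂ A] [Nontrivial A] (hirr : ∀ V : Submodule ℂ A,
      (∀ (z : Cl κ), ∀ s ∈ V, α z s ∈ V) → V = ⊥ ∨ V = ⊤) (F : Module.End ℂ A)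
    (hF : ∀ z x, α z (F x) = F (α z x)) : ∃ c : ℂ, F = c • 1 := by
  obtain ⟨c, hc⟩ := Module.End.exists_eigenvalue F
  refine ⟨c, ?_⟩
  rcases hirr (Module.End.eigenspace F c) (fun z s hs => by
    rw [Module.End.mem_eigenspace_iff] at hs ⊢
    rw [← hF, hs, map_smul]) with h | h
  · exact absurd h hc
  · ext x
    have : x ∈ Module.End.eigenspace F c := h ▸ Submodule.mem_top
    rw [Module.End.mem_eigenspace_iff] at this
    simpa using this

end Schur

/-! ### Classification of irreducible Clifford modules by averaging over monomials -/

section Averaging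

variable {κ : Type} [Fintype κ] [DecidableEq κ]

/-- The generator `e_k` of the Clifford algebra. -/
def gen (k : κ) : Cl κ := ι (stdForm κ) (Pi.single k 1)

lemma gen_mul_self (k : κ) : gen k * gen k = -1 := by
  rw [gen, ι_sq_scalar, stdForm_apply]
  simp [Pi.single_apply]

lemma gen_anticomm {k l : κ} (h : k ≠ l) : gen k * gen l = -(gen l * gen k) :=
  single_anticomm h

lemma ι_eq_sum_gen (v : κ → ℝ) : ι (stdForm κ) v = ∑ k, v k • gen k := by
  conv_lhs => rw [pi_eq_sum_univ' v]
  simp only [map_sum, map_smul, gen]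

/-- The generator `e_k` as a unit. -/
def genUnit (k : κ) : (Cl κ)ˣ :=
  ⟨gen k, -gen k, by rw [mul_neg, gen_mul_self, neg_neg], by rw [neg_mul, gen_mul_self, neg_neg]⟩

/-- The monomial `e_{k₁} ⋯ e_{k_r}` as a unit. -/
def monomialUnit (m : List κ) : (Cl κ)ˣ := (m.map genUnit).prod

lemma monomialUnit_cons (k : κ) (m : List κ) :
    monomialUnit (k :: m) = genUnit k * monomialUnit m := by
  simp [monomialUnit]

/-- Passing a letter different from `k` costs a sign and passing the letter `k` costs none, so
repeated letters do no harm. -/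
lemma gen_mul_monomialUnit (k : κ) (m : List κ) :
    gen k * (monomialUnit m : Cl κ) =
      ((-1 : ℝ) ^ (m.countP fun j => j ≠ k)) • ((monomialUnit m : Cl κ) * gen k) := by
  induction m with
  | nil => simp [monomialUnit]
  | cons j m ih =>
    rw [monomialUnit_cons, List.countP_cons, Units.val_mul]
    change gen k * (gen j * _) = _ • (gen j * _ * gen k)
    by_cases hj : j = k
    · subst hj
      rw [mul_assoc, ih]
      simp
    · rw [← mul_assoc, gen_anticomm (Ne.symm hj), neg_mul, mul_assoc, ih]
      simp [hj, pow_succ, mul_assoc]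

lemma involute_monomialUnit (m : List κ) :
    involute (monomialUnit m : Cl κ) = ((-1 : ℝ) ^ m.length) • (monomialUnit m : Cl κ) := by
  induction m with
  | nil => simp [monomialUnit]
  | cons j m ih =>
    rw [monomialUnit_cons, Units.val_mul, map_mul, ih]
    change involute (gen j) * _ = _ • (gen j * _)
    rw [gen, involute_ι]
    simp [pow_succ]

variable {A : Type v} [AddCommGroup A] [Module ℂ A] {B : Type v'} [AddCommGroup B] [Module ℂ B]
  (α : Cl κ →ₐ[ℝ] Module.End ℂ A) (β : Cl κ →ₐ[ℝ] Module.End ℂ B)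

/-- The sum of the conjugates of `f` by all submonomials of the monomial given by `l`. -/
def conjSum (l : List κ) (f : A →ₗ[ℂ] B) : A →ₗ[ℂ] B :=
  (l.sublists'.map fun m => β (monomialUnit m : Cl κ) ∘ₗ f ∘ₗ
    α ((monomialUnit m)⁻¹ : (Cl κ)ˣ)).sum

variable {α β}

/-- A sublist of `k :: l` either omits the leading `k` or starts with it. Sublists of the second
kind conjugate the sum for `l` by `e_k`; the minus sign is `e_k⁻¹ = -e_k`. -/
lemma conjSum_cons (k : κ) (l : List κ) (f : A →ₗ[ℂ] B) :
    conjSum α β (k :: l) f = conjSum α β l f -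
      β (gen k) ∘ₗ conjSum α β l f ∘ₗ α (gen k) := by
  have h : ∀ L : List (List κ),
      (L.map fun m => β (monomialUnit (k :: m) : Cl κ) ∘ₗ f ∘ₗ
        α ((monomialUnit (k :: m))⁻¹ : (Cl κ)ˣ)).sum =
      -(β (gen k) ∘ₗ (L.map fun m => β (monomialUnit m : Cl κ) ∘ₗ f ∘ₗ
        α ((monomialUnit m)⁻¹ : (Cl κ)ˣ)).sum ∘ₗ α (gen k)) := by
    intro L
    induction L with
    | nil => simp
    | cons m L ih =>
      rw [List.map_cons, List.sum_cons, ih, List.map_cons, List.sum_cons, LinearMap.add_comp,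
        LinearMap.comp_add, neg_add]
      congr 1
      rw [monomialUnit_cons, mul_inv_rev, Units.val_mul, Units.val_mul, map_mul, map_mul]
      have e : (((genUnit k)⁻¹ : (Cl κ)ˣ) : Cl κ) = -gen k := rfl
      have e' : ((genUnit k : (Cl κ)ˣ) : Cl κ) = gen k := rfl
      rw [e, e', map_neg]
      ext x
      simp
  rw [conjSum, List.sublists'_cons, List.map_append, List.sum_append, List.map_map]
  rw [Function.comp_def, h, sub_eq_add_neg]
  rfl

lemma map_gen_map_gen (k : κ) (x : A) : α (gen k) (α (gen k) x) = -x := by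
  rw [← Module.End.mul_apply, ← map_mul, gen_mul_self, map_neg, map_one]; rfl

lemma map_gen_comm {k l : κ} (h : k ≠ l) (x : A) :
    α (gen k) (α (gen l) x) = -α (gen l) (α (gen k) x) := by
  rw [← Module.End.mul_apply, ← map_mul, gen_anticomm h, map_neg, map_mul]; rfl

/-- If `k` is the head, `C - e_k C e_k` commutes with `e_k` for every `C`, because `e_k² = -1`.
Otherwise `e_k` is moved past the two outer factors `e_j`, and the two signs cancel. -/
lemma conjSum_gen (l : List κ) (f : A →ₗ[ℂ] B) (k : κ) (hk : k ∈ l) (x : A) :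
    β (gen k) (conjSum α β l f x) = conjSum α β l f (α (gen k) x) := by
  induction l generalizing x with
  | nil => simp at hk
  | cons j l ih =>
    rw [conjSum_cons]
    by_cases h : k = j
    · subst h
      simp only [LinearMap.sub_apply, LinearMap.comp_apply, map_sub, map_gen_map_gen, map_neg]
      abel
    · have ih := ih (by simpa [h] using hk)
      simp only [LinearMap.sub_apply, LinearMap.comp_apply, map_sub]
      rw [map_gen_comm h, ih, ih, map_gen_comm h, map_neg, map_neg, neg_neg]

lemma conjSum_intertwines (f : A →ₗ[ℂ] B) (z : Cl κ) (x : A) :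
    β z (conjSum α β Finset.univ.toList f x) = conjSum α β Finset.univ.toList f (α z x) := by
  induction z using CliffordAlgebra.induction generalizing x with
  | algebraMap r =>
    rw [AlgHom.commutes, AlgHom.commutes, Module.algebraMap_end_apply, Module.algebraMap_end_apply,
      ← Complex.coe_smul, ← Complex.coe_smul, map_smul]
  | ι v =>
    simp only [ι_eq_sum_gen, map_sum, map_smul, LinearMap.sum_apply, LinearMap.smul_apply]
    refine Finset.sum_congr rfl fun k _ => ?_
    rw [conjSum_gen _ _ _ (by simp), ← Complex.coe_smul, ← Complex.coe_smul, map_smul]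
  | mul a b ha hb => rw [map_mul, map_mul, Module.End.mul_apply, Module.End.mul_apply, hb, ha]
  | add a b ha hb =>
    rw [map_add, map_add, LinearMap.add_apply, LinearMap.add_apply, ha, hb, map_add]

lemma trace_eq_sum_coord {V ι : Type*} [AddCommGroup V] [Module ℂ V] [Fintype ι]
    (c : Module.Basis ι ℂ V) (f : Module.End ℂ V) :
    LinearMap.trace ℂ V f = ∑ i, c.coord i (f (c i)) := by
  classical
  rw [LinearMap.trace_eq_matrix_trace ℂ c, Matrix.trace]
  simp [LinearMap.toMatrix_apply]

/-- The trace of the operator `f ↦ conjSum f` on `Hom(A, B)`. -/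
lemma trace_conjSum {ιA ιB : Type*} [Fintype ιA] [Fintype ιB] (a : Module.Basis ιA ℂ A)
    (b : Module.Basis ιB ℂ B) (l : List κ) :
    ∑ i, ∑ j, b.coord j (conjSum α β l ((a.coord i).smulRight (b j)) (a i)) =
      (l.sublists'.map fun m => LinearMap.trace ℂ B (β (monomialUnit m : Cl κ)) *
        LinearMap.trace ℂ A (α ((monomialUnit m)⁻¹ : (Cl κ)ˣ))).sum := by
  classical
  unfold conjSum
  induction l.sublists' with
  | nil => simp
  | cons m L ih =>
    simp only [List.map_cons, List.sum_cons, LinearMap.add_apply, map_add, Finset.sum_add_distrib]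
    rw [ih]
    congr 1
    rw [trace_eq_sum_coord b, trace_eq_sum_coord a, Finset.sum_mul_sum, Finset.sum_comm]
    refine Finset.sum_congr rfl fun j _ => Finset.sum_congr rfl fun i _ => ?_
    simp [mul_comm]

/-- Conjugation preserves traces, so each new letter doubles the trace: `tr (e_k C e_k) = tr (C
e_k²) = -tr C`. -/
lemma trace_conjSum_self (l : List κ) (f : Module.End ℂ A) :
    LinearMap.trace ℂ A (conjSum α α l f) = 2 ^ l.length * LinearMap.trace ℂ A f := by
  induction l with
  | nil => simp [conjSum, monomialUnit, Module.End.one_eq_id]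
  | cons k l ih =>
    rw [conjSum_cons, map_sub, ← Module.End.mul_eq_comp, ← Module.End.mul_eq_comp,
      LinearMap.trace_mul_comm, mul_assoc, ← map_mul, gen_mul_self, map_neg, map_one, mul_neg_one,
      map_neg, ih, List.length_cons]
    ring

/-- Some generator `e_k` anticommutes with the monomial, and conjugation by it makes the trace equal
to its own negative. Anticommuting means that the number of letters other than `k` is odd: in even
length any letter of `m` will do, in odd length any letter missing from `m`. -/
lemma trace_monomial_eq_zero (m : List κ) (hm : m.Nodup) (h0 : m ≠ [])
    (h : Even m.length ∨ m.length < Fintype.card κ) :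
    LinearMap.trace ℂ B (β (monomialUnit m : Cl κ)) = 0 := by
  obtain ⟨k, hk⟩ : ∃ k, Odd (m.countP fun j => j ≠ k) := by
    by_cases he : Even m.length
    · obtain ⟨k, hk⟩ := List.exists_mem_of_ne_nil m h0
      refine ⟨k, ?_⟩
      have h1 := List.length_eq_countP_add_countP (fun j => decide (j = k)) (l := m)
      have h2 : m.countP (fun j => decide (j = k)) = 1 := by
        have := List.count_eq_one_of_mem hm hk
        rw [List.count] at this
        convert this using 2
        funext j
        exact Bool.eq_iff_iff.2 (by simp)
      rw [h2] at h1
      have h3 : m.countP (fun j => decide (j ≠ k)) + 1 = m.length := by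
        rw [h1, add_comm]; simp
      rw [← h3] at he
      exact Nat.not_even_iff_odd.1 (Nat.even_add_one.1 he)
    · obtain ⟨k, hk⟩ : ∃ k, k ∉ m := by
        by_contra! hall
        have : m.toFinset = Finset.univ := Finset.eq_univ_iff_forall.2 (by simpa using hall)
        have hc := List.toFinset_card_of_nodup hm
        rw [this, Finset.card_univ] at hc
        rcases h with h | h
        · exact he h
        · omega
      refine ⟨k, ?_⟩
      have : m.countP (fun j => decide (j ≠ k)) = m.length := by
        rw [List.countP_eq_length]
        intro j hj
        simpa using fun e : j = k => hk (e ▸ hj)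
      rw [this]
      exact Nat.not_even_iff_odd.1 he
  have h1 := gen_mul_monomialUnit k m
  rw [hk.neg_one_pow, neg_one_smul] at h1
  have h2 := congrArg (fun z => LinearMap.trace ℂ B (β (z * gen k))) h1
  simp only [neg_mul, mul_assoc, gen_mul_self, mul_neg, mul_one, neg_neg] at h2
  rw [map_mul β, map_mul β, LinearMap.trace_mul_comm, ← map_mul, ← map_mul, mul_assoc,
    gen_mul_self] at h2
  simp only [mul_neg, mul_one, map_neg] at h2
  exact self_eq_neg.1 h2.symm

variable [FiniteDimensional ℂ A] [FiniteDimensional ℂ B]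

/-- The hypothesis says that the averaging operator on `Hom(A, B)` has nonzero trace. Hence it does
not kill some elementary map of rank one, and the average of that map is a nonzero intertwiner. -/
lemma exists_intertwiner (hirr : ∀ V : Submodule ℂ A,
      (∀ (z : Cl κ), ∀ s ∈ V, α z s ∈ V) → V = ⊥ ∨ V = ⊤)
    (hd : Module.finrank ℂ A = Module.finrank ℂ B)
    (h : ((Finset.univ : Finset κ).toList.sublists'.map fun m =>
      LinearMap.trace ℂ B (β (monomialUnit m : Cl κ)) *
        LinearMap.trace ℂ A (α ((monomialUnit m)⁻¹ : (Cl κ)ˣ))).sum ≠ 0) :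
    ∃ L : A ≃ₗ[ℂ] B, ∀ z x, L (α z x) = β z (L x) := by
  let a := Module.finBasis ℂ A
  let b := Module.finBasis ℂ B
  rw [← trace_conjSum a b] at h
  obtain ⟨i, -, hi⟩ := Finset.exists_ne_zero_of_sum_ne_zero h
  obtain ⟨j, -, hj⟩ := Finset.exists_ne_zero_of_sum_ne_zero hi
  refine intertwiner_bijective hirr hd _ ?_ fun z x =>
    conjSum_intertwines ((a.coord i).smulRight (b j)) z x
  intro h0
  rw [h0] at hj
  simp at hj

/-- Only the empty and the full monomial survive. They coincide when there are no generators, which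
is why that case is separate. -/
lemma sum_sublists_univ {R : Type*} [AddCommMonoid R] (φ : List κ → R) (hφ : ∀ m : List κ,
      m.Nodup → m ≠ [] → m.length < Fintype.card κ → φ m = 0) :
    ((Finset.univ : Finset κ).toList.sublists'.map φ).sum =
      if Fintype.card κ = 0 then φ [] else φ [] + φ (Finset.univ : Finset κ).toList := by
  set l := (Finset.univ : Finset κ).toList with hl
  have hln : l.Nodup := Finset.nodup_toList _
  have hlen : l.length = Fintype.card κ := by simp [hl]
  have hn : l.sublists'.Nodup := List.nodup_sublists'.2 hln
  rw [← List.sum_toFinset _ hn]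
  have hz : ∀ m ∈ l.sublists'.toFinset, m ∉ ({[], l} : Finset (List κ)) → φ m = 0 := by
    intro m hm hm'
    have hsub : m.Sublist l := by simpa using hm
    simp only [Finset.mem_insert, Finset.mem_singleton, not_or] at hm'
    refine hφ m (hln.sublist hsub) hm'.1 ?_
    rw [← hlen]
    exact lt_of_le_of_ne hsub.length_le fun e => hm'.2 (hsub.eq_of_length e)
  have hsub : ({[], l} : Finset (List κ)) ⊆ l.sublists'.toFinset := by
    intro m hm
    simp only [Finset.mem_insert, Finset.mem_singleton] at hm
    rcases hm with rfl | rfl <;> simp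
  rw [← Finset.sum_subset hsub hz]
  split_ifs with h
  · have : l = [] := List.length_eq_zero_iff.1 (hlen.trans h)
    simp [this]
  · have : [] ≠ l := fun e => h (by rw [← hlen, ← e]; rfl)
    rw [Finset.sum_pair this]

lemma sum_trace_of_even (hn : Even (Fintype.card κ)) :
    ((Finset.univ : Finset κ).toList.sublists'.map fun m =>
      LinearMap.trace ℂ B (β (monomialUnit m : Cl κ)) *
        LinearMap.trace ℂ A (α ((monomialUnit m)⁻¹ : (Cl κ)ˣ))).sum =
      Module.finrank ℂ B * Module.finrank ℂ A := by
  rw [sum_sublists_univ]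
  · have h0 : LinearMap.trace ℂ B (β (monomialUnit ([] : List κ) : Cl κ)) *
        LinearMap.trace ℂ A (α ((monomialUnit ([] : List κ))⁻¹ : (Cl κ)ˣ)) =
        Module.finrank ℂ B * Module.finrank ℂ A := by
      simp [monomialUnit, LinearMap.trace_one]
    split_ifs with h
    · exact h0
    · rw [h0, trace_monomial_eq_zero _ (Finset.nodup_toList _)
        (by simpa [Finset.univ_eq_empty_iff, Fintype.card_eq_zero_iff] using h)
        (Or.inl (by simpa using hn)), zero_mul, add_zero]
  · intro m hm h0 hlt
    rw [trace_monomial_eq_zero m hm h0 (Or.inr hlt), zero_mul]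

/-- Two representations of the same dimension, the first irreducible, are isomorphic up to a sign of
the vectors, which is `1` in even dimension. -/
theorem exists_equiv_of_irreducible [Nontrivial A] (hirr : ∀ V : Submodule ℂ A,
      (∀ (z : Cl κ), ∀ s ∈ V, α z s ∈ V) → V = ⊥ ∨ V = ⊤)
    (hd : Module.finrank ℂ A = Module.finrank ℂ B) :
    ∃ ε : ℝ, (ε = 1 ∨ ε = -1) ∧ (Even (Fintype.card κ) → ε = 1) ∧
      ∃ L : A ≃ₗ[ℂ] B, ∀ v x,
        L (α (ι (stdForm κ) v) x) = (ε : ℂ) • β (ι (stdForm κ) v) (L x) := by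
  have hA : (Module.finrank ℂ A : ℂ) ≠ 0 := by
    exact_mod_cast (Module.finrank_pos (R := ℂ) (M := A)).ne'
  by_cases hn : Even (Fintype.card κ)
  · obtain ⟨L, hL⟩ := exists_intertwiner (α := α) (β := β) hirr hd (by
      rw [sum_trace_of_even hn, ← hd]
      exact mul_ne_zero hA hA)
    exact ⟨1, Or.inl rfl, fun _ => rfl, L, fun v x => by rw [hL, Complex.ofReal_one, one_smul]⟩
  -- In odd dimension the full monomial may contribute and cancel the identity term. Twisting `β` by
  -- the grading involution reverses the sign of that contribution, so the two character sums add up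
  -- to `2 (dim A)²` and cannot both vanish.
  · let β' : Cl κ →ₐ[ℝ] Module.End ℂ B := β.comp involute
    have key : ((Finset.univ : Finset κ).toList.sublists'.map fun m =>
        LinearMap.trace ℂ B (β (monomialUnit m : Cl κ)) *
          LinearMap.trace ℂ A (α ((monomialUnit m)⁻¹ : (Cl κ)ˣ))).sum +
        ((Finset.univ : Finset κ).toList.sublists'.map fun m =>
        LinearMap.trace ℂ B (β' (monomialUnit m : Cl κ)) *
          LinearMap.trace ℂ A (α ((monomialUnit m)⁻¹ : (Cl κ)ˣ))).sum ≠ 0 := by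
      have hc : Fintype.card κ ≠ 0 := fun h => hn (by rw [h]; exact Even.zero)
      rw [sum_sublists_univ, sum_sublists_univ, if_neg hc, if_neg hc]
      · have e : β' (monomialUnit (Finset.univ : Finset κ).toList : Cl κ) =
            -β (monomialUnit (Finset.univ : Finset κ).toList : Cl κ) := by
          change β (involute _) = _
          rw [involute_monomialUnit, Finset.length_toList, Finset.card_univ,
            (Nat.not_even_iff_odd.1 hn).neg_one_pow, neg_one_smul, map_neg]
        rw [e]
        simp only [monomialUnit, List.map_nil, List.prod_nil, Units.val_one, map_one, inv_one,
          LinearMap.trace_one, map_neg, neg_mul, ← hd]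
        intro h
        have : (2 : ℂ) * (Module.finrank ℂ A * Module.finrank ℂ A) = 0 := by
          rw [← h]; ring
        exact mul_ne_zero two_ne_zero (mul_ne_zero hA hA) this
      · intro m hm h0 hlt
        rw [trace_monomial_eq_zero m hm h0 (Or.inr hlt), zero_mul]
      · intro m hm h0 hlt
        rw [trace_monomial_eq_zero m hm h0 (Or.inr hlt), zero_mul]
    by_cases h1 : ((Finset.univ : Finset κ).toList.sublists'.map fun m =>
        LinearMap.trace ℂ B (β (monomialUnit m : Cl κ)) *
          LinearMap.trace ℂ A (α ((monomialUnit m)⁻¹ : (Cl κ)ˣ))).sum = 0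
    · rw [h1, zero_add] at key
      obtain ⟨L, hL⟩ := exists_intertwiner (α := α) (β := β') hirr hd key
      refine ⟨-1, Or.inr rfl, fun h => absurd h hn, L, fun v x => ?_⟩
      rw [hL, Complex.ofReal_neg, Complex.ofReal_one, neg_one_smul]
      change β (involute _) _ = _
      rw [involute_ι, map_neg, LinearMap.neg_apply]
    · obtain ⟨L, hL⟩ := exists_intertwiner (α := α) (β := β) hirr hd h1
      exact ⟨1, Or.inl rfl, fun _ => rfl, L, fun v x => by rw [hL, Complex.ofReal_one, one_smul]⟩

/-- An irreducible representation has dimension `2^[n/2]`. -/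
theorem finrank_of_irreducible [Nontrivial A] (hirr : ∀ V : Submodule ℂ A,
      (∀ (z : Cl κ), ∀ s ∈ V, α z s ∈ V) → V = ⊥ ∨ V = ⊤) :
    Module.finrank ℂ A = 2 ^ (Fintype.card κ / 2) := by
  have hpos := Module.finrank_pos (R := ℂ) (M := A)
  have hA : (Module.finrank ℂ A : ℂ) ≠ 0 := by exact_mod_cast hpos.ne'
  have hsum : ((Finset.univ : Finset κ).toList.sublists'.map fun m =>
      LinearMap.trace ℂ A (α (monomialUnit m : Cl κ)) *
        LinearMap.trace ℂ A (α ((monomialUnit m)⁻¹ : (Cl κ)ˣ))).sum = 2 ^ Fintype.card κ := by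
    classical
    let a := Module.finBasis ℂ A
    rw [← trace_conjSum a a]
    -- By Schur the average of the elementary map is a scalar `c`. Comparing traces gives `c · dim A
    -- = 2^n δ_ij`.
    have h : ∀ i j, a.coord j (conjSum α α Finset.univ.toList
        ((a.coord i).smulRight (a j)) (a i)) =
        if i = j then 2 ^ Fintype.card κ / (Module.finrank ℂ A : ℂ) else 0 := by
      intro i j
      obtain ⟨c, hc⟩ := exists_eq_smul_of_commute hirr
        (conjSum α α Finset.univ.toList ((a.coord i).smulRight (a j)))
        (fun z x => conjSum_intertwines _ z x)
      have ht := trace_conjSum_self (α := α) Finset.univ.toList ((a.coord i).smulRight (a j))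
      rw [hc, map_smul, LinearMap.trace_one, LinearMap.trace_smulRight, Finset.length_toList,
        Finset.card_univ] at ht
      rw [hc]
      simp only [Module.Basis.coord_apply, Module.Basis.repr_self, LinearMap.smul_apply,
        Module.End.one_apply, map_smul, smul_eq_mul] at ht ⊢
      by_cases hij : i = j
      · subst hij
        simp only [Finsupp.single_eq_same, mul_one, if_true] at ht ⊢
        rw [eq_div_iff hA, ht]
      · rw [if_neg hij]
        simp [hij]
    simp only [h, Finset.sum_ite_eq, Finset.mem_univ, if_true, Finset.sum_const,
      Finset.card_univ, Fintype.card_fin, nsmul_eq_mul]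
    field_simp
  by_cases hn : Even (Fintype.card κ)
  · rw [sum_trace_of_even hn] at hsum
    obtain ⟨r, hr⟩ := hn
    have h2 : Module.finrank ℂ A * Module.finrank ℂ A = 2 ^ Fintype.card κ := by exact_mod_cast hsum
    rw [hr, pow_add] at h2
    rw [hr, show (r + r) / 2 = r by omega]
    exact Nat.mul_self_inj.1 h2
  · have hc : Fintype.card κ ≠ 0 := fun h => hn (by rw [h]; exact Even.zero)
    have hl : Even (Fintype.card κ - 1) := by
      obtain ⟨r, hr⟩ := Nat.not_even_iff_odd.1 hn
      exact ⟨r, by omega⟩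
    -- For odd `n` the full monomial is central, since each generator passes the `n - 1` others, an
    -- even number. It therefore acts by a scalar, its inverse acts by the inverse scalar, and its
    -- term in the character sum is again `(dim A)²`; so `2 (dim A)² = 2^n`.
    obtain ⟨c, hc'⟩ := exists_eq_smul_of_commute hirr
      (α (monomialUnit (Finset.univ : Finset κ).toList : Cl κ)) (fun z x => by
        rw [← Module.End.mul_apply, ← Module.End.mul_apply, ← map_mul, ← map_mul]
        congr 2
        induction z using CliffordAlgebra.induction with
        | algebraMap r => exact Algebra.commutes r _
        | ι v =>
          rw [ι_eq_sum_gen, Finset.sum_mul, Finset.mul_sum]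
          refine Finset.sum_congr rfl fun k _ => ?_
          have e : (Finset.univ : Finset κ).toList.countP (fun j => j ≠ k) =
              Fintype.card κ - 1 := by
            rw [List.countP_eq_length_filter, ← Finset.card_univ,
              ← Finset.card_erase_of_mem (Finset.mem_univ k), ← Finset.length_toList]
            refine List.Perm.length_eq ?_
            rw [List.perm_ext_iff_of_nodup ((Finset.nodup_toList _).filter _)
              (Finset.nodup_toList _)]
            simp
          rw [smul_mul_assoc, gen_mul_monomialUnit, e, hl.neg_one_pow, one_smul, mul_smul_comm]
        | mul a b ha hb => rw [mul_assoc, hb, ← mul_assoc, ha, mul_assoc]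
        | add a b ha hb => rw [add_mul, mul_add, ha, hb])
    set u := monomialUnit (Finset.univ : Finset κ).toList with hu
    have hinv : c • α ((u⁻¹ : (Cl κ)ˣ) : Cl κ) = 1 := by
      rw [← map_one α, ← Units.mul_inv u, map_mul, hc', smul_mul_assoc, one_mul]
    rw [sum_sublists_univ, if_neg hc, ← hu, hc', map_smul, LinearMap.trace_one, smul_eq_mul,
      mul_comm c, mul_assoc, ← smul_eq_mul c, ← map_smul, hinv, LinearMap.trace_one] at hsum
    · simp only [monomialUnit, List.map_nil, List.prod_nil, Units.val_one, map_one, inv_one,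
        LinearMap.trace_one] at hsum
      have h2 : Module.finrank ℂ A * Module.finrank ℂ A + Module.finrank ℂ A * Module.finrank ℂ A =
        2 ^ Fintype.card κ := by exact_mod_cast hsum
      obtain ⟨r, hr⟩ := Nat.not_even_iff_odd.1 hn
      rw [hr, show (2 * r + 1) / 2 = r by omega]
      rw [hr, pow_succ, two_mul, pow_add] at h2
      refine Nat.mul_self_inj.1 ?_
      omega
    · intro m hm h0 hlt
      rw [trace_monomial_eq_zero m hm h0 (Or.inr hlt), zero_mul]

end Averaging

/-! ### Tensor products of subspaces and their dimensions -/

section TensorFactors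

variable {N : ℕ} {F : Fin N → Type v} [∀ i, AddCommGroup (F i)] [∀ i, Module ℂ (F i)]

/-- The factors of `tensorSub`. -/
def tensorFactor (T : Finset (Fin N)) (Fp Fm : ∀ i, Submodule ℂ (F i)) (i : Fin N) :
    Submodule ℂ (F i × F i) :=
  if i ∈ T then LinearMap.eqLocus (LinearMap.fst ℂ (F i) (F i)) (LinearMap.snd ℂ (F i) (F i))
  else (Fp i).prod (Fm i)

lemma mem_tensorFactor {T : Finset (Fin N)} {Fp Fm : ∀ i, Submodule ℂ (F i)} {i : Fin N}
    {ξ : F i × F i} : ξ ∈ tensorFactor T Fp Fm i ↔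
      if i ∈ T then ξ.1 = ξ.2 else ξ.1 ∈ Fp i ∧ ξ.2 ∈ Fm i := by
  unfold tensorFactor
  split_ifs with h
  · exact LinearMap.mem_eqLocus
  · exact Submodule.mem_prod

/-- This identifies the span in the definition with an honest tensor product of subspaces, whose
dimension is multiplicative. -/
lemma tensorSub_eq_range (T : Finset (Fin N)) (Fp Fm : ∀ i, Submodule ℂ (F i)) :
    tensorSub T Fp Fm = LinearMap.range (PiTensorProduct.mapIncl (tensorFactor T Fp Fm)) := by
  rw [PiTensorProduct.mapIncl, PiTensorProduct.map_range_eq_span_tprod, tensorSub]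
  congr 1
  ext t
  constructor
  · rintro ⟨ξ, rfl, hξ⟩
    exact ⟨fun i => ⟨ξ i, mem_tensorFactor.2 (hξ i)⟩, rfl⟩
  · rintro ⟨ξ, rfl⟩
    exact ⟨fun i => (ξ i).1, rfl, fun i => mem_tensorFactor.1 (ξ i).2⟩

/-- Over a field each subspace has a linear retraction, and the tensor product of the retractions is
a left inverse. -/
lemma mapIncl_injective {G : Fin N → Type*} [∀ i, AddCommGroup (G i)] [∀ i, Module ℂ (G i)]
    (K : ∀ i, Submodule ℂ (G i)) :
    Function.Injective (PiTensorProduct.mapIncl K) := by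
  choose ρ hρ using fun i => (K i).subtype.exists_leftInverse_of_injective (K i).ker_subtype
  refine Function.LeftInverse.injective (g := PiTensorProduct.map ρ) fun t => ?_
  rw [PiTensorProduct.mapIncl, ← LinearMap.comp_apply, ← PiTensorProduct.map_comp]
  simp only [hρ, PiTensorProduct.map_id, LinearMap.id_apply]

lemma finrank_piTensorProduct {G : Fin N → Type*} [∀ i, AddCommGroup (G i)] [∀ i, Module ℂ (G i)]
    [∀ i, FiniteDimensional ℂ (G i)] :
    Module.finrank ℂ (⨂[ℂ] i, G i) = ∏ i, Module.finrank ℂ (G i) := by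
  rw [Module.finrank_eq_card_basis (Basis.piTensorProduct fun i => Module.finBasis ℂ (G i)),
    Fintype.card_pi]
  simp

lemma finrank_tensorSub [∀ i, FiniteDimensional ℂ (F i)] (T : Finset (Fin N))
    (Fp Fm : ∀ i, Submodule ℂ (F i)) :
    Module.finrank ℂ (tensorSub T Fp Fm) = ∏ i, Module.finrank ℂ (tensorFactor T Fp Fm i) := by
  rw [tensorSub_eq_range, LinearMap.finrank_range_of_inj (mapIncl_injective _),
    finrank_piTensorProduct]

lemma map_mem_tensorSub {T : Finset (Fin N)} {Fp Fm : ∀ i, Submodule ℂ (F i)}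
    (f : ∀ i, F i × F i →ₗ[ℂ] F i × F i)
    (hf : ∀ i, ∀ ξ ∈ tensorFactor T Fp Fm i, f i ξ ∈ tensorFactor T Fp Fm i)
    {t : ⨂[ℂ] i, F i × F i} (ht : t ∈ tensorSub T Fp Fm) :
    PiTensorProduct.map f t ∈ tensorSub T Fp Fm := by
  induction ht using Submodule.span_induction with
  | mem t ht =>
    obtain ⟨ξ, rfl, hξ⟩ := ht
    rw [PiTensorProduct.map_tprod]
    exact Submodule.subset_span ⟨_, rfl, fun i =>
      mem_tensorFactor.1 (hf i _ (mem_tensorFactor.2 (hξ i)))⟩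
  | zero => rw [map_zero]; exact Submodule.zero_mem _
  | add t t' _ _ h h' => rw [map_add]; exact Submodule.add_mem _ h h'
  | smul c t _ h => rw [map_smul]; exact Submodule.smul_mem _ _ h

end TensorFactors

/-! ### Anticommuting operators on the tensor product that respect the diagonals -/

section TwistedAction

/-- The grading operator of `F ⊕ F`. -/
def gradeOp (F : Type v) [AddCommGroup F] [Module ℂ F] : Module.End ℂ (F × F) :=
  LinearMap.prodMap LinearMap.id (-LinearMap.id)

/-- The operator `(a, b) ↦ (-i b, i a)` of `F ⊕ F`. -/
def phaseOp (F : Type v) [AddCommGroup F] [Module ℂ F] : Module.End ℂ (F × F) :=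
  LinearMap.prod (-Complex.I • LinearMap.snd ℂ F F) (Complex.I • LinearMap.fst ℂ F F)

/-- The odd operator `(a, b) ↦ (X b, X a)` of `F ⊕ F`. -/
def swapOp {F : Type v} [AddCommGroup F] [Module ℂ F] (X : Module.End ℂ F) :
    Module.End ℂ (F × F) :=
  LinearMap.prod (X ∘ₗ LinearMap.snd ℂ F F) (X ∘ₗ LinearMap.fst ℂ F F)

section Single

variable {F : Type v} [AddCommGroup F] [Module ℂ F]

lemma gradeOp_apply (ξ : F × F) : gradeOp F ξ = (ξ.1, -ξ.2) := rfl

lemma phaseOp_apply (ξ : F × F) : phaseOp F ξ = (-Complex.I • ξ.2, Complex.I • ξ.1) := rfl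

lemma swapOp_apply (X : Module.End ℂ F) (ξ : F × F) : swapOp X ξ = (X ξ.2, X ξ.1) := rfl

lemma gradeOp_mul_self : gradeOp F * gradeOp F = 1 :=
  LinearMap.ext fun ξ => by simp [gradeOp_apply]

lemma phaseOp_mul_self : phaseOp F * phaseOp F = 1 :=
  LinearMap.ext fun ξ => by simp [phaseOp_apply, smul_smul]

lemma swapOp_mul_swapOp (X Y : Module.End ℂ F) :
    swapOp X * swapOp Y = LinearMap.prodMap (X * Y) (X * Y) :=
  LinearMap.ext fun ξ => by simp [swapOp_apply]

lemma swapOp_mul_gradeOp (X : Module.End ℂ F) :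
    swapOp X * gradeOp F = -(gradeOp F * swapOp X) :=
  LinearMap.ext fun ξ => by simp [swapOp_apply, gradeOp_apply]

lemma swapOp_mul_phaseOp (X : Module.End ℂ F) :
    swapOp X * phaseOp F = -(phaseOp F * swapOp X) :=
  LinearMap.ext fun ξ => by simp [swapOp_apply, phaseOp_apply]

lemma phaseOp_mul_gradeOp : phaseOp F * gradeOp F = -(gradeOp F * phaseOp F) :=
  LinearMap.ext fun ξ => by simp [phaseOp_apply, gradeOp_apply]

lemma swapOp_add (X Y : Module.End ℂ F) : swapOp (X + Y) = swapOp X + swapOp Y :=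
  LinearMap.ext fun ξ => by simp [swapOp_apply]

lemma swapOp_smul (c : ℂ) (X : Module.End ℂ F) : swapOp (c • X) = c • swapOp X :=
  LinearMap.ext fun ξ => by simp [swapOp_apply]

end Single

variable {N : ℕ} (F : Fin N → Type v) [∀ i, AddCommGroup (F i)] [∀ i, Module ℂ (F i)]
  (T : Finset (Fin N)) (r : Fin N → ℕ)

/-- The operator by which vectors of the `i`-th summand act on the `j`-th factor, `j ≠ i`. -/
def siteOp (i j : Fin N) : Module.End ℂ (F j × F j) :=
  if j ∈ T then 1 else if (j : ℕ) < r i then gradeOp (F j)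
  else if (j : ℕ) = r i then phaseOp (F j) else 1

variable {F}

/-- The action of `X_i`, placed in the `i`-th summand, on `⨂_i (F_i ⊕ F_i)`. -/
def twistedTerm (i : Fin N) (X : Module.End ℂ (F i)) : Module.End ℂ (⨂[ℂ] i, F i × F i) :=
  PiTensorProduct.map (Function.update (siteOp F T r i) i (swapOp X))

/-- Ranks which make the operators of `twistedTerm` anticommute. -/
structure IsRanking : Prop where
  of_notMem : ∀ i ∉ T, r i = i
  injOn : ∀ i ∈ T, ∀ k ∈ T, r i = r k → i = k
  notMem : ∀ i ∈ T, ∀ j : Fin N, r i = j → j ∉ T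
  le : ∀ i ∈ T, r i ≤ N

variable {T r}

lemma siteOp_mul_self (i j : Fin N) : siteOp F T r i j * siteOp F T r i j = 1 := by
  unfold siteOp
  split_ifs <;> simp [gradeOp_mul_self, phaseOp_mul_self]

/-- A sign in one slot can be pulled out of the whole tensor product, so exactly one anticommuting
slot is enough. -/
lemma map_mul_map_of_anticommute {G : Fin N → Type*} [∀ i, AddCommGroup (G i)]
    [∀ i, Module ℂ (G i)] (f g : ∀ j, Module.End ℂ (G j)) (j₀ : Fin N)
    (h₀ : f j₀ * g j₀ = -(g j₀ * f j₀)) (h : ∀ j ≠ j₀, f j * g j = g j * f j) :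
    (PiTensorProduct.map f * PiTensorProduct.map g : Module.End ℂ (⨂[ℂ] i, G i)) =
      (-1 : ℂ) • (PiTensorProduct.map g * PiTensorProduct.map f) := by
  rw [← PiTensorProduct.map_mul, ← PiTensorProduct.map_mul]
  have e : (fun j => f j * g j) =
      Function.update (fun j => g j * f j) j₀ ((-1 : ℂ) • (g j₀ * f j₀)) := by
    funext j
    by_cases hj : j = j₀
    · subst hj; rw [Function.update_self, h₀, neg_one_smul]
    · rw [Function.update_of_ne hj, h j hj]
  rw [e, PiTensorProduct.map_update_smul, Function.update_eq_self]

/-- The only anticommuting slot is `r i`, the smaller rank. In a tie one index lies in `T` and is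
paired with the other; `heq` asks that `i` be the one outside `T`. -/
lemma twistedTerm_anticomm_of_le (hr : IsRanking T r) {i k : Fin N} (hik : i ≠ k)
    (hle : r i ≤ r k) (heq : r i = r k → i ∉ T) (X : Module.End ℂ (F i))
    (Y : Module.End ℂ (F k)) :
    twistedTerm T r i X * twistedTerm T r k Y =
      (-1 : ℂ) • (twistedTerm T r k Y * twistedTerm T r i X) := by
  obtain ⟨j₀, hj₀⟩ : ∃ j₀ : Fin N, r i = j₀ := by
    by_cases hi : i ∈ T
    · have hlt : r i < r k := lt_of_le_of_ne hle fun e => heq e hi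
      have hk : r k ≤ N := by
        by_cases hk : k ∈ T
        · exact hr.le k hk
        · rw [hr.of_notMem k hk]; exact k.2.le
      exact ⟨⟨r i, hlt.trans_le hk⟩, rfl⟩
    · exact ⟨i, hr.of_notMem i hi⟩
  have hj₀T : j₀ ∉ T := by
    by_cases hi : i ∈ T
    · exact hr.notMem i hi j₀ hj₀
    · rw [hr.of_notMem i hi] at hj₀
      exact (Fin.ext hj₀) ▸ hi
  have hj₀k : j₀ ≠ k := by
    rintro rfl
    have h1 := hr.of_notMem j₀ hj₀T
    have h2 := heq (hj₀.trans h1.symm)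
    exact hik (Fin.ext ((hr.of_notMem i h2).symm.trans hj₀))
  refine map_mul_map_of_anticommute _ _ j₀ ?_ fun j hj => ?_
  · rw [Function.update_of_ne hj₀k]
    by_cases hi : j₀ = i
    · subst hi
      rw [Function.update_self]
      -- For `i ∉ T` slot `r i` is slot `i`, which carries `swapOp X`. It meets the grading of the
      -- `k`-th action, or its phase if `k` is paired with `i`; both anticommute with it.
      have hs : siteOp F T r k j₀ = gradeOp _ ∨ siteOp F T r k j₀ = phaseOp _ := by
        unfold siteOp
        rw [if_neg hj₀T]
        rcases hle.lt_or_eq with h | h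
        · left; rw [if_pos (by omega)]
        · right; rw [if_neg (by omega), if_pos (by omega)]
      rcases hs with hs | hs <;> rw [hs]
      · exact swapOp_mul_gradeOp X
      · exact swapOp_mul_phaseOp X
    -- For `i ∈ T` the slot `r i` carries the phase of the `i`-th action and the grading of the
    -- `k`-th one, the inequality of ranks being strict.
    · have hiT : i ∈ T := by
        by_contra hiT
        exact hi (Fin.ext (hj₀.symm.trans (hr.of_notMem i hiT)))
      have hlt : r i < r k := lt_of_le_of_ne hle fun e => heq e hiT
      have e1 : siteOp F T r i j₀ = phaseOp _ := by
        unfold siteOp; rw [if_neg hj₀T, if_neg (by omega), if_pos hj₀.symm]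
      have e2 : siteOp F T r k j₀ = gradeOp _ := by
        unfold siteOp; rw [if_neg hj₀T, if_pos (by omega)]
      rw [Function.update_of_ne hi, e1, e2]
      exact phaseOp_mul_gradeOp
  · have hj' : (j : ℕ) ≠ r i := fun e => hj (Fin.ext (e.trans hj₀))
    by_cases hji : j = i
    · subst hji
      have hjT : j ∈ T := by
        by_contra hjT
        exact hj' (hr.of_notMem j hjT).symm
      have e : siteOp F T r k j = 1 := by unfold siteOp; rw [if_pos hjT]
      rw [Function.update_self, Function.update_of_ne hik, e, mul_one, one_mul]
    · rw [Function.update_of_ne hji]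
      by_cases hjk : j = k
      · subst hjk
        have e : siteOp F T r i j = 1 := by
          unfold siteOp
          by_cases hjT : j ∈ T
          · rw [if_pos hjT]
          · have := hr.of_notMem j hjT
            rw [if_neg hjT, if_neg (by omega), if_neg hj']
        rw [e, mul_one, one_mul]
      · rw [Function.update_of_ne hjk]
        unfold siteOp
        split_ifs <;> first | rfl | simp | omega

lemma twistedTerm_anticomm (hr : IsRanking T r) {i k : Fin N} (hik : i ≠ k)
    (X : Module.End ℂ (F i)) (Y : Module.End ℂ (F k)) :
    twistedTerm T r i X * twistedTerm T r k Y =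
      (-1 : ℂ) • (twistedTerm T r k Y * twistedTerm T r i X) := by
  have swap : ∀ h : twistedTerm T r k Y * twistedTerm T r i X =
      (-1 : ℂ) • (twistedTerm T r i X * twistedTerm T r k Y),
      twistedTerm T r i X * twistedTerm T r k Y =
        (-1 : ℂ) • (twistedTerm T r k Y * twistedTerm T r i X) :=
    fun h => by rw [h, smul_smul, neg_one_mul, neg_neg, one_smul]
  rcases lt_trichotomy (r i) (r k) with h | h | h
  · exact twistedTerm_anticomm_of_le hr hik h.le (fun e => absurd e h.ne) X Y
  · by_cases hi : i ∈ T
    · refine swap (twistedTerm_anticomm_of_le hr hik.symm h.symm.le (fun _ hk => ?_) Y X)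
      exact hik (hr.injOn i hi k hk h)
    · exact twistedTerm_anticomm_of_le hr hik h.le (fun _ => hi) X Y
  · exact swap (twistedTerm_anticomm_of_le hr hik.symm h.le (fun e => absurd e h.ne) Y X)

/-- The auxiliary operators in the slots other than `i` are involutions and cancel. The product thus
lives in slot `i` alone and no longer depends on `r`. -/
lemma twistedTerm_mul_self (i : Fin N) (X Y : Module.End ℂ (F i)) :
    twistedTerm T r i X * twistedTerm T r i Y =
      PiTensorProduct.map (Function.update 1 i (LinearMap.prodMap (X * Y) (X * Y))) := by
  rw [twistedTerm, twistedTerm, ← PiTensorProduct.map_mul]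
  congr 1
  funext j
  by_cases h : j = i
  · subst h
    simp only [Function.update_self, swapOp_mul_swapOp]
  · simp only [Function.update_of_ne h, siteOp_mul_self, Pi.one_apply]

lemma twistedTerm_add (i : Fin N) (X Y : Module.End ℂ (F i)) :
    twistedTerm T r i (X + Y) = twistedTerm T r i X + twistedTerm T r i Y := by
  rw [twistedTerm, swapOp_add, PiTensorProduct.map_update_add]; rfl

lemma twistedTerm_smul (i : Fin N) (c : ℂ) (X : Module.End ℂ (F i)) :
    twistedTerm T r i (c • X) = c • twistedTerm T r i X := by
  rw [twistedTerm, swapOp_smul, PiTensorProduct.map_update_smul]; rfl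

lemma twistedTerm_zero (i : Fin N) : twistedTerm T r i (0 : Module.End ℂ (F i)) = 0 := by
  simpa using twistedTerm_smul (T := T) (r := r) i 0 (0 : Module.End ℂ (F i))

/-- Twice the square is `∑ (a_i a_k + a_k a_i)`, in which all terms with `i ≠ k` vanish. -/
lemma sum_mul_sum_of_anticommute {R ι : Type*} [Semiring R] [Algebra ℂ R] [Fintype ι]
    (a : ι → R) (h : ∀ i k, i ≠ k → a i * a k = (-1 : ℂ) • (a k * a i)) :
    (∑ i, a i) * ∑ i, a i = ∑ i, a i * a i := by
  classical
  have h1 : (∑ i, a i) * ∑ i, a i = ∑ i, ∑ k, a i * a k := Finset.sum_mul_sum _ _ _ _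
  have h2 : (∑ i, a i) * ∑ i, a i = ∑ i, ∑ k, a k * a i := by rw [h1, Finset.sum_comm]
  have h3 : (2 : ℂ) • ((∑ i, a i) * ∑ i, a i) = (2 : ℂ) • ∑ i, a i * a i := by
    rw [two_smul, two_smul]
    nth_rewrite 1 [h1]
    rw [h2, ← Finset.sum_add_distrib, ← Finset.sum_add_distrib]
    refine Finset.sum_congr rfl fun i _ => ?_
    rw [← Finset.sum_add_distrib, Finset.sum_eq_single i]
    · intro k _ hk
      have : (-1 : ℂ) • (a k * a i) + (1 : ℂ) • (a k * a i) = 0 := by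
        rw [← add_smul, neg_add_cancel, zero_smul]
      rwa [one_smul, ← h i k hk.symm] at this
    · simp
  have h4 := congrArg ((2⁻¹ : ℂ) • ·) h3
  simpa only [smul_smul, inv_mul_cancel₀ (two_ne_zero (α := ℂ)), one_smul] using h4

/-- If `X_i² = q_i` then the sum of the `twistedTerm`s has square `∑ q_i`. -/
lemma sum_twistedTerm_mul_self (hr : IsRanking T r) (X : ∀ i, Module.End ℂ (F i)) (q : Fin N → ℂ)
    (hX : ∀ i, X i * X i = q i • 1) :
    (∑ i, twistedTerm T r i (X i)) * ∑ i, twistedTerm T r i (X i) = (∑ i, q i) • 1 := by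
  rw [sum_mul_sum_of_anticommute _ fun i k hik => twistedTerm_anticomm hr hik _ _, Finset.sum_smul]
  refine Finset.sum_congr rfl fun i _ => ?_
  have e : LinearMap.prodMap (X i * X i) (X i * X i) = q i • (1 : Module.End ℂ (F i × F i)) := by
    rw [hX]
    exact LinearMap.ext fun ξ => rfl
  rw [twistedTerm_mul_self, e, PiTensorProduct.map_update_smul]
  congr 1
  have : Function.update (1 : ∀ i, Module.End ℂ (F i × F i)) i 1 = 1 := Function.update_eq_self i _
  rw [this]
  exact PiTensorProduct.map_one

/-- The diagonals survive because slots in `T` carry only the identity or `swapOp X`. The phase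
exchanges the two summands, which is harmless at `r i` because there `hphase` makes both subspaces
the whole space; `swapOp X` outside `T` is compatible because `X` exchanges `Fp i` and `Fm i`. -/
lemma twistedTerm_mem {Fp Fm : ∀ i, Submodule ℂ (F i)}
    (hphase : ∀ i ∈ T, ∀ j : Fin N, r i = j → Fp j = ⊤ ∧ Fm j = ⊤) (hr : IsRanking T r)
    (i : Fin N) (X : Module.End ℂ (F i)) (hp : ∀ s ∈ Fp i, X s ∈ Fm i)
    (hm : ∀ s ∈ Fm i, X s ∈ Fp i) {t : ⨂[ℂ] i, F i × F i} (ht : t ∈ tensorSub T Fp Fm) :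
    twistedTerm T r i X t ∈ tensorSub T Fp Fm := by
  refine map_mem_tensorSub _ (fun j ξ hξ => ?_) ht
  rw [mem_tensorFactor] at hξ ⊢
  by_cases hj : j = i
  · subst hj
    rw [Function.update_self, swapOp_apply]
    split_ifs at hξ ⊢
    · exact congrArg X hξ.symm
    · exact ⟨hm _ hξ.2, hp _ hξ.1⟩
  · rw [Function.update_of_ne hj]
    unfold siteOp
    split_ifs at hξ ⊢ with h1 h2 h3
    · exact hξ
    · exact ⟨hξ.1, Submodule.neg_mem _ hξ.2⟩
    · have hi : i ∈ T := by
        by_contra hi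
        exact hj (Fin.ext (h3.trans (hr.of_notMem i hi)))
      obtain ⟨e1, e2⟩ := hphase i hi j h3.symm
      rw [e1, e2]
      exact ⟨trivial, trivial⟩
    · exact hξ

/-- If the ranking puts the elements of `T` last, the twisted action is `cliffordTensor`. -/
lemma sum_twistedTerm_eq_cliffordTensor (hT : ∀ k ∈ T, ∀ j, j ≤ k)
    (hr : ∀ i, r i = if i ∈ T then N else i) (X : ∀ i, F i →ₗ[ℂ] F i) :
    ∑ i, twistedTerm T r i (X i) = cliffordTensor X := by
  refine Finset.sum_congr rfl fun i _ => ?_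
  unfold twistedTerm
  congr 1
  funext j
  by_cases hj : j = i
  · subst hj
    rw [Function.update_self, if_neg (lt_irrefl _), if_pos rfl]
    rfl
  · rw [Function.update_of_ne hj]
    unfold siteOp
    rw [hr]
    by_cases hjT : j ∈ T
    · rw [if_pos hjT, if_neg (not_lt.2 (hT j hjT i)), if_neg hj]; rfl
    · rw [if_neg hjT]
      by_cases hi : i ∈ T
      · rw [if_pos hi, if_pos j.2, if_pos (lt_of_le_of_ne (hT i hi j) hj)]; rfl
      · rw [if_neg hi]
        by_cases hlt : j < i
        · rw [if_pos hlt, if_pos (Fin.lt_def.1 hlt)]; rfl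
        · rw [if_neg hlt, if_neg (fun e => hlt (Fin.lt_def.2 e)), if_neg hj,
            if_neg fun e => hj (Fin.ext e)]
          rfl

end TwistedAction

/-! ### The twisted action as a representation of the Clifford algebra of the orthogonal sum -/

section ProductAction

variable {N : ℕ} {κ : Fin N → Type} [∀ i, Fintype (κ i)] {F : Fin N → Type v}
  [∀ i, AddCommGroup (F i)] [∀ i, Module ℂ (F i)]

/-- The action of a vector of the orthogonal sum on `⨂_i (F_i ⊕ F_i)`. -/
def vecAction (γ : ∀ i, Cl (κ i) →ₐ[ℝ] Module.End ℂ (F i)) (T : Finset (Fin N)) (r : Fin N → ℕ)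
    (v : (Σ i, κ i) → ℝ) : Module.End ℂ (⨂[ℂ] i, F i × F i) :=
  ∑ i, twistedTerm T r i (γ i (ι (stdForm (κ i)) fun a => v ⟨i, a⟩))

variable {γ : ∀ i, Cl (κ i) →ₐ[ℝ] Module.End ℂ (F i)} {T : Finset (Fin N)} {r : Fin N → ℕ}

lemma vecAction_add (v w : (Σ i, κ i) → ℝ) :
    vecAction γ T r (v + w) = vecAction γ T r v + vecAction γ T r w := by
  unfold vecAction
  rw [← Finset.sum_add_distrib]
  refine Finset.sum_congr rfl fun i _ => ?_
  rw [← twistedTerm_add, ← map_add, ← map_add]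
  rfl

lemma vecAction_smul (c : ℝ) (v : (Σ i, κ i) → ℝ) :
    vecAction γ T r (c • v) = (c : ℂ) • vecAction γ T r v := by
  unfold vecAction
  rw [Finset.smul_sum]
  refine Finset.sum_congr rfl fun i _ => ?_
  rw [← twistedTerm_smul, Complex.coe_smul, ← map_smul, ← map_smul]
  rfl

lemma vecAction_mul_self (hr : IsRanking T r) (v : (Σ i, κ i) → ℝ) :
    vecAction γ T r v * vecAction γ T r v = ((stdForm (Σ i, κ i) v : ℝ) : ℂ) • 1 := by
  have hq : ((stdForm (Σ i, κ i) v : ℝ) : ℂ) =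
      ∑ i, ((stdForm (κ i) (fun a => v ⟨i, a⟩) : ℝ) : ℂ) := by
    rw [← Complex.ofReal_sum]
    congr 1
    simp only [stdForm_apply, Fintype.sum_sigma, Finset.sum_neg_distrib]
  rw [hq]
  refine sum_twistedTerm_mul_self hr _ _ fun i => ?_
  rw [← map_mul, ι_sq_scalar, AlgHom.commutes, Algebra.algebraMap_eq_smul_one, Complex.coe_smul]

variable {S : Type v'} [AddCommGroup S] [Module ℂ S] {e : S →ₗ[ℂ] ⨂[ℂ] i, F i × F i}

/-- Linearity in `v` and the Clifford relation hold in the ambient tensor product and are pulled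
back along the injection `e`; the universal property then extends the action of vectors to the whole
algebra. -/
lemma exists_action (he : Function.Injective e) (hr : IsRanking T r)
    (a : ((Σ i, κ i) → ℝ) → Module.End ℂ S) (ha : ∀ v s, e (a v s) = vecAction γ T r v (e s)) :
    ∃ β : Cl (Σ i, κ i) →ₐ[ℝ] Module.End ℂ S,
      ∀ v s, e (β (ι (stdForm (Σ i, κ i)) v) s) = vecAction γ T r v (e s) := by
  let a' : ((Σ i, κ i) → ℝ) →ₗ[ℝ] Module.End ℂ S :=
    { toFun := a
      map_add' := fun v w => LinearMap.ext fun s => he (by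
        rw [ha, vecAction_add, LinearMap.add_apply, LinearMap.add_apply, map_add, ha, ha])
      map_smul' := fun c v => LinearMap.ext fun s => he (by
        rw [ha, vecAction_smul, LinearMap.smul_apply, RingHom.id_apply, LinearMap.smul_apply,
          ← Complex.coe_smul c (a v s), map_smul, ha]) }
  refine ⟨CliffordAlgebra.lift _ ⟨a', fun v => LinearMap.ext fun s => he ?_⟩, fun v s => ?_⟩
  · change e (a v (a v s)) = _
    rw [ha, ha, ← Module.End.mul_apply, vecAction_mul_self hr, Module.algebraMap_end_apply,
      ← Complex.coe_smul _ s, map_smul]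
    rfl
  · rw [CliffordAlgebra.lift_ι_apply]
    exact ha v s

lemma vecAction_incl (i : Fin N) (w : κ i → ℝ) :
    vecAction γ T r (incl i w) = twistedTerm T r i (γ i (ι (stdForm (κ i)) w)) := by
  unfold vecAction
  rw [Finset.sum_eq_single i]
  · congr 3
    funext a
    simp [incl_apply]
  · intro k _ hk
    have : (fun a => incl i w ⟨k, a⟩) = (0 : κ k → ℝ) := by
      funext a
      simp [incl_apply, Pi.single_eq_of_ne hk]
    rw [this, map_zero, map_zero, twistedTerm_zero]
  · simp

variable {β : Cl (Σ i, κ i) →ₐ[ℝ] Module.End ℂ S}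

/-- Even elements of one summand are built from scalars and pairs of vectors of that summand, and
such pairs act in slot `i` only by `twistedTerm_mul_self`. -/
lemma action_incl_even
    (hβ : ∀ v s, e (β (ι (stdForm (Σ i, κ i)) v) s) = vecAction γ T r v (e s))
    (i : Fin N) {x : Cl (κ i)} (hx : x ∈ CliffordAlgebra.even (stdForm (κ i))) (s : S) :
    e (β (CliffordAlgebra.map (incl i) x) s) =
      PiTensorProduct.map (Function.update 1 i (LinearMap.prodMap (γ i x) (γ i x))) (e s) := by
  have hx' : x ∈ evenOdd (stdForm (κ i)) 0 := hx
  clear hx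
  induction x, hx' using CliffordAlgebra.even_induction generalizing s with
  | algebraMap c =>
    have h1 : LinearMap.prodMap (γ i (algebraMap ℝ (Cl (κ i)) c)) (γ i (algebraMap ℝ (Cl (κ i)) c)) =
        (c : ℂ) • (1 : Module.End ℂ (F i × F i)) := by
      rw [AlgHom.commutes, Algebra.algebraMap_eq_smul_one, ← Complex.coe_smul]
      exact LinearMap.ext fun ξ => rfl
    have h2 : Function.update (1 : ∀ i, Module.End ℂ (F i × F i)) i 1 = 1 :=
      Function.update_eq_self i _
    have h3 : PiTensorProduct.map (1 : ∀ i, Module.End ℂ (F i × F i)) = LinearMap.id :=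
      PiTensorProduct.map_one
    rw [h1, PiTensorProduct.map_update_smul, h2, h3, AlgHom.commutes, AlgHom.commutes,
      Module.algebraMap_end_apply, ← Complex.coe_smul c s, map_smul]
    rfl
  | add x y hx hy ihx ihy =>
    have h1 : LinearMap.prodMap (γ i (x + y)) (γ i (x + y)) =
        LinearMap.prodMap (γ i x) (γ i x) + LinearMap.prodMap (γ i y) (γ i y) := by
      rw [map_add]
      exact LinearMap.ext fun ξ => rfl
    rw [h1, PiTensorProduct.map_update_add, map_add, map_add, LinearMap.add_apply,
      LinearMap.add_apply, map_add, ihx, ihy]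
  | ι_mul_ι_mul v w x hx ih =>
    rw [map_mul (CliffordAlgebra.map (incl i)), map_mul (CliffordAlgebra.map (incl i)), map_apply_ι,
      map_apply_ι, map_mul β, map_mul β, Module.End.mul_apply,
      Module.End.mul_apply, hβ, hβ, ih, vecAction_incl, vecAction_incl, ← Module.End.mul_apply,
      twistedTerm_mul_self, ← Module.End.mul_apply, ← PiTensorProduct.map_mul]
    congr 2
    funext j
    by_cases h : j = i
    · subst h
      simp only [Function.update_self, map_mul]
      exact LinearMap.ext fun ξ => rfl
    · simp only [Function.update_of_ne h, Pi.one_apply, mul_one]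

/-- Whatever `T` and `r` are, the twisted action restricts on `∏ Spin` to the factorwise action,
which is the one that glues the bundle `S`. This is what makes the twist admissible. -/
lemma action_spinProd
    (hβ : ∀ v s, e (β (ι (stdForm (Σ i, κ i)) v) s) = vecAction γ T r v (e s))
    (a : ∀ i, Spin (κ i)) (s : S) :
    e (β (spinProd a : Spin (Σ i, κ i)) s) =
      PiTensorProduct.map (fun i => LinearMap.prodMap (γ i (a i : Cl (κ i))) (γ i (a i))) (e s) := by
  have key : ∀ (U : Finset (Fin N)) (hc : (U : Set (Fin N)).Pairwise
      (Function.onFun Commute fun i => spinIncl i (a i))) (s : S),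
      e (β (U.noncommProd (fun i => spinIncl i (a i)) hc : Spin (Σ i, κ i)) s) =
        PiTensorProduct.map (fun i => if i ∈ U then
          LinearMap.prodMap (γ i (a i : Cl (κ i))) (γ i (a i)) else 1) (e s) := by
    intro U
    induction U using Finset.induction_on with
    | empty =>
      intro hc s
      have h3 : PiTensorProduct.map (fun i => (1 : Module.End ℂ (F i × F i))) = LinearMap.id :=
        PiTensorProduct.map_one
      simp only [Finset.noncommProd_empty, Submonoid.coe_one, map_one, Module.End.one_apply,
        Finset.notMem_empty, if_false]
      rw [h3]
      rfl
    | insert i U hi ih =>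
      intro hc s
      rw [Finset.noncommProd_insert_of_notMem _ _ _ _ hi, Submonoid.coe_mul, map_mul,
        Module.End.mul_apply]
      refine (action_incl_even hβ i (spinGroup.mem_even (a i).2) _).trans ?_
      rw [ih, ← Module.End.mul_apply, ← PiTensorProduct.map_mul]
      congr 2
      funext j
      by_cases h : j = i
      · subst h
        simp [hi]
      · simp [h]
  have h := key Finset.univ (fun i _ k _ hik => spinIncl_commute hik _ _) s
  simp only [Finset.mem_univ, if_true] at h
  rw [← h, spinProd, MonoidHom.noncommPiCoprod_apply]

end ProductAction

/-! ### Volume element and half spinors -/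

section Halves

variable {D : ℕ}

lemma vol_eq_monomialUnit : vol D = (monomialUnit (List.finRange D) : Cl (Fin D)) := by
  have h : ∀ l : List (Fin D), (monomialUnit l : Cl (Fin D)) = (l.map gen).prod := by
    intro l
    induction l with
    | nil => simp [monomialUnit]
    | cons k l ih =>
      rw [monomialUnit_cons, Units.val_mul, ih, List.map_cons, List.prod_cons]
      rfl
  rw [h]
  rfl

/-- A letter followed by `n` others contributes `n` signs for passing them and one more for `e_k² =
-1`. -/
lemma monomialUnit_mul_self {κ : Type} [Fintype κ] [DecidableEq κ] (m : List κ) (hm : m.Nodup) :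
    (monomialUnit m : Cl κ) * monomialUnit m =
      ((-1 : ℝ) ^ (∑ n ∈ Finset.range m.length, (n + 1))) • 1 := by
  induction m with
  | nil => simp [monomialUnit]
  | cons k m ih =>
    rw [List.nodup_cons] at hm
    have e : m.countP (fun j => j ≠ k) = m.length := by
      rw [List.countP_eq_length]
      intro j hj
      simpa using fun e : j = k => hm.1 (e ▸ hj)
    have h := gen_mul_monomialUnit k m
    rw [e] at h
    rw [monomialUnit_cons, Units.val_mul]
    change gen k * _ * (gen k * _) = _
    rw [← mul_assoc, h, smul_mul_assoc, smul_mul_assoc, mul_assoc (monomialUnit m : Cl κ),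
      gen_mul_self, mul_neg_one, neg_mul, ih hm.2, List.length_cons, Finset.sum_range_succ,
      pow_add, pow_succ]
    simp [smul_smul, mul_comm]

/-- For `D = 2n` the exponent `1 + ⋯ + D = n (2n + 1)` has the parity of `n`. -/
lemma vol_mul_vol (h : Even D) : vol D * vol D = ((-1 : ℝ) ^ (D / 2)) • 1 := by
  rw [vol_eq_monomialUnit, monomialUnit_mul_self _ (List.nodup_finRange D), List.length_finRange]
  congr 1
  obtain ⟨n, rfl⟩ := h
  rw [show (n + n) / 2 = n by omega]
  induction n with
  | zero => simp
  | succ n ih =>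
    rw [show n + 1 + (n + 1) = n + n + 1 + 1 by omega, Finset.sum_range_succ,
      Finset.sum_range_succ, pow_add, pow_add, ih, pow_succ _ n]
    rw [mul_assoc, ← pow_add, show n + n + 1 + (n + n + 1 + 1) = 2 * (n + n + 1) + 1 by ring,
      pow_succ _ (2 * _), pow_mul]
    simp

variable (Δ : SpinorModule.{v} (Fin D))

lemma normalizedVol_mul_self (h : Even D) :
    (Complex.I ^ (D / 2) • Δ.c (vol D)) * (Complex.I ^ (D / 2) • Δ.c (vol D)) = 1 := by
  rw [smul_mul_smul_comm, ← map_mul, vol_mul_vol h, map_smul, map_one, ← mul_pow, Complex.I_mul_I,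
    ← Complex.coe_smul, smul_smul]
  push_cast
  rw [← mul_pow]
  simp

/-- The halves are the complementary eigenspaces of an involution. Only the sum of their dimensions
matters, as `S_i^+ ⊕ S_i^-` enters as a whole. -/
lemma finrank_half_add (h : Even D) :
    Module.finrank ℂ (half Δ 1) + Module.finrank ℂ (half Δ (-1)) = Module.finrank ℂ Δ.carrier := by
  set J := Complex.I ^ (D / 2) • Δ.c (vol D) with hJ
  have hJ2 : ∀ x, J (J x) = x := fun x => by
    rw [← Module.End.mul_apply, hJ, normalizedVol_mul_self Δ h, Module.End.one_apply]
  have hh : ∀ ε, half Δ ε = Module.End.eigenspace J ε := fun ε => by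
    unfold half; rw [if_pos h]
  refine Submodule.finrank_add_eq_of_isCompl ⟨?_, ?_⟩
  · rw [Submodule.disjoint_def]
    intro x hx hx'
    rw [hh, Module.End.mem_eigenspace_iff] at hx hx'
    rw [hx, one_smul, neg_one_smul] at hx'
    have h2 : (2 : ℂ) • x = 0 := by
      rw [two_smul]
      exact eq_neg_iff_add_eq_zero.1 hx'
    exact (smul_eq_zero.1 h2).resolve_left two_ne_zero
  · rw [codisjoint_iff, eq_top_iff]
    intro x _
    rw [Submodule.mem_sup]
    refine ⟨(2⁻¹ : ℂ) • (x + J x), ?_, (2⁻¹ : ℂ) • (x - J x), ?_, ?_⟩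
    · rw [hh, Module.End.mem_eigenspace_iff, map_smul, map_add, hJ2, one_smul, add_comm]
    · rw [hh, Module.End.mem_eigenspace_iff, map_smul, map_sub, hJ2, neg_one_smul, ← smul_neg,
        neg_sub]
    · rw [← smul_add, add_add_sub_cancel, ← two_smul ℂ x, smul_smul,
        inv_mul_cancel₀ two_ne_zero, one_smul]

lemma half_of_odd (h : Odd D) (ε : ℂ) : half Δ ε = ⊤ := by
  unfold half
  rw [if_neg (Nat.not_even_iff_odd.2 h)]

/-- In positive even dimension vectors anticommute with the volume element; in odd dimension there
is nothing to show. -/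
lemma ι_mem_half {Δ : SpinorModule.{v} (Fin D)} {ε : ℂ} (w : Fin D → ℝ) {s : Δ.carrier}
    (hs : s ∈ half Δ ε) : Δ.c (ι (stdForm (Fin D)) w) s ∈ half Δ (-ε) := by
  by_cases h : Even D
  -- At `D = 0` the truncated `D - 1` is even and anticommutation is not available, but the only
  -- vector is zero.
  · rcases Nat.eq_zero_or_pos D with h0 | h0
    · subst h0
      rw [Subsingleton.elim w 0, map_zero, map_zero]
      exact Submodule.zero_mem _
    · unfold half at hs ⊢
      rw [if_pos h, Module.End.mem_eigenspace_iff] at hs ⊢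
      have ho : Odd (D - 1) := Nat.Even.sub_odd h0 h odd_one
      have hc := ι_mul_vol w
      rw [ho.neg_one_pow, neg_one_smul] at hc
      have hc' : vol D * ι (stdForm (Fin D)) w = -(ι (stdForm (Fin D)) w * vol D) := by
        rw [hc, neg_neg]
      rw [LinearMap.smul_apply, ← Module.End.mul_apply, ← map_mul, hc', map_neg, map_mul,
        LinearMap.neg_apply, Module.End.mul_apply, smul_neg, ← map_smul, ← LinearMap.smul_apply, hs,
        map_smul, neg_smul]
  · rw [half_of_odd Δ (Nat.not_even_iff_odd.1 h)]
    trivial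

lemma SpinorModule.finrank_eq {κ : Type} [Fintype κ] [DecidableEq κ] (Δ : SpinorModule.{v} κ) :
    Module.finrank ℂ Δ.carrier = 2 ^ (Fintype.card κ / 2) :=
  have := Δ.nontrivial
  finrank_of_irreducible Δ.irreducible

end Halves

/-! ### The standard fibre of `S` and its comparison with the spinor module -/

section StandardFibre

variable {N : ℕ} {D : Fin N → ℕ}

/-- The `i`-th factor has dimension `2^[D_i/2]`, doubled when `D_i` is odd and `i ∉ T`. This happens
for `[N_o/2]` indices, and `[D/2] = ∑ [D_i/2] + [N_o/2]`; the size of `T` is chosen for this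
equality. -/
lemma finrank_stdFiber (Δ : ∀ i, SpinorModule.{v} (Fin (D i))) (T : Finset (Fin N))
    (hT : ∀ i ∈ T, Odd (D i))
    (hcard : T.card = (Finset.univ.filter fun i => Odd (D i)).card -
      (Finset.univ.filter fun i => Odd (D i)).card / 2) :
    Module.finrank ℂ (stdFiber Δ T) = 2 ^ ((∑ i, D i) / 2) := by
  have hfac : ∀ i, Module.finrank ℂ (tensorFactor T (fun i => half (Δ i) 1)
      (fun i => half (Δ i) (-1)) i) = 2 ^ (D i / 2 + if Odd (D i) ∧ i ∉ T then 1 else 0) := by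
    intro i
    have hd : Module.finrank ℂ (Δ i).carrier = 2 ^ (D i / 2) := by
      rw [(Δ i).finrank_eq, Fintype.card_fin]
    unfold tensorFactor
    by_cases hi : i ∈ T
    · rw [if_pos hi, if_neg (fun h => h.2 hi), add_zero, ← hd]
      exact LinearEquiv.finrank_eq
        { toFun := fun ξ => ξ.1.1
          map_add' := fun _ _ => rfl
          map_smul' := fun _ _ => rfl
          invFun := fun s => ⟨(s, s), rfl⟩
          left_inv := fun ξ => Subtype.ext (Prod.ext rfl ξ.2)
          right_inv := fun _ => rfl }
    · have e : (half (Δ i) 1).prod (half (Δ i) (-1)) ≃ₗ[ℂ] half (Δ i) 1 × half (Δ i) (-1) :=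
        { toFun := fun ξ => (⟨ξ.1.1, ξ.2.1⟩, ⟨ξ.1.2, ξ.2.2⟩)
          map_add' := fun _ _ => rfl
          map_smul' := fun _ _ => rfl
          invFun := fun ξ => ⟨(ξ.1.1, ξ.2.1), ξ.1.2, ξ.2.2⟩
          left_inv := fun _ => rfl
          right_inv := fun _ => rfl }
      rw [if_neg hi, e.finrank_eq, Module.finrank_prod]
      by_cases ho : Odd (D i)
      · rw [if_pos ⟨ho, hi⟩, half_of_odd _ ho, half_of_odd _ ho, finrank_top, hd]
        ring
      · rw [if_neg (fun h => ho h.1), add_zero, finrank_half_add _ (Nat.not_odd_iff_even.1 ho), hd]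
  rw [stdFiber, finrank_tensorSub, Finset.prod_congr rfl fun i _ => hfac i,
    Finset.prod_pow_eq_pow_sum, Finset.sum_add_distrib]
  congr 1
  set O := Finset.univ.filter fun i => Odd (D i) with hO
  have h1 : ∑ i, D i = 2 * ∑ i, D i / 2 + O.card := by
    rw [Finset.mul_sum, hO, Finset.card_filter, ← Finset.sum_add_distrib]
    refine Finset.sum_congr rfl fun i _ => ?_
    split_ifs with h
    · obtain ⟨k, hk⟩ := h; omega
    · obtain ⟨k, hk⟩ := Nat.not_odd_iff_even.1 h; omega
  have h2 : ∑ i, (if Odd (D i) ∧ i ∉ T then 1 else 0) = O.card - T.card := by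
    have hsub : T ⊆ O := fun i hi => by simpa [hO] using hT i hi
    rw [← Finset.card_sdiff_of_subset hsub, ← Finset.card_filter]
    congr 1
    ext i
    simp [hO]
  rw [h2, hcard, h1]
  omega

/-- The set `T` has at most one element more than the set of odd indices outside it, so it embeds
into that set with one point added. If `T` contains at most the last index, no partner is used, so
that the twisted action is the Clifford multiplication of `W`. -/
lemma exists_ranking (T : Finset (Fin N)) (hT : ∀ i ∈ T, Odd (D i))
    (hcard : T.card = (Finset.univ.filter fun i => Odd (D i)).card -
      (Finset.univ.filter fun i => Odd (D i)).card / 2) :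
    ∃ r : Fin N → ℕ, IsRanking T r ∧ (∀ i ∈ T, ∀ j : Fin N, r i = j → Odd (D j)) ∧
      ((∀ k ∈ T, ∀ j, j ≤ k) → ∀ i, r i = if i ∈ T then N else i) := by
  by_cases hlast : ∀ k ∈ T, ∀ j, j ≤ k
  · refine ⟨fun i => if i ∈ T then N else i, ⟨fun i hi => if_neg hi, fun i hi k hk _ =>
      le_antisymm (hlast k hk i) (hlast i hi k), fun i hi j h => ?_, fun i hi => (if_pos hi).le⟩,
      fun i hi j h => ?_, fun _ _ => rfl⟩
    · rw [if_pos hi] at h; exact absurd j.2 (by omega)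
    · simp only [if_pos hi] at h; exact absurd j.2 (by omega)
  · set O := Finset.univ.filter fun i => Odd (D i) with hO
    have hsub : T ⊆ O := fun i hi => by simpa [hO] using hT i hi
    have hc : Fintype.card T ≤ Fintype.card (Option (O \ T : Finset (Fin N))) := by
      rw [Fintype.card_option, Fintype.card_coe, Fintype.card_coe, Finset.card_sdiff_of_subset hsub]
      omega
    obtain ⟨f⟩ := Function.Embedding.nonempty_of_card_le hc
    -- The added point becomes `N`, which is no slot: the index sent there has no phase operator and
    -- puts the grading on every slot outside `T` other than its own.
    let q : Option (O \ T : Finset (Fin N)) → ℕ := fun o => o.elim N fun u => (u.1 : ℕ)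
    have hq : Function.Injective q := by
      rintro (_ | u) (_ | u') h
      · rfl
      · exact absurd u'.1.2 (by simp only [q, Option.elim] at h; omega)
      · exact absurd u.1.2 (by simp only [q, Option.elim] at h; omega)
      · exact congrArg some (Subtype.ext (Fin.ext h))
    have hqj : ∀ o (j : Fin N), q o = j → j ∈ O \ T := by
      rintro (_ | u) j h
      · exact absurd j.2 (by simp only [q, Option.elim] at h; omega)
      · rw [← show u.1 = j from Fin.ext h]; exact u.2
    have hqN : ∀ o, q o ≤ N := by
      rintro (_ | u)
      · exact le_rfl
      · exact u.1.2.le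
    refine ⟨fun i => if h : i ∈ T then q (f ⟨i, h⟩) else i,
      ⟨fun i hi => dif_neg hi, fun i hi k hk h => ?_, fun i hi j h => ?_, fun i hi => ?_⟩,
      fun i hi j h => ?_, fun h => absurd h hlast⟩
    · rw [dif_pos hi, dif_pos hk] at h
      exact congrArg Subtype.val (f.injective (hq h))
    · rw [dif_pos hi] at h
      exact (Finset.mem_sdiff.1 (hqj _ _ h)).2
    · rw [dif_pos hi]
      exact hqN _
    · simp only [dif_pos hi] at h
      simpa [hO] using (Finset.mem_sdiff.1 (hqj _ _ h)).1

lemma vecAction_mem_stdFiber {Δ : ∀ i, SpinorModule.{v} (Fin (D i))} {T : Finset (Fin N)}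
    {r : Fin N → ℕ} (hr : IsRanking T r) (hodd : ∀ i ∈ T, ∀ j : Fin N, r i = j → Odd (D j))
    (v : (Σ i, Fin (D i)) → ℝ) {t : ⨂[ℂ] i, (Δ i).carrier × (Δ i).carrier}
    (ht : t ∈ stdFiber Δ T) : vecAction (fun i => (Δ i).c) T r v t ∈ stdFiber Δ T := by
  rw [vecAction, LinearMap.sum_apply]
  refine Submodule.sum_mem _ fun i _ => twistedTerm_mem (fun k hk j h =>
    ⟨half_of_odd _ (hodd k hk j h) _, half_of_odd _ (hodd k hk j h) _⟩) hr i _ ?_ ?_ ht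
  · intro s hs
    exact ι_mem_half _ hs
  · intro s hs
    simpa using ι_mem_half (fun a => v ⟨i, a⟩) hs

/-- In a product of an even number of vectors the signs cancel, `ε² = 1`. So either of the two
irreducible modules in odd dimension gives the same representation of `Spin`. -/
lemma intertwines_even {κ : Type} [Fintype κ] {A : Type v} [AddCommGroup A] [Module ℂ A]
    {B : Type v'} [AddCommGroup B] [Module ℂ B] {α : Cl κ →ₐ[ℝ] Module.End ℂ A}
    {β : Cl κ →ₐ[ℝ] Module.End ℂ B} (L : A →ₗ[ℂ] B) {ε : ℝ} (hε : ε = 1 ∨ ε = -1)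
    (hL : ∀ v x, L (α (ι (stdForm κ) v) x) = (ε : ℂ) • β (ι (stdForm κ) v) (L x)) {z : Cl κ}
    (hz : z ∈ CliffordAlgebra.even (stdForm κ)) (x : A) : L (α z x) = β z (L x) := by
  have hz' : z ∈ evenOdd (stdForm κ) 0 := hz
  clear hz
  have hεε : ε * ε = 1 := by rcases hε with rfl | rfl <;> norm_num
  induction z, hz' using CliffordAlgebra.even_induction generalizing x with
  | algebraMap c =>
    rw [AlgHom.commutes, AlgHom.commutes, Module.algebraMap_end_apply, Module.algebraMap_end_apply,
      ← Complex.coe_smul, ← Complex.coe_smul, map_smul]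
  | add y z hy hz ihy ihz =>
    rw [map_add, map_add, LinearMap.add_apply, LinearMap.add_apply, map_add, ihy, ihz]
  | ι_mul_ι_mul v w z hz ih =>
    simp only [map_mul, Module.End.mul_apply]
    rw [hL, hL, ih, map_smul, smul_smul, ← Complex.ofReal_mul,
      hεε, Complex.ofReal_one, one_smul]

/-- Equivariance of a map of standard fibres under the product of the spin groups. -/
def SpinEquivariant {Δ : ∀ i, SpinorModule.{v} (Fin (D i))}
    {Δ₀ : SpinorModule.{v'} (Σ i, Fin (D i))} {T : Finset (Fin N)}
    (L : stdFiber Δ T ≃ₗ[ℂ] Δ₀.carrier) : Prop :=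
  ∀ (a : ∀ i, Spin (Fin (D i))) (s s' : stdFiber Δ T),
    s'.1 = PiTensorProduct.map (fun i => LinearMap.prodMap
      ((Δ i).c (a i : Cl (Fin (D i)))) ((Δ i).c (a i))) s.1 →
    L s' = Δ₀.c (spinProd a : Spin (Σ i, Fin (D i))) (L s)

/-- The standard fibre of `S` is isomorphic to the spinor module of the orthogonal sum, compatibly
with the product of the spin groups and, up to a sign, with the Clifford action. -/
theorem exists_stdFiber_equiv (Δ : ∀ i, SpinorModule.{v} (Fin (D i)))
    (Δ₀ : SpinorModule.{v'} (Σ i, Fin (D i))) (T : Finset (Fin N)) (hT : ∀ i ∈ T, Odd (D i))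
    (hcard : T.card = (Finset.univ.filter fun i => Odd (D i)).card -
      (Finset.univ.filter fun i => Odd (D i)).card / 2)
    {r : Fin N → ℕ} (hr : IsRanking T r) (hodd : ∀ i ∈ T, ∀ j : Fin N, r i = j → Odd (D j)) :
    ∃ (L : stdFiber Δ T ≃ₗ[ℂ] Δ₀.carrier) (ε : ℝ), (ε = 1 ∨ ε = -1) ∧ (Even (∑ i, D i) → ε = 1) ∧
      SpinEquivariant L ∧
      ∀ (v : (Σ i, Fin (D i)) → ℝ) (s s' : stdFiber Δ T),
        s'.1 = vecAction (fun i => (Δ i).c) T r v s.1 →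
        L s' = (ε : ℂ) • Δ₀.c (ι (stdForm _) v) (L s) := by
  have hinj : Function.Injective (stdFiber Δ T).subtype := Subtype.val_injective
  obtain ⟨β, hβ⟩ := exists_action (γ := fun i => (Δ i).c) (S := stdFiber Δ T)
    (e := (stdFiber Δ T).subtype) hinj hr
    (fun v => (vecAction (fun i => (Δ i).c) T r v).restrict
      fun t ht => vecAction_mem_stdFiber hr hodd v ht) (fun v s => by rfl)
  have hcardκ : Fintype.card (Σ i, Fin (D i)) = ∑ i, D i := by simp
  have := Δ₀.nontrivial
  -- The map is built from `Δ₀` to the standard fibre, since irreducibility is known only for `Δ₀`;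
  -- the equality of dimensions replaces it on the other side. The inverse satisfies the same
  -- relation because `ε² = 1`.
  obtain ⟨ε, hε, heven, L₀, hL₀⟩ := exists_equiv_of_irreducible (B := stdFiber Δ T) (β := β)
    Δ₀.irreducible (by
    rw [finrank_stdFiber Δ T hT hcard, Δ₀.finrank_eq, hcardκ])
  have hεε : ε * ε = 1 := by rcases hε with rfl | rfl <;> norm_num
  refine ⟨L₀.symm, ε, hε, fun h => heven (by rwa [hcardκ]), fun a s s' h => ?_,
    fun v s s' h => ?_⟩
  · have h1 : s' = β (spinProd a : Spin (Σ i, Fin (D i))) s :=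
      hinj (h.trans (action_spinProd hβ a s).symm)
    rw [h1, LinearEquiv.symm_apply_eq]
    have := intertwines_even (B := stdFiber Δ T) L₀.toLinearMap hε hL₀
      (spinGroup.mem_even (spinProd a).2) (L₀.symm s)
    simpa using this.symm
  · have h1 : s' = β (ι (stdForm _) v) s := hinj (h.trans (hβ v s).symm)
    rw [h1, LinearEquiv.symm_apply_eq, map_smul, hL₀, LinearEquiv.apply_symm_apply,
      smul_smul, ← Complex.ofReal_mul, hεε, Complex.ofReal_one, one_smul]

end StandardFibre

/-! ### From the standard fibres to the bundles -/

section BundleIsomorphism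

lemma congr_cliffordTensor {N : ℕ} {F : Fin N → Type v} [∀ i, AddCommGroup (F i)]
    [∀ i, Module ℂ (F i)] {G : Fin N → Type v'} [∀ i, AddCommGroup (G i)] [∀ i, Module ℂ (G i)]
    (e : ∀ i, F i ≃ₗ[ℂ] G i) (X : ∀ i, F i →ₗ[ℂ] F i) (Y : ∀ i, G i →ₗ[ℂ] G i)
    (h : ∀ i s, e i (X i s) = Y i (e i s)) (t : ⨂[ℂ] i, F i × F i) :
    PiTensorProduct.congr (fun i => (e i).prodCongr (e i)) (cliffordTensor X t) =
      cliffordTensor Y (PiTensorProduct.congr (fun i => (e i).prodCongr (e i)) t) := by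
  unfold cliffordTensor
  rw [LinearMap.sum_apply, LinearMap.sum_apply, map_sum]
  refine Finset.sum_congr rfl fun i _ => ?_
  induction t using PiTensorProduct.induction_on with
  | smul_tprod c ξ =>
    simp only [map_smul, PiTensorProduct.map_tprod, PiTensorProduct.congr_tprod]
    congr 2
    funext j
    split_ifs with h1 h2
    · exact Prod.ext rfl (map_neg (e j) _)
    · exact Prod.ext (h j _) (h j _)
    · rfl
  | add t t' ht ht' => simp only [map_add, ht, ht']

variable {N : ℕ} {E : Fin N → Type} [∀ j, NormedAddCommGroup (E j)]
  [∀ j, NormedSpace ℝ (E j)] {H : Fin N → Type} [∀ j, TopologicalSpace (H j)]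
  {I : ∀ j, ModelWithCorners ℝ (E j) (H j)}
  {M : Fin N → Type u} [∀ j, TopologicalSpace (M j)] [∀ j, ChartedSpace (H j) (M j)]
  [∀ j, IsManifold (I j) ∞ (M j)] {D : Fin N → ℕ}
  {g : ∀ j, OrientedRiemannian (I j) (M j) (Fin (D j))}
  (P : ∀ j, SpinStructure.{u, w, w'} (g j))

/-- A change of point within the reduction is a change by an element of `∏ Spin(D_i)`, so
equivariance under this product suffices below. -/
lemma div_reduction {x : ∀ j, M j} (p q : ∀ j, (P j).fiber (x j)) :
    (inducedSpinStructure P).div (reduction P p) (reduction P q) =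
      spinProd fun j => (P j).div (p j) (q j) := by
  change (spinProd _)⁻¹⁻¹ * (spinProd _)⁻¹ = _
  rw [inv_inv, ← map_inv, ← map_mul]
  refine congrArg spinProd (funext fun j => ?_)
  rw [Pi.mul_apply, Pi.inv_apply, mul_inv_eq_iff_eq_mul, ← (P j).div_act_right, (P j).act_div]

lemma frame_reduction {x : ∀ j, M j} (p : ∀ j, (P j).fiber (x j)) :
    (inducedSpinStructure P).frame (reduction P p) = productFrame fun j => (P j).frame (p j) := by
  change (productFrame fun j => (P j).frame (basePoint P x j)).rotate
    ((reduction P p).toFun (basePoint P x)) = _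
  rw [frame_indep P (reduction P p) p]
  have : (reduction P p).toFun p = 1 := by
    change (spinProd _)⁻¹ = 1
    rw [inv_eq_one, ← map_one spinProd]
    exact congrArg spinProd (funext fun j => (P j).div_self _)
  rw [this, Frame.rotate_one]

lemma frame_reduction_symm {x : ∀ j, M j} (p : ∀ j, (P j).fiber (x j))
    (X : TangentSpace (ModelWithCorners.pi I) x) (k : Σ j, Fin (D j)) :
    ((inducedSpinStructure P).frame (reduction P p)).toEquiv.symm X k =
      ((P k.1).frame (p k.1)).toEquiv.symm ((tangentSum x).symm X k.1) k.2 := by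
  rw [frame_reduction]
  rfl

variable {P} {Δ : ∀ j, SpinorModule.{v} (Fin (D j))} {Δ₀ : SpinorModule.{v'} (Σ i, Fin (D i))}
  {T : Finset (Fin N)} (L : stdFiber Δ T ≃ₗ[ℂ] Δ₀.carrier)

/-- The isomorphism of fibres given by an isomorphism of the standard fibres. -/
def fiberEquiv (x : ∀ j, M j) :
    productFiber P Δ T x ≃ₗ[ℂ] spinorFiber (inducedSpinStructure P) Δ₀ x :=
  ((productEval Δ T (basePoint P x)).trans L).trans
    (evalAt (P := inducedSpinStructure P) (reduction P (basePoint P x))).symm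

variable {L}

/-- The isomorphism of fibres was defined with an arbitrary base point, chosen without continuity.
Equivariance of `L` makes it independent of that choice, which yields both the compatibility with
the reduction and the smoothness. -/
lemma evalAt_fiberEquiv (hL : SpinEquivariant L) {x : ∀ j, M j} (p : ∀ j, (P j).fiber (x j))
    (s : productFiber P Δ T x) :
    evalAt (P := inducedSpinStructure P) (reduction P p) (fiberEquiv L x s) =
      L (productEval Δ T p s) := by
  set b := basePoint P x
  have h1 : evalAt (P := inducedSpinStructure P) (reduction P p) (fiberEquiv L x s) =
      Δ₀.c ((inducedSpinStructure P).div (reduction P p) (reduction P b) : Spin (Σ i, Fin (D i)))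
        (L (productEval Δ T b s)) :=
    evalAt_symm_apply (P := inducedSpinStructure P) _ _ _
  rw [h1, div_reduction]
  refine (hL _ _ _ ?_).symm
  have h2 := productEval_transition Δ T b p (productEval Δ T b s)
  rw [LinearEquiv.symm_apply_apply] at h2
  exact h2

lemma evalAt_fiberEquiv_symm (hL : SpinEquivariant L) {x : ∀ j, M j} (p : ∀ j, (P j).fiber (x j))
    (σ : spinorFiber (inducedSpinStructure P) Δ₀ x) :
    productEval Δ T p ((fiberEquiv L x).symm σ) =
      L.symm (evalAt (P := inducedSpinStructure P) (reduction P p) σ) := by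
  rw [LinearEquiv.eq_symm_apply, ← evalAt_fiberEquiv hL, LinearEquiv.apply_symm_apply]

/-- The isomorphism of bundles given by an isomorphism of the standard fibres which is equivariant
under the product of the spin groups. -/
def bundleIso (hL : SpinEquivariant L) :
    (productSpinorBundle P Δ T).Iso (spinorBundle (inducedSpinStructure P) Δ₀) where
  equiv x := fiberEquiv L x
  smooth a b s := by
    -- In the trivializations given by local sections of `∏ P_j` the isomorphism is the constant `L`
    -- applied to a transition function of `S`.
    refine ((smoothOn_productEval (P := P) Δ T a b s).linear
      (L.toLinearMap.restrictScalars ℝ)).congr fun x _ => ?_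
    exact evalAt_fiberEquiv hL _ _
  smooth_symm a b s := by
    refine ((smoothOn_productEval (P := P) Δ T b a (L.symm s)).mono fun x hx =>
      ⟨hx.2, hx.1⟩).congr fun x _ => ?_
    refine congrArg (productEval Δ T fun j => (P j).sec (a j) (x j)) ?_
    refine (LinearEquiv.eq_symm_apply (productEval Δ T fun j => (P j).sec (b j) (x j))).2 ?_
    refine (evalAt_fiberEquiv_symm hL _ _).trans ?_
    exact congrArg L.symm (LinearEquiv.apply_symm_apply _ _)

lemma evalAt_cliffordMul {E H : Type} [NormedAddCommGroup E] [NormedSpace ℝ E] [TopologicalSpace H]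
    {I : ModelWithCorners ℝ E H} {M : Type u} [TopologicalSpace M] [ChartedSpace H M]
    [IsManifold I ∞ M] {κ : Type} [Fintype κ] [DecidableEq κ] {g : OrientedRiemannian I M κ}
    (P : SpinStructure.{u, w, w'} g) (Δ : SpinorModule.{v} κ) {x : M} (p : P.fiber x)
    (X : TangentSpace I x) (s : spinorFiber P Δ x) :
    evalAt p (cliffordMul P Δ X s) =
      Δ.c (ι (stdForm κ) ((P.frame p).toEquiv.symm X)) (evalAt p s) := rfl

/-- Clifford multiplication of `W` in terms of the standard fibre. -/
lemma congr_evalAt_cliffordTensor {r : Fin N → ℕ} (hT : ∀ k ∈ T, ∀ j, j ≤ k)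
    (hr : ∀ i, r i = if i ∈ T then N else i) {x : ∀ j, M j} (p : ∀ j, (P j).fiber (x j))
    (X : TangentSpace (ModelWithCorners.pi I) x)
    (t : ⨂[ℂ] i, spinorFiber (P i) (Δ i) (x i) × spinorFiber (P i) (Δ i) (x i)) :
    PiTensorProduct.congr (fun i => (evalAt (Δ := Δ i) (p i)).prodCongr (evalAt (p i)))
        (cliffordTensor (fun i => cliffordMul (P i) (Δ i) ((tangentSum x).symm X i)) t) =
      vecAction (fun i => (Δ i).c) T r
        (((inducedSpinStructure P).frame (reduction P p)).toEquiv.symm X)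
        (PiTensorProduct.congr (fun i => (evalAt (Δ := Δ i) (p i)).prodCongr (evalAt (p i))) t) := by
  rw [vecAction, sum_twistedTerm_eq_cliffordTensor hT hr]
  refine congr_cliffordTensor _ _ _ (fun i s => ?_) t
  rw [evalAt_cliffordMul]
  simp only [frame_reduction_symm]

lemma mem_productFiber_iff {x : ∀ j, M j} (p : ∀ j, (P j).fiber (x j))
    (t : ⨂[ℂ] i, spinorFiber (P i) (Δ i) (x i) × spinorFiber (P i) (Δ i) (x i)) :
    t ∈ productFiber P Δ T x ↔ PiTensorProduct.congr
      (fun i => (evalAt (Δ := Δ i) (p i)).prodCongr (evalAt (p i))) t ∈ stdFiber Δ T := by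
  have h := tensorSub_map T (fun i => evalAt (Δ := Δ i) (p i))
    (fun i => halfFiber_map (P i) (Δ i) 1 (p i)) fun i => halfFiber_map (P i) (Δ i) (-1) (p i)
  rw [stdFiber, ← h, productFiber]
  constructor
  · exact fun ht => ⟨t, ht, rfl⟩
  · rintro ⟨t', ht', e⟩
    rwa [← LinearEquiv.injective _ e]

end BundleIsomorphism

end SpinProduct

end

theorem proposition4 {N : ℕ} (D : Fin N → ℕ)
    (M : Fin N → Type u) [∀ i, TopologicalSpace (M i)]
    [∀ i, ChartedSpace (EuclideanSpace ℝ (Fin (D i))) (M i)]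
    [∀ i, IsManifold (𝓡 (D i)) ∞ (M i)]
    (g : ∀ i, SpinProduct.OrientedRiemannian (𝓡 (D i)) (M i) (Fin (D i)))
    (P : ∀ i, SpinProduct.SpinStructure.{u, w, w'} (g i))
    (Δ : ∀ i, SpinProduct.SpinorModule.{v} (Fin (D i)))
    (Δ₀ : SpinProduct.SpinorModule.{v'} (Σ i, Fin (D i)))
    (T : Finset (Fin N)) (hT : ∀ i ∈ T, Odd (D i))
    (hcard : T.card = (Finset.univ.filter fun i => Odd (D i)).card -
      (Finset.univ.filter fun i => Odd (D i)).card / 2) :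
    ∃ φ : (SpinProduct.productSpinorBundle P Δ T).Iso
        (SpinProduct.spinorBundle (SpinProduct.inducedSpinStructure P) Δ₀),
      (∃ L : SpinProduct.stdFiber Δ T ≃ₗ[ℂ] Δ₀.carrier,
        ∀ (x : ∀ i, M i) (p : ∀ i, (P i).fiber (x i)) (s : SpinProduct.productFiber P Δ T x),
          SpinProduct.evalAt (P := SpinProduct.inducedSpinStructure P)
              (SpinProduct.reduction P p) (φ.equiv x s) =
            L (SpinProduct.productEval Δ T p s)) ∧
      ((∀ k ∈ T, ∀ j, j ≤ k) →
        ∃ ε : ℝ, (ε = 1 ∨ ε = -1) ∧ (Even (∑ i, D i) → ε = 1) ∧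
          ∀ (x : ∀ i, M i)
            (X : TangentSpace (ModelWithCorners.pi fun i => 𝓡 (D i)) x)
            (s : SpinProduct.productFiber P Δ T x),
            ∃ h : SpinProduct.cliffordTensor (fun i => SpinProduct.cliffordMul (P i) (Δ i)
                ((SpinProduct.tangentSum x).symm X i)) s.1 ∈ SpinProduct.productFiber P Δ T x,
              φ.equiv x ⟨_, h⟩ = (ε : ℂ) •
                SpinProduct.cliffordMul (SpinProduct.inducedSpinStructure P) Δ₀ X
                  (φ.equiv x s)) := by
  obtain ⟨r, hr, hodd, hlast⟩ := SpinProduct.exists_ranking T hT hcard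
  obtain ⟨L, ε, hε, heven, hspin, hcliff⟩ :=
    SpinProduct.exists_stdFiber_equiv Δ Δ₀ T hT hcard hr hodd
  refine ⟨SpinProduct.bundleIso hspin, ⟨L, fun x p s => SpinProduct.evalAt_fiberEquiv hspin p s⟩,
    fun hl => ⟨ε, hε, heven, fun x X s => ?_⟩⟩
  -- In the coordinates of one point of `∏ P_i` the multiplication of `W` is the twisted action.
  -- This gives the stability of `S` and then reduces the formula for `φ` to that for `L`.
  have key := SpinProduct.congr_evalAt_cliffordTensor (Δ := Δ) hl (hlast hl)
    (SpinProduct.basePoint P x) X s.1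
  refine ⟨(SpinProduct.mem_productFiber_iff (SpinProduct.basePoint P x) _).2 ?_, ?_⟩
  · rw [key]
    exact SpinProduct.vecAction_mem_stdFiber hr hodd _
      ((SpinProduct.mem_productFiber_iff (SpinProduct.basePoint P x) _).1 s.2)
  · apply (SpinProduct.evalAt (P := SpinProduct.inducedSpinStructure P) (Δ := Δ₀)
      (SpinProduct.reduction P (SpinProduct.basePoint P x))).injective
    refine (SpinProduct.evalAt_fiberEquiv hspin _ _).trans ?_
    refine (hcliff (((SpinProduct.inducedSpinStructure P).frame
      (SpinProduct.reduction P (SpinProduct.basePoint P x))).toEquiv.symm X)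
      (SpinProduct.productEval Δ T (SpinProduct.basePoint P x) s) _ key).trans ?_
    rw [← SpinProduct.evalAt_fiberEquiv hspin]
    rfl
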